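/- Let $k$ be a field, $B$ a finite-dimensional commutative $k$-algebra and $A \subset B$ a $k$-subalgebra. Denote by $\mu^B$ the group scheme of units of $B$, i.e. $\mu^B(R) = (B \otimes_k R)^*$ for every commutative $k$-algebra $R$ (and similarly for other algebras), and by $\mu^{B/A} := \mu^B/\mu^A$ the quotient group scheme, i.e. the quotient in the sense of fppf sheaves. Let $I \subset J$ be the nilradicals of $A \subset B$, put $A_{\rm red} := A/I \subset B/J =: B_{\rm red}$, and let $A_{\rm sep} \subset B_{\rm sep}$ be the largest separable (i.e. étale) subalgebras of $A_{\rm red}$ and $B_{\rm red}$. Let $1+J \subset \mu^B$ denote the subgroup $R \mapsto 1 + J \otimes_k R$, and likewise $1 + I \subset \mu^A$; the quotient $(1+J)/(1+I)$ is again a quotient of fppf sheaves. Then: (i) The inclusion $B_{\rm sep} \subset B_{\rm red}$ lifts uniquely to a homomorphism of algebras $s : B_{\rm sep} \to B$; it satisfies $s(A_{\rm sep}) \subset A$, and the induced homomorphism $\mu^{B_{\rm sep}/A_{\rm sep}} \to \mu^{B/A}$ identifies $\mu^{B_{\rm sep}/A_{\rm sep}}$ with the maximal torus of $\mu^{B/A}$: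 it is a closed immersion, its source is a torus, and for every field extension $K/k$ (in particular for $K = k$), every subtorus of $(\mu^{B/A})_K$ is contained in $(\mu^{B_{\rm sep}/A_{\rm sep}})_K$. (ii) Suppose that $B_{\rm red} = B_{\rm sep}$ (this holds whenever $k$ is perfect). Then $A_{\rm red} = A_{\rm sep}$, and there is an isomorphism $$\mu^{B/A} \cong (1+J)/(1+I) \times \mu^{B_{\rm red}/A_{\rm red}},$$ whose second projection is the natural homomorphism $\mu^{B/A} \to \mu^{B_{\rm red}/A_{\rm red}}$ and whose first projection restricts to the identity along the natural homomorphism $(1+J)/(1+I) \to \mu^{B/A}$. Moreover $(1+J)/(1+I)$ is a unipotent affine group scheme of finite type, and $\mu^{B_{\rm red}/A_{\rm red}}$ is a torus. -/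

import Mathlib

open CategoryTheory Opposite
open scoped TensorProduct

universe u

namespace RelUnits

noncomputable section

/-! ### Commutative group functors and the fppf topology -/

/-- Commutative group functors on commutative `k`-algebras (groups are written additively).
The values live one universe up, so that fppf sheafification stays within this category. -/
abbrev GrpFunctor (k : Type u) [Field k] := CommAlgCat.{u} k ⥤ AddCommGrpCat.{u + 1}

/-- A finite family of affine `k`-schemes over `X` is an fppf covering: all members are flat and
of finite presentation, and they are jointly surjective on spectra. -/
def IsFppfCovering {k : Type u} [Field k] {X : (CommAlgCat.{u} k)ᵒᵖ} {ι : Type}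
    (Y : ι → (CommAlgCat.{u} k)ᵒᵖ) (f : ∀ i, Y i ⟶ X) : Prop :=
  (∀ i, (f i).unop.hom.toRingHom.Flat ∧ (f i).unop.hom.toRingHom.FinitePresentation) ∧
    ∀ p : PrimeSpectrum X.unop, ∃ i, ∃ q : PrimeSpectrum (Y i).unop,
      PrimeSpectrum.comap (f i).unop.hom.toRingHom q = p

theorem exists_comap_tensor {R S T : Type u} [CommRing R] [CommRing S] [CommRing T] [Algebra R S]
    [Algebra R T] (p : PrimeSpectrum S) (q : PrimeSpectrum T)
    (h : PrimeSpectrum.comap (algebraMap R T) q = PrimeSpectrum.comap (algebraMap R S) p) :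
    ∃ r : PrimeSpectrum (S ⊗[R] T), PrimeSpectrum.comap (algebraMap S (S ⊗[R] T)) r = p := by
  set m := PrimeSpectrum.comap (algebraMap R S) p with hm
  change p ∈ Set.range _
  rw [← PrimeSpectrum.nontrivial_iff_mem_rangeComap]
  have hT : Nontrivial (m.asIdeal.ResidueField ⊗[R] T) :=
    (PrimeSpectrum.nontrivial_iff_mem_rangeComap m).2 ⟨q, h⟩
  let : Algebra m.asIdeal.ResidueField p.asIdeal.ResidueField :=
    (Ideal.ResidueField.map m.asIdeal p.asIdeal (algebraMap R S)
      (congrArg PrimeSpectrum.asIdeal hm)).toAlgebra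
  have : IsScalarTower R m.asIdeal.ResidueField p.asIdeal.ResidueField := by
    refine .of_algebraMap_eq fun x => ?_
    rw [IsScalarTower.algebraMap_apply R S p.asIdeal.ResidueField x]
    exact (Ideal.ResidueField.map_algebraMap m.asIdeal p.asIdeal (algebraMap R S)
      (congrArg PrimeSpectrum.asIdeal hm) x).symm
  have e1 := (Algebra.TensorProduct.cancelBaseChange R m.asIdeal.ResidueField
    m.asIdeal.ResidueField p.asIdeal.ResidueField T).toEquiv
  have e2 := (Algebra.TensorProduct.cancelBaseChange R S S p.asIdeal.ResidueField T).toEquiv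
  exact (e2.trans e1.symm).nontrivial

/-- The fppf topology on the category of affine `k`-schemes. -/
def fppfTopology (k : Type u) [Field k] : GrothendieckTopology (CommAlgCat.{u} k)ᵒᵖ where
  sieves X := {S | ∃ (ι : Type) (_ : Finite ι) (Y : ι → (CommAlgCat.{u} k)ᵒᵖ)
    (f : ∀ i, Y i ⟶ X), IsFppfCovering Y f ∧ ∀ i, S (f i)}
  top_mem' X := by
    refine ⟨Unit, inferInstance, fun _ => X, fun _ => 𝟙 X, ⟨fun _ => ⟨?_, ?_⟩, ?_⟩, fun _ => trivial⟩
    · exact RingHom.Flat.id _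
    · exact RingHom.FinitePresentation.id _
    · exact fun p => ⟨(), p, rfl⟩
  pullback_stable' X X' S g := by
    rintro ⟨ι, _, Y, f, ⟨hf, hsurj⟩, hS⟩
    let : Algebra X.unop X'.unop := g.unop.hom.toRingHom.toAlgebra
    let algY : ∀ i, Algebra X.unop (Y i).unop := fun i => (f i).unop.hom.toRingHom.toAlgebra
    have : IsScalarTower k X.unop X'.unop := .of_algebraMap_eq fun x => (g.unop.hom.commutes x).symm
    have (i : ι) : IsScalarTower k X.unop (Y i).unop :=
      .of_algebraMap_eq fun x => ((f i).unop.hom.commutes x).symm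
    have hfl (i : ι) : Module.Flat X.unop (Y i).unop := (hf i).1
    have hfp (i : ι) : Algebra.FinitePresentation X.unop (Y i).unop := (hf i).2
    refine ⟨ι, inferInstance, fun i => op (.of k (X'.unop ⊗[X.unop] (Y i).unop)),
      fun i => (CommAlgCat.ofHom (IsScalarTower.toAlgHom k X'.unop
        (X'.unop ⊗[X.unop] (Y i).unop))).op, ⟨fun i => ⟨?_, ?_⟩, fun p => ?_⟩, fun i => ?_⟩
    · exact RingHom.flat_algebraMap_iff.2
        (inferInstance : Module.Flat X'.unop (X'.unop ⊗[X.unop] (Y i).unop))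
    · exact RingHom.finitePresentation_algebraMap.2
        (inferInstance : Algebra.FinitePresentation X'.unop (X'.unop ⊗[X.unop] (Y i).unop))
    · obtain ⟨i, q, hq⟩ := hsurj (PrimeSpectrum.comap g.unop.hom.toRingHom p)
      obtain ⟨r, hr⟩ := exists_comap_tensor p q hq
      exact ⟨i, r, hr⟩
    · have : (CommAlgCat.ofHom (IsScalarTower.toAlgHom k X'.unop
          (X'.unop ⊗[X.unop] (Y i).unop))).op ≫ g =
          (CommAlgCat.ofHom ((Algebra.TensorProduct.includeRight (R := X.unop) (A := X'.unop)
            (B := (Y i).unop)).restrictScalars k)).op ≫ f i := by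
        apply Quiver.Hom.unop_inj
        ext x
        exact (Algebra.TensorProduct.tmul_one_eq_one_tmul (R := X.unop) (A := X'.unop) (B := (Y i).unop) x)
      change S.arrows (_ ≫ g)
      rw [this]
      exact S.downward_closed (hS i) _
  transitive' X S hS R hR := by
    obtain ⟨ι, _, Y, f, ⟨hf, hsurj⟩, hS⟩ := hS
    choose κ hκ Z g hg hR using fun i => hR (hS i)
    refine ⟨Σ i, κ i, inferInstance, fun x => Z x.1 x.2, fun x => g x.1 x.2 ≫ f x.1,
      ⟨fun x => ⟨?_, ?_⟩, fun p => ?_⟩, fun x => hR x.1 x.2⟩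
    · exact RingHom.Flat.comp (hf x.1).1 ((hg x.1).1 x.2).1
    · exact RingHom.FinitePresentation.comp ((hg x.1).1 x.2).2 (hf x.1).2
    · obtain ⟨i, q, rfl⟩ := hsurj p
      obtain ⟨j, r, rfl⟩ := (hg i).2 q
      exact ⟨⟨i, j⟩, r, rfl⟩

/-- The fppf sheaf associated with a commutative group functor. -/
def fppfSheafify {k : Type u} [Field k] (F : GrpFunctor k) : GrpFunctor k :=
  opOp _ ⋙ sheafify (fppfTopology k) (unopUnop _ ⋙ F)

/-- Functoriality of the associated fppf sheaf. -/
def fppfSheafifyMap {k : Type u} [Field k] {F G : GrpFunctor k} (f : F ⟶ G) :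
    fppfSheafify F ⟶ fppfSheafify G :=
  Functor.whiskerLeft (opOp _) (sheafifyMap (fppfTopology k) (Functor.whiskerLeft (unopUnop _) f))

/-- The quotient `G / N` of a commutative group functor by (the image of) `φ : N ⟶ G`, in the sense
of fppf sheaves: the fppf sheaf associated with `R ↦ G(R) / φ(N(R))`. -/
def fppfQuotient {k : Type u} [Field k] {N G : GrpFunctor k} (φ : N ⟶ G) : GrpFunctor k :=
  fppfSheafify (Limits.cokernel φ)

/-- The map `G / N ⟶ G' / N'` induced by a commutative square. -/
def fppfQuotientMap {k : Type u} [Field k] {N G N' G' : GrpFunctor k} (φ : N ⟶ G) (φ' : N' ⟶ G')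
    (a : N ⟶ N') (b : G ⟶ G') (h : φ ≫ b = a ≫ φ') : fppfQuotient φ ⟶ fppfQuotient φ' :=
  fppfSheafifyMap (Limits.cokernel.map φ φ' a b h)

/-! ### Unit groups and relative unit groups -/

section units

variable {k : Type u} [Field k] {A B A' B' : Type u} [CommRing A] [CommRing B]
  [CommRing A'] [CommRing B'] [Algebra k A] [Algebra k B] [Algebra k A'] [Algebra k B']

/-- The map `(A ⊗ R)ˣ → (B ⊗ S)ˣ` induced by algebra maps `A → B` and `R → S`. -/
def tensorUnitsMap (f : A →ₐ[k] B) {R S : Type u} [CommRing R] [CommRing S] [Algebra k R]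
    [Algebra k S] (g : R →ₐ[k] S) : (A ⊗[k] R)ˣ →* (B ⊗[k] S)ˣ :=
  Units.map (Algebra.TensorProduct.map f g).toRingHom.toMonoidHom

/-- The unit group `μ^A : R ↦ (A ⊗ R)ˣ` of a commutative `k`-algebra `A`. -/
def mu (k : Type u) [Field k] (A : Type u) [CommRing A] [Algebra k A] : GrpFunctor k where
  obj R := AddCommGrpCat.of (ULift.{u + 1} (Additive (A ⊗[k] R)ˣ))
  map {R S} g := AddCommGrpCat.uliftFunctor.{u + 1, u}.map
    (AddCommGrpCat.ofHom (tensorUnitsMap (AlgHom.id k A) g.hom).toAdditive)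
  map_id R := by
    ext x
    refine ULift.ext _ _ (Units.ext ?_)
    exact DFunLike.congr_fun (Algebra.TensorProduct.map_id (R := k) (S := k) (A := A) (B := R)) _
  map_comp f g := by
    ext x
    refine ULift.ext _ _ (Units.ext ?_)
    exact DFunLike.congr_fun (Algebra.TensorProduct.map_comp (AlgHom.id k A) (AlgHom.id k A)
      g.hom f.hom) _

/-- The homomorphism `μ^A ⟶ μ^B` induced by a homomorphism of algebras `A → B`. -/
def muMap (f : A →ₐ[k] B) : mu k A ⟶ mu k B where
  app R := AddCommGrpCat.uliftFunctor.{u + 1, u}.map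
    (AddCommGrpCat.ofHom (tensorUnitsMap f (AlgHom.id k R)).toAdditive)
  naturality R S g := by
    ext x
    refine ULift.ext _ _ (Units.ext ?_)
    exact (DFunLike.congr_fun (Algebra.TensorProduct.map_comp f (AlgHom.id k A)
      (AlgHom.id k S) g.hom) _).symm.trans
      (DFunLike.congr_fun (Algebra.TensorProduct.map_comp (AlgHom.id k B) f
      g.hom (AlgHom.id k R)) _)

/-- The relative unit group `μ^{B/A} = μ^B / μ^A` of an extension of algebras `A → B`
(in all uses below, `A → B` is the inclusion of a subalgebra). -/
def relMu (f : A →ₐ[k] B) : GrpFunctor k := fppfQuotient (muMap f)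

theorem muMap_comm {f : A →ₐ[k] B} {f' : A' →ₐ[k] B'} {a : A →ₐ[k] A'} {b : B →ₐ[k] B'}
    (h : b.comp f = f'.comp a) : muMap f ≫ muMap b = muMap a ≫ muMap f' := by
  ext R x
  refine ULift.ext _ _ (Units.ext ?_)
  refine (DFunLike.congr_fun (Algebra.TensorProduct.map_comp b f
    (AlgHom.id k R) (AlgHom.id k R)) _).symm.trans ?_
  rw [h]
  exact DFunLike.congr_fun (Algebra.TensorProduct.map_comp f' a
    (AlgHom.id k R) (AlgHom.id k R)) _

/-- The homomorphism `μ^{B/A} ⟶ μ^{B'/A'}` induced by a commutative square of algebras. -/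
def relMuMap (f : A →ₐ[k] B) (f' : A' →ₐ[k] B') (a : A →ₐ[k] A') (b : B →ₐ[k] B')
    (h : b.comp f = f'.comp a) : relMu f ⟶ relMu f' :=
  fppfQuotientMap (muMap f) (muMap f') (muMap a) (muMap b) (muMap_comm h)

/-- The units of `A ⊗ R` that are congruent to `1` modulo the ideal `I ⊗ R` generated by `I`.
For `I` nilpotent this is all of `1 + I ⊗ R`. -/
def onePlusSubgroup (I : Ideal A) (R : Type u) [CommRing R] [Algebra k R] :
    Subgroup (A ⊗[k] R)ˣ :=
  (Units.map (Ideal.Quotient.mk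
    (I.map (algebraMap A (A ⊗[k] R)))).toMonoidHom).ker

theorem mem_onePlusSubgroup {I : Ideal A} {R : Type u} [CommRing R] [Algebra k R]
    {x : (A ⊗[k] R)ˣ} :
    x ∈ onePlusSubgroup I R ↔ (x : A ⊗[k] R) - 1 ∈ I.map (algebraMap A (A ⊗[k] R)) := by
  rw [onePlusSubgroup, MonoidHom.mem_ker, Units.ext_iff, ← Ideal.Quotient.eq]
  rfl

theorem tensorUnitsMap_mem {I : Ideal A} {J : Ideal B} {f : A →ₐ[k] B} (h : I ≤ J.comap f)
    {R S : Type u} [CommRing R] [CommRing S] [Algebra k R] [Algebra k S] (g : R →ₐ[k] S)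
    {x : (A ⊗[k] R)ˣ} (hx : x ∈ onePlusSubgroup I R) :
    tensorUnitsMap f g x ∈ onePlusSubgroup J S := by
  rw [mem_onePlusSubgroup] at hx ⊢
  have key : I.map (algebraMap A (A ⊗[k] R)) ≤
      (J.map (algebraMap B (B ⊗[k] S))).comap (Algebra.TensorProduct.map f g) := by
    rw [Ideal.map_le_iff_le_comap]
    intro a ha
    have : Algebra.TensorProduct.map f g (algebraMap A (A ⊗[k] R) a) =
        algebraMap B (B ⊗[k] S) (f a) := by simp
    rw [Ideal.mem_comap, Ideal.mem_comap, this]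
    exact Ideal.mem_map_of_mem _ (h ha)
  have := key hx
  rwa [Ideal.mem_comap, map_sub, map_one] at this

/-- The map `1 + I ⊗ R → 1 + J ⊗ S` induced by `A → B` mapping `I` to `J` and by `R → S`. -/
def onePlusHom {I : Ideal A} {J : Ideal B} (f : A →ₐ[k] B) (h : I ≤ J.comap f)
    {R S : Type u} [CommRing R] [CommRing S] [Algebra k R] [Algebra k S] (g : R →ₐ[k] S) :
    onePlusSubgroup (k := k) I R →* onePlusSubgroup (k := k) J S :=
  ((tensorUnitsMap f g).comp (Subgroup.subtype _)).codRestrict _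
    fun x => tensorUnitsMap_mem h g x.2

/-- The group functor `1 + I : R ↦ 1 + I ⊗ R`, for a nilpotent ideal `I` of `A`. -/
def onePlus (k : Type u) [Field k] {A : Type u} [CommRing A] [Algebra k A] (I : Ideal A) :
    GrpFunctor k where
  obj R := AddCommGrpCat.of (ULift.{u + 1} (Additive (onePlusSubgroup (k := k) I R)))
  map {R S} g := AddCommGrpCat.uliftFunctor.{u + 1, u}.map
    (AddCommGrpCat.ofHom (onePlusHom (I := I) (J := I) (AlgHom.id k A) le_rfl g.hom).toAdditive)
  map_id R := by
    ext x
    refine ULift.ext _ _ (Subtype.ext (Units.ext ?_))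
    exact DFunLike.congr_fun (Algebra.TensorProduct.map_id (R := k) (S := k) (A := A) (B := R)) _
  map_comp f g := by
    ext x
    refine ULift.ext _ _ (Subtype.ext (Units.ext ?_))
    exact DFunLike.congr_fun (Algebra.TensorProduct.map_comp (AlgHom.id k A) (AlgHom.id k A)
      g.hom f.hom) _

/-- The homomorphism `1 + I ⟶ 1 + J` induced by `A → B` mapping `I` to `J`. -/
def onePlusMap {I : Ideal A} {J : Ideal B} (f : A →ₐ[k] B) (h : I ≤ J.comap f) :
    onePlus k I ⟶ onePlus k J where
  app R := AddCommGrpCat.uliftFunctor.{u + 1, u}.map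
    (AddCommGrpCat.ofHom (onePlusHom f h (AlgHom.id k R)).toAdditive)
  naturality R S g := by
    ext x
    refine ULift.ext _ _ (Subtype.ext (Units.ext ?_))
    exact (DFunLike.congr_fun (Algebra.TensorProduct.map_comp f (AlgHom.id k A)
      (AlgHom.id k S) g.hom) _).symm.trans
      (DFunLike.congr_fun (Algebra.TensorProduct.map_comp (AlgHom.id k B) f
      g.hom (AlgHom.id k R)) _)

/-- The inclusion `1 + I ⟶ μ^A`. -/
def onePlusIncl (k : Type u) [Field k] {A : Type u} [CommRing A] [Algebra k A] (I : Ideal A) :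
    onePlus k I ⟶ mu k A where
  app R := AddCommGrpCat.uliftFunctor.{u + 1, u}.map
    (AddCommGrpCat.ofHom (onePlusSubgroup (k := k) I R).subtype.toAdditive)
  naturality _ _ _ := rfl

/-- The quotient `(1 + J) / (1 + I)`. -/
def relOnePlus {I : Ideal A} {J : Ideal B} (f : A →ₐ[k] B) (h : I ≤ J.comap f) : GrpFunctor k :=
  fppfQuotient (onePlusMap f h)

/-- The natural homomorphism `(1 + J) / (1 + I) ⟶ μ^{B/A}`. -/
def relOnePlusIncl {I : Ideal A} {J : Ideal B} (f : A →ₐ[k] B) (h : I ≤ J.comap f) :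
    relOnePlus f h ⟶ relMu f :=
  fppfQuotientMap (onePlusMap f h) (muMap f) (onePlusIncl k I) (onePlusIncl k J) rfl

end units

/-! ### Tori, closed immersions, unipotent groups -/

/-- A commutative group functor is an affine group scheme of finite type if it is represented by a
`k`-algebra of finite type. -/
def IsAffineGroupScheme {k : Type u} [Field k] (G : GrpFunctor k) : Prop :=
  ∃ H : CommAlgCat.{u} k, Algebra.FiniteType k H ∧
    Nonempty (G ⋙ forget AddCommGrpCat.{u + 1} ≅ coyoneda.obj (op H) ⋙ uliftFunctor.{u + 1, u})

/-- Restriction of scalars from `K`-algebras to `k`-algebras. -/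
def restrictAlg (k K : Type u) [Field k] [Field K] [Algebra k K] :
    CommAlgCat.{u} K ⥤ CommAlgCat.{u} k where
  obj R := @CommAlgCat.of k _ R _ (Algebra.compHom R (algebraMap k K))
  map {R S} f :=
    letI := Algebra.compHom R (algebraMap k K)
    letI := Algebra.compHom S (algebraMap k K)
    CommAlgCat.ofHom
      { (f.hom : R →+* S) with commutes' := fun x => f.hom.commutes (algebraMap k K x) }

/-- The base change `G_K` of a group functor `G` to a field extension `K` of `k`. -/
abbrev baseChange {k : Type u} [Field k] (K : Type u) [Field K] [Algebra k K] (G : GrpFunctor k) :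
    GrpFunctor K :=
  restrictAlg k K ⋙ G

/-- The base change of a homomorphism of group functors to a field extension. -/
abbrev baseChangeMap {k : Type u} [Field k] (K : Type u) [Field K] [Algebra k K]
    {G H : GrpFunctor k} (f : G ⟶ H) : baseChange K G ⟶ baseChange K H :=
  Functor.whiskerLeft (restrictAlg k K) f

/-- The split torus `𝔾ₘⁿ : R ↦ (Rˣ)ⁿ`. -/
def splitTorus (k : Type u) [Field k] (n : ℕ) : GrpFunctor k where
  obj R := AddCommGrpCat.of (ULift.{u + 1} (Additive (Fin n → Rˣ)))
  map {R S} g := AddCommGrpCat.uliftFunctor.{u + 1, u}.map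
    (AddCommGrpCat.ofHom (MonoidHom.compLeft
      (Units.map g.hom.toRingHom.toMonoidHom) (Fin n)).toAdditive)

/-- A torus over a field: an affine group scheme of finite type that becomes isomorphic to some
`𝔾ₘⁿ` over an algebraic closure. -/
def IsTorus {k : Type u} [Field k] (T : GrpFunctor k) : Prop :=
  IsAffineGroupScheme T ∧
    ∃ n : ℕ, Nonempty (baseChange (AlgebraicClosure k) T ≅ splitTorus (AlgebraicClosure k) n)

/-- A homomorphism `f : G ⟶ H` is a closed immersion if it identifies `G` with a closed subfunctor
of `H`: for every `h ∈ H(R)`, the condition that `h` comes from `G` is given by an ideal of `R`. -/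
def IsClosedImmersion {k : Type u} [Field k] {G H : GrpFunctor k} (f : G ⟶ H) : Prop :=
  (∀ R, Function.Injective (f.app R)) ∧
    ∀ (R : CommAlgCat.{u} k) (h : H.obj R), ∃ I : Ideal R, ∀ (S : CommAlgCat.{u} k) (φ : R ⟶ S),
      (∃ g : G.obj S, f.app S g = H.map φ h) ↔ ∀ x ∈ I, φ.hom x = 0

/-- `j : T ⟶ G` exhibits `T` as the maximal torus of the commutative group `G`: `T` is a torus, `j`
is a closed immersion and, over every field extension `K` of `k` (in particular over `k`),
`T_K` contains every subtorus of `G_K`. -/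
def IsMaximalTorus {k : Type u} [Field k] {T G : GrpFunctor k} (j : T ⟶ G) : Prop :=
  IsTorus T ∧ IsClosedImmersion j ∧
    ∀ (K : Type u) [Field K] [Algebra k K] (T' : GrpFunctor K) (i : T' ⟶ baseChange K G),
      IsTorus T' → IsClosedImmersion i →
        ∃ f : T' ⟶ baseChange K T, f ≫ baseChangeMap K j = i

/-- An `n`-dimensional linear representation of `G`: a homomorphism of group functors to `GLₙ`. -/
structure Representation {k : Type u} [Field k] (G : GrpFunctor k) (n : ℕ) where
  ρ : ∀ R : CommAlgCat.{u} k, Multiplicative (G.obj R) →* GL (Fin n) R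
  naturality : ∀ {R S : CommAlgCat.{u} k} (φ : R ⟶ S) (g : G.obj R),
    ρ S (.ofAdd (G.map φ g)) =
      Matrix.GeneralLinearGroup.map φ.hom.toRingHom (ρ R (.ofAdd g))

/-- An affine group scheme of finite type is unipotent if each of its nonzero finite-dimensional
representations has a nonzero fixed vector. -/
def IsUnipotent {k : Type u} [Field k] (G : GrpFunctor k) : Prop :=
  IsAffineGroupScheme G ∧
    ∀ (n : ℕ) (V : Representation G n), 0 < n → ∃ v : Fin n → k, v ≠ 0 ∧
      ∀ (R : CommAlgCat.{u} k) (g : G.obj R),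
        (V.ρ R (.ofAdd g) : Matrix (Fin n) (Fin n) R).mulVec (fun i => algebraMap k R (v i)) =
          fun i => algebraMap k R (v i)

/-! ### Reduced quotients and largest separable subalgebras -/

section sep

variable {k : Type u} [Field k]

/-- The largest separable (that is, étale) `k`-subalgebra of a subalgebra `C` of a finite-dimensional
commutative algebra `D`. -/
def sepPart {D : Type u} [CommRing D] [Algebra k D] (C : Subalgebra k D) : Subalgebra k D :=
  sSup {S | S ≤ C ∧ Algebra.Etale k S}

theorem sepPart_isGreatest {D : Type u} [CommRing D] [Algebra k D] [Module.Finite k D]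
    (C : Subalgebra k D) : IsGreatest {S | S ≤ C ∧ Algebra.Etale k S} (sepPart C) := by
  have hsup : ∀ S T : Subalgebra k D, Algebra.Etale k S → Algebra.Etale k T →
      Algebra.Etale k (S ⊔ T : Subalgebra k D) := by
    intro S T hS hT
    have h1 : Algebra.FormallyUnramified k (S ⊗[k] T) := .comp k S (S ⊗[k] T)
    have hr := Algebra.TensorProduct.productMap_range S.val T.val
    rw [Subalgebra.range_val, Subalgebra.range_val] at hr
    rw [← hr]
    have h2 := Algebra.FormallyUnramified.of_surjective
      (Algebra.TensorProduct.productMap S.val T.val).rangeRestrict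
      (AlgHom.rangeRestrict_surjective _)
    have h3 := Algebra.FormallyEtale.of_formallyUnramified_of_field k
      (Algebra.TensorProduct.productMap S.val T.val).range
    exact ⟨h3, Algebra.FinitePresentation.of_finiteType.1 inferInstance⟩
  have hbot : Algebra.Etale k (⊥ : Subalgebra k D) := by
    have h2 := Algebra.FormallyUnramified.of_surjective (Algebra.ofId k (⊥ : Subalgebra k D))
      (fun ⟨_, x, hx⟩ => ⟨x, Subtype.ext hx⟩)
    have h3 := Algebra.FormallyEtale.of_formallyUnramified_of_field k (⊥ : Subalgebra k D)
    exact ⟨h3, Algebra.FinitePresentation.of_finiteType.1 inferInstance⟩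
  have hwf : WellFoundedGT (Subalgebra k D) :=
    (Subalgebra.toSubmodule (R := k) (A := D)).strictMono.wellFoundedGT
  obtain ⟨S, ⟨hSC, hS⟩, hmax⟩ := WellFounded.has_min hwf.wf
    {S : Subalgebra k D | S ≤ C ∧ Algebra.Etale k S} ⟨⊥, bot_le, hbot⟩
  have hS' : IsGreatest {S | S ≤ C ∧ Algebra.Etale k S} S := by
    refine ⟨⟨hSC, hS⟩, fun T hT => ?_⟩
    by_contra hTS
    exact hmax (S ⊔ T) ⟨sup_le hSC hT.1, hsup S T hS hT.2⟩
      (lt_of_le_of_ne le_sup_left fun h => hTS (h ▸ le_sup_right))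
  rw [sepPart, hS'.isLUB.sSup_eq]
  exact hS'

theorem sepPart_mono {D : Type u} [CommRing D] [Algebra k D] {C C' : Subalgebra k D}
    (h : C ≤ C') : sepPart C ≤ sepPart C' :=
  sSup_le_sSup fun _ hS => ⟨hS.1.trans h, hS.2⟩

variable {B : Type u} [CommRing B] [Algebra k B] (A : Subalgebra k B)

/-- The reduced quotient `B_red` of `B`. -/
abbrev Red (B : Type u) [CommRing B] : Type u := B ⧸ nilradical B

/-- The quotient map `B → B_red`. -/
abbrev toRed (k : Type u) [Field k] (B : Type u) [CommRing B] [Algebra k B] : B →ₐ[k] Red B :=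
  Ideal.Quotient.mkₐ k (nilradical B)

/-- The reduced quotient `A_red` of a subalgebra `A` of `B`, regarded as a subalgebra of `B_red`:
it is the image of `A`, see `ker_toRedSub`. -/
abbrev redSub : Subalgebra k (Red B) := A.map (toRed k B)

/-- The quotient map `A → A_red`. -/
def toRedSub : A →ₐ[k] redSub A :=
  ((toRed k B).comp A.val).codRestrict _ fun x => ⟨x, x.2, rfl⟩

theorem toRedSub_surjective : Function.Surjective (toRedSub A) := by
  rintro ⟨_, x, hx, rfl⟩
  exact ⟨⟨x, hx⟩, rfl⟩

theorem ker_toRedSub : RingHom.ker (toRedSub A) = nilradical A := by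
  ext x
  have h1 : x ∈ RingHom.ker (toRedSub A) ↔ toRed k B (x : B) = 0 :=
    (RingHom.mem_ker).trans Subtype.ext_iff
  rw [h1, Ideal.Quotient.mkₐ_eq_mk, Ideal.Quotient.eq_zero_iff_mem, mem_nilradical, mem_nilradical]
  exact IsNilpotent.map_iff (f := A.val) Subtype.val_injective

/-- `B_sep`, the largest separable subalgebra of `B_red`. -/
abbrev sepTop (k : Type u) [Field k] (B : Type u) [CommRing B] [Algebra k B] :
    Subalgebra k (Red B) := sepPart ⊤

/-- `A_sep`, the largest separable subalgebra of `A_red`. -/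
abbrev sepSub : Subalgebra k (Red B) := sepPart (redSub A)

/-- The inclusion `A_sep ⊂ B_sep`. -/
abbrev sepIncl : sepSub A →ₐ[k] sepTop k B := Subalgebra.inclusion (sepPart_mono le_top)

theorem nilradical_le : nilradical A ≤ (nilradical B).comap A.val := by
  intro x hx
  rw [Ideal.mem_comap, mem_nilradical]
  exact (mem_nilradical.1 hx).map A.val

/-- The homomorphism `μ^{B_sep/A_sep} ⟶ μ^{B/A}` induced by an algebra map `s : B_sep → B` that
sends `A_sep` to `A`. -/
def sepToRelMu (s : sepTop k B →ₐ[k] B) (hs : ∀ x, s (sepIncl A x) ∈ A) :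
    relMu (sepIncl A) ⟶ relMu A.val :=
  relMuMap (sepIncl A) A.val ((s.comp (sepIncl A)).codRestrict A hs) s rfl

/-- The natural homomorphism `μ^{B/A} ⟶ μ^{B_red/A_red}`. -/
def relMuToRed : relMu A.val ⟶ relMu (redSub A).val :=
  relMuMap A.val (redSub A).val (toRedSub A) (toRed k B) rfl

/-- The group `(1 + J) / (1 + I)`, where `I ⊂ J` are the nilradicals of `A ⊂ B`. -/
abbrev nilQuot : GrpFunctor k := relOnePlus A.val (nilradical_le A)

/-- The natural homomorphism `(1 + J) / (1 + I) ⟶ μ^{B/A}`. -/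
abbrev nilQuotIncl : nilQuot A ⟶ relMu A.val := relOnePlusIncl A.val (nilradical_le A)

end sep

end

end RelUnits

open CategoryTheory.Limits RelUnits

namespace RelUnits

/-- A single-morphism fppf covering of affine schemes. -/
structure IsCover {k : Type u} [Field k] {R S : CommAlgCat.{u} k} (φ : R ⟶ S) : Prop where
  flat : φ.hom.toRingHom.Flat
  finitePresentation : φ.hom.toRingHom.FinitePresentation
  surjective : Function.Surjective (PrimeSpectrum.comap φ.hom.toRingHom)

/-- A commutative group functor is an fppf sheaf. -/
def IsFppfSheaf {k : Type u} [Field k] (G : GrpFunctor k) : Prop :=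
  Presheaf.IsSheaf (fppfTopology k) (unopUnop _ ⋙ G)

variable {k : Type u} [Field k]

theorem isFppfSheaf_fppfSheafify (F : GrpFunctor k) : IsFppfSheaf (fppfSheafify F) :=
  ((presheafToSheaf (fppfTopology k) AddCommGrpCat.{u + 1}).obj (unopUnop _ ⋙ F)).property

/-- The canonical map from a group functor to its associated fppf sheaf. -/
noncomputable def fppfUnit (F : GrpFunctor k) : F ⟶ fppfSheafify F :=
  Functor.whiskerLeft (opOp _) (toSheafify (fppfTopology k) (unopUnop _ ⋙ F))

/-- The universal property of the associated sheaf. -/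
noncomputable def fppfDesc {F Z : GrpFunctor k} (α : F ⟶ Z) (hZ : IsFppfSheaf Z) :
    fppfSheafify F ⟶ Z :=
  Functor.whiskerLeft (opOp _) (sheafifyLift (fppfTopology k) (Functor.whiskerLeft (unopUnop _) α)
    hZ)

theorem fppfUnit_desc {F Z : GrpFunctor k} (α : F ⟶ Z) (hZ : IsFppfSheaf Z) :
    fppfUnit F ≫ fppfDesc α hZ = α :=
  congrArg (Functor.whiskerLeft (opOp _)) (toSheafify_sheafifyLift (fppfTopology k)
    (Functor.whiskerLeft (unopUnop _) α) hZ)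

theorem fppfUnit_map {F G : GrpFunctor k} (α : F ⟶ G) :
    fppfUnit F ≫ fppfSheafifyMap α = α ≫ fppfUnit G :=
  congrArg (Functor.whiskerLeft (opOp _)) (toSheafify_naturality (fppfTopology k)
    (Functor.whiskerLeft (unopUnop _) α)).symm

theorem fppfSheafify_hom_ext {F Z : GrpFunctor k} (hZ : IsFppfSheaf Z) {α β : fppfSheafify F ⟶ Z}
    (h : fppfUnit F ≫ α = fppfUnit F ≫ β) : α = β := by
  have := sheafify_hom_ext (fppfTopology k) (P := unopUnop _ ⋙ F)
    (Functor.whiskerLeft (unopUnop _) α) (Functor.whiskerLeft (unopUnop _) β) hZ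
    (congrArg (Functor.whiskerLeft (unopUnop _)) h)
  exact congrArg (Functor.whiskerLeft (opOp _)) this

theorem IsCover.mem {R S : CommAlgCat.{u} k} {φ : R ⟶ S} (h : IsCover φ)
    {U : Sieve (op R)} (hU : U φ.op) : U ∈ fppfTopology k (op R) :=
  ⟨Unit, inferInstance, fun _ => op S, fun _ => φ.op, ⟨fun _ => ⟨h.flat, h.finitePresentation⟩,
    fun p => ⟨(), h.surjective p⟩⟩, fun _ => hU⟩

theorem isFppfSheaf_iff {G : GrpFunctor k} :
    IsFppfSheaf G ↔ Presieve.IsSheaf (fppfTopology k) (unopUnop _ ⋙ G ⋙ forget AddCommGrpCat) := by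
  rw [IsFppfSheaf, Presheaf.isSheaf_iff_isSheaf_forget (fppfTopology k) _ (forget AddCommGrpCat),
    isSheaf_iff_isSheaf_of_type]
  rfl

theorem IsFppfSheaf.ext_sieve {G : GrpFunctor k} (hG : IsFppfSheaf G) {R : CommAlgCat.{u} k}
    {U : Sieve (op R)} (hU : U ∈ fppfTopology k (op R)) {x y : G.obj R}
    (h : ∀ (S : CommAlgCat.{u} k) (φ : R ⟶ S), U φ.op → G.map φ x = G.map φ y) : x = y :=
  ((isFppfSheaf_iff.1 hG).isSeparated U hU).ext fun Y f hf => h Y.unop f.unop hf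

theorem IsFppfSheaf.ext {G : GrpFunctor k} (hG : IsFppfSheaf G) {R S : CommAlgCat.{u} k}
    {φ : R ⟶ S} (hφ : IsCover φ) {x y : G.obj R} (h : G.map φ x = G.map φ y) : x = y := by
  refine hG.ext_sieve (hφ.mem (U := Sieve.generate (Presieve.singleton φ.op))
    ⟨_, 𝟙 _, _, Presieve.singleton_self _, Category.id_comp _⟩) fun T ψ hψ => ?_
  obtain ⟨Y, a, _, ⟨⟩, hb⟩ := hψ
  have : ψ = φ ≫ a.unop := Quiver.Hom.op_inj hb.symm
  rw [this, G.map_comp, ConcreteCategory.comp_apply, ConcreteCategory.comp_apply, h]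

/-- A section of a sheaf that locally comes from a subsheaf comes from it. -/
theorem exists_preimage_of_sieve {F G : GrpFunctor k} (hF : IsFppfSheaf F) (hG : IsFppfSheaf G)
    (j : F ⟶ G) (hj : ∀ R, Function.Injective (j.app R)) {R : CommAlgCat.{u} k} (h : G.obj R)
    {U : Sieve (op R)} (hU : U ∈ fppfTopology k (op R))
    (hl : ∀ (S : CommAlgCat.{u} k) (φ : R ⟶ S), U φ.op → ∃ g, j.app S g = G.map φ h) :
    ∃ g, j.app R g = h := by
  choose! t ht using hl
  let x : Presieve.FamilyOfElements (unopUnop _ ⋙ F ⋙ forget AddCommGrpCat.{u + 1}) U.arrows :=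
    fun Y f _ => t Y.unop f.unop
  have hx : x.Compatible := by
    rw [Presieve.compatible_iff_sieveCompatible]
    intro Y Z f g hf
    apply hj
    refine (ht Z.unop (g ≫ f).unop (U.downward_closed hf g)).trans ?_
    refine Eq.trans ?_ (ConcreteCategory.congr_hom (j.naturality g.unop) _).symm
    rw [ConcreteCategory.comp_apply]
    erw [ht Y.unop f.unop hf]
    rw [← ConcreteCategory.comp_apply, ← G.map_comp]
    rfl
  obtain ⟨g, hg, -⟩ := (isFppfSheaf_iff.1 hF) U hU x hx
  refine ⟨g, hG.ext_sieve hU fun S φ hφ => ?_⟩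
  rw [← ht S φ hφ]
  refine (ConcreteCategory.congr_hom (j.naturality φ) g).symm.trans ?_
  exact congrArg (j.app S) (hg φ.op hφ)

theorem exists_preimage_of_isCover {F G : GrpFunctor k} (hF : IsFppfSheaf F) (hG : IsFppfSheaf G)
    (j : F ⟶ G) (hj : ∀ R, Function.Injective (j.app R)) {R S : CommAlgCat.{u} k} (h : G.obj R)
    {φ : R ⟶ S} (hφ : IsCover φ) (hl : ∃ g, j.app S g = G.map φ h) :
    ∃ g, j.app R g = h := by
  refine exists_preimage_of_sieve hF hG j hj h
    (hφ.mem (U := Sieve.generate (Presieve.singleton φ.op))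
    ⟨_, 𝟙 _, _, Presieve.singleton_self _, Category.id_comp _⟩) fun T ψ hψ => ?_
  obtain ⟨Y, a, _, ⟨⟩, hb⟩ := hψ
  obtain ⟨g, hg⟩ := hl
  have : ψ = φ ≫ a.unop := Quiver.Hom.op_inj hb.symm
  refine ⟨F.map a.unop g, ?_⟩
  rw [this, G.map_comp, ConcreteCategory.comp_apply, ← hg]
  exact ConcreteCategory.congr_hom (j.naturality a.unop) g

theorem exists_sieve_of_fppfUnit_eq {F : GrpFunctor k} {R : CommAlgCat.{u} k} {x y : F.obj R}
    (h : (fppfUnit F).app R x = (fppfUnit F).app R y) :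
    ∃ U ∈ fppfTopology k (op R), ∀ (S : CommAlgCat.{u} k) (φ : R ⟶ S), U φ.op →
      F.map φ x = F.map φ y :=
  ⟨_, Presheaf.equalizerSieve_mem (fppfTopology k)
    (toSheafify (fppfTopology k) (unopUnop _ ⋙ F)) (X := op (op R)) x y h, fun _ _ h => h⟩

theorem exists_sieve_fppfUnit {F : GrpFunctor k} {R : CommAlgCat.{u} k}
    (h : (fppfSheafify F).obj R) :
    ∃ U ∈ fppfTopology k (op R), ∀ (S : CommAlgCat.{u} k) (φ : R ⟶ S), U φ.op →
      ∃ x, (fppfUnit F).app S x = (fppfSheafify F).map φ h :=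
  ⟨_, Presheaf.imageSieve_mem (fppfTopology k)
    (toSheafify (fppfTopology k) (unopUnop _ ⋙ F)) (U := op (op R)) h, fun _ _ h => h⟩

/-- A homomorphism to a sheaf that is injective and locally surjective identifies the sheaf with the
associated sheaf of its source. -/
theorem isIso_fppfDesc {F Z : GrpFunctor k} (α : F ⟶ Z) (hZ : IsFppfSheaf Z)
    (hinj : ∀ R, Function.Injective (α.app R))
    (hsurj : ∀ (R : CommAlgCat.{u} k) (z : Z.obj R), ∃ U ∈ fppfTopology k (op R),
      ∀ (S : CommAlgCat.{u} k) (φ : R ⟶ S), U φ.op → ∃ x, α.app S x = Z.map φ z) :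
    IsIso (fppfDesc α hZ) := by
  have hα : ∀ R x, (fppfDesc α hZ).app R ((fppfUnit F).app R x) = α.app R x := fun R x => by
    rw [← ConcreteCategory.comp_apply, ← NatTrans.comp_app, fppfUnit_desc]
  have hi : ∀ R, Function.Injective ((fppfDesc α hZ).app R) := by
    intro R
    rw [injective_iff_map_eq_zero]
    intro h hh
    obtain ⟨U, hU, hl⟩ := exists_sieve_fppfUnit h
    refine (isFppfSheaf_fppfSheafify F).ext_sieve hU fun S φ hφ => ?_
    obtain ⟨x, hx⟩ := hl S φ hφ
    rw [← hx]
    have : α.app S x = 0 := by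
      rw [← hα, hx]
      refine (ConcreteCategory.congr_hom ((fppfDesc α hZ).naturality φ) h).trans ?_
      rw [ConcreteCategory.comp_apply, hh, map_zero]
    rw [hinj S (this.trans (map_zero _).symm), map_zero, map_zero]
  rw [NatTrans.isIso_iff_isIso_app]
  intro R
  rw [ConcreteCategory.isIso_iff_bijective]
  refine ⟨hi R, fun z => ?_⟩
  obtain ⟨U, hU, hl⟩ := hsurj R z
  refine exists_preimage_of_sieve (isFppfSheaf_fppfSheafify F) hZ _ hi z hU fun S φ hφ => ?_
  obtain ⟨x, hx⟩ := hl S φ hφ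
  exact ⟨_, (hα S x).trans hx⟩

theorem tensor_pi_ext {R : Type*} [CommRing R] {ι : Type*} [Finite ι] {S : ι → Type*}
    [∀ i, CommRing (S i)] [∀ i, Algebra R (S i)] {x y : (Π i, S i) ⊗[R] (Π i, S i)}
    (h : ∀ i j, TensorProduct.map (LinearMap.proj i) (LinearMap.proj (R := R) (φ := S) j) x =
      TensorProduct.map (LinearMap.proj i) (LinearMap.proj j) y) : x = y := by
  classical
  cases nonempty_fintype ι
  have key : ∀ z : (Π i, S i) ⊗[R] (Π i, S i), z = ∑ i, ∑ j,
      TensorProduct.map (LinearMap.single R S i) (LinearMap.single R S j)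
        (TensorProduct.map (LinearMap.proj i) (LinearMap.proj j) z) := by
    intro z
    induction z with
    | zero => simp
    | add a b ha hb =>
      simp only [map_add, Finset.sum_add_distrib]
      rw [← ha, ← hb]
    | tmul a b =>
      simp only [TensorProduct.map_tmul, ← TensorProduct.tmul_sum, ← TensorProduct.sum_tmul]
      congr 1 <;> ext i <;> simp [Finset.sum_apply]
  rw [key x, key y]
  simp only [h]

variable {k : Type u} [Field k] {X : (CommAlgCat.{u} k)ᵒᵖ} {ι : Type}
    {Y : ι → (CommAlgCat.{u} k)ᵒᵖ} {f : ∀ i, Y i ⟶ X}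

/-- The product of the members of a finite covering family. -/
noncomputable def piCover (f : ∀ i, Y i ⟶ X) : X.unop ⟶ CommAlgCat.of k (Π i, (Y i).unop) :=
  CommAlgCat.ofHom (AlgHom.pi fun i => (f i).unop.hom)

/-- The projections of `piCover`. -/
noncomputable def piProj (Y : ι → (CommAlgCat.{u} k)ᵒᵖ) (i : ι) :
    CommAlgCat.of k (Π i, (Y i).unop) ⟶ (Y i).unop :=
  CommAlgCat.ofHom (Pi.evalAlgHom k _ i)

theorem IsFppfCovering.isCover_pi [Finite ι] (hf : IsFppfCovering Y f) : IsCover (piCover f) := by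
  let (i : ι) : Algebra X.unop (Y i).unop := (f i).unop.hom.toRingHom.toAlgebra
  have hfl (i : ι) : Module.Flat X.unop (Y i).unop := (hf.1 i).1
  have hfp (i : ι) : Algebra.FinitePresentation X.unop (Y i).unop := (hf.1 i).2
  refine ⟨?_, ?_, fun p => ?_⟩
  · cases nonempty_fintype ι
    classical
    exact Module.Flat.of_linearEquiv (DFinsupp.linearEquivFunOnFintype
      (R := X.unop) (M := fun i => ((Y i).unop : Type u))).symm
  · exact (inferInstance : Algebra.FinitePresentation X.unop (Π i, (Y i).unop))
  · obtain ⟨i, q, rfl⟩ := hf.2 p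
    exact ⟨PrimeSpectrum.comap (Pi.evalRingHom (fun i => ((Y i).unop : Type u)) i) q, rfl⟩

theorem evalRingHom_flat_finitePresentation {ι : Type*} [Finite ι] (S : ι → Type*)
    [∀ i, CommRing (S i)] (i : ι) :
    (Pi.evalRingHom S i).Flat ∧ (Pi.evalRingHom S i).FinitePresentation := by
  classical
  let : Algebra (Π i, S i) (S i) := (Pi.evalRingHom S i).toAlgebra
  have : IsLocalization.Away (Pi.single i 1 : Π i, S i) (S i) := by
    refine IsLocalization.away_of_isIdempotentElem ?_ (RingHom.ker_evalRingHom _ _)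
      (Function.surjective_eval _)
    simp [IsIdempotentElem, ← Pi.single_mul_left]
  have h1 := IsLocalization.flat (S i) (.powers (Pi.single i 1 : Π i, S i))
  have h2 := IsLocalization.Away.finitePresentation (S := S i) (Pi.single i 1 : Π i, S i)
  exact ⟨RingHom.flat_algebraMap_iff.2 h1, RingHom.finitePresentation_algebraMap.2 h2⟩

theorem isFppfCovering_piProj [Finite ι] (Y : ι → (CommAlgCat.{u} k)ᵒᵖ) :
    IsFppfCovering Y fun i => (piProj Y i).op := by
  classical
  refine ⟨fun i => ?_, fun p => ?_⟩
  · exact evalRingHom_flat_finitePresentation (fun i => ((Y i).unop : Type u)) i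
  · obtain ⟨⟨i, q⟩, hq⟩ := (PrimeSpectrum.sigmaToPi_bijective
      (fun i => ((Y i).unop : Type u))).2 p
    exact ⟨i, q, hq⟩

theorem IsCover.faithfullyFlat {R S : CommAlgCat.{u} k} {φ : R ⟶ S} (h : IsCover φ) :
    φ.hom.toRingHom.FaithfullyFlat := by
  rw [RingHom.FaithfullyFlat.iff_flat_and_comap_surjective]
  exact ⟨h.flat, h.surjective⟩

theorem IsCover.injective {R S : CommAlgCat.{u} k} {φ : R ⟶ S} (h : IsCover φ) :
    Function.Injective φ.hom :=
  h.faithfullyFlat.injective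

theorem IsCover.exists_eq_of_tensor {R S : CommAlgCat.{u} k} {φ : R ⟶ S} (h : IsCover φ) (s : S)
    (hs : letI := φ.hom.toRingHom.toAlgebra
      s ⊗ₜ[R] (1 : S) = (1 : S) ⊗ₜ[R] s) : ∃ r, φ.hom r = s := by
  let := φ.hom.toRingHom.toAlgebra
  have : Module.FaithfullyFlat R S := h.faithfullyFlat
  exact (Algebra.IsEffective.of_faithfullyFlat (R := R) (S := S) s).1 (sub_eq_zero.2 hs)

theorem IsFppfCovering.injective [Finite ι] (hf : IsFppfCovering Y f) {x y : X.unop}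
    (h : ∀ i, (f i).unop.hom x = (f i).unop.hom y) : x = y :=
  hf.isCover_pi.injective (funext h)

theorem IsFppfCovering.exists_eq [Finite ι] (hf : IsFppfCovering Y f) (s : ∀ i, (Y i).unop)
    (hs : ∀ i j (T : CommAlgCat.{u} k) (a : (Y i).unop ⟶ T) (b : (Y j).unop ⟶ T),
      (f i).unop ≫ a = (f j).unop ≫ b → a.hom (s i) = b.hom (s j)) :
    ∃ r, ∀ i, (f i).unop.hom r = s i := by
  let (i : ι) : Algebra X.unop (Y i).unop := (f i).unop.hom.toRingHom.toAlgebra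
  have (i : ι) : IsScalarTower k X.unop (Y i).unop :=
    .of_algebraMap_eq fun x => ((f i).unop.hom.commutes x).symm
  obtain ⟨r, hr⟩ := hf.isCover_pi.exists_eq_of_tensor s (by
    refine tensor_pi_ext (R := X.unop) (S := fun i => ((Y i).unop : Type u)) fun i j => ?_
    refine hs i j (.of k ((Y i).unop ⊗[X.unop] (Y j).unop))
      (CommAlgCat.ofHom ((Algebra.TensorProduct.includeLeft
        (R := X.unop) (S := X.unop)).restrictScalars k))
      (CommAlgCat.ofHom ((Algebra.TensorProduct.includeRight (R := X.unop)).restrictScalars k)) ?_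
    ext x
    exact (Algebra.TensorProduct.tmul_one_eq_one_tmul (R := X.unop) (A := (Y i).unop)
      (B := (Y j).unop) x))
  exact ⟨r, fun i => congrFun hr i⟩

theorem isSheaf_coyoneda (H : CommAlgCat.{u} k) :
    Presieve.IsSheaf (fppfTopology k) (unopUnop _ ⋙ coyoneda.obj (op H)) := by
  have hsep : ∀ (X : (CommAlgCat.{u} k)ᵒᵖ) (U : Sieve X), U ∈ fppfTopology k X →
      ∀ t t' : H ⟶ X.unop, (∀ (Y : (CommAlgCat.{u} k)ᵒᵖ) (f : Y ⟶ X),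
          U f → t ≫ f.unop = t' ≫ f.unop) →
      t = t' := by
    rintro X U ⟨ι, _, Y, f, hf, hU⟩ t t' h
    ext a
    exact hf.injective fun i => ConcreteCategory.congr_hom (h _ _ (hU i)) a
  intro X U hU x hx
  obtain ⟨ι, _, Y, f, hf, hfU⟩ := id hU
  have hx' := (Presieve.compatible_iff_sieveCompatible _).1 hx
  have key : ∀ a : H, ∃ r : X.unop, ∀ i,
      (f i).unop.hom r = (x (f i) (hfU i) : H ⟶ (Y i).unop).hom a := by
    intro a
    refine hf.exists_eq _ fun i j T α β hαβ => ?_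
    exact ConcreteCategory.congr_hom (show (x (f i) (hfU i) : H ⟶ (Y i).unop) ≫ α =
      (x (f j) (hfU j) : H ⟶ (Y j).unop) ≫ β from
      hx α.op β.op _ _ (Quiver.Hom.unop_inj hαβ)) a
  choose r hr using key
  let t : H ⟶ X.unop := CommAlgCat.ofHom
    { toFun := r
      map_one' := hf.injective fun i => by rw [hr, map_one, map_one]
      map_zero' := hf.injective fun i => by rw [hr, map_zero, map_zero]
      map_mul' := fun a b => hf.injective fun i => by rw [hr, map_mul, map_mul, hr, hr]
      map_add' := fun a b => hf.injective fun i => by rw [hr, map_add, map_add, hr, hr]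
      commutes' := fun c => hf.injective fun i => by
        rw [hr, AlgHom.commutes, AlgHom.commutes]; rfl }
  have ht : ∀ i, t ≫ (f i).unop = x (f i) (hfU i) := fun i => by
    ext a
    exact hr a i
  have ham : ∀ (Z : (CommAlgCat.{u} k)ᵒᵖ) (g : Z ⟶ X) (hg : U g), t ≫ g.unop = x g hg := by
    intro Z g hg
    refine hsep Z (Sieve.pullback g (Sieve.generate (Presieve.ofArrows Y f))) ?_ _ _ fun W h hW =>
      ?_
    · exact (fppfTopology k).pullback_stable g
        ⟨ι, inferInstance, Y, f, hf, fun i => ⟨_, 𝟙 _, _, ⟨i⟩, Category.id_comp _⟩⟩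
    · obtain ⟨V, c, _, ⟨i⟩, hc⟩ := hW
      have h1 : x (h ≫ g) (U.downward_closed hg h) = (x g hg : H ⟶ Z.unop) ≫ h.unop := hx' g h hg
      have h2 : x (c ≫ f i) (U.downward_closed (hfU i) c) =
        (x (f i) (hfU i) : H ⟶ _) ≫ c.unop := hx' (f i) c (hfU i)
      have h3 : ∀ (g₁ g₂ : W ⟶ X) (_ : g₁ = g₂) (e₁ : U g₁) (e₂ : U g₂), x g₁ e₁ ≍ x g₂ e₂ := by
        rintro _ _ rfl _ _
        rfl
      have h4 := eq_of_heq (h3 _ _ hc (U.downward_closed (hfU i) c) (U.downward_closed hg h))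
      change (t ≫ g.unop) ≫ h.unop = (x g hg : H ⟶ Z.unop) ≫ h.unop
      rw [← h1, ← h4, h2, ← ht, Category.assoc, Category.assoc, ← unop_comp, ← unop_comp, hc]
  exact ⟨t, ham, fun t' ht' => hsep X U hU _ _ fun Z g hg => (ht' g hg).trans (ham Z g hg).symm⟩

theorem isFppfSheaf_of_representable (G : GrpFunctor k) (H : CommAlgCat.{u} k)
    (e : G ⋙ forget AddCommGrpCat.{u + 1} ≅ coyoneda.obj (op H) ⋙ uliftFunctor.{u + 1, u}) :
    IsFppfSheaf G := by
  rw [isFppfSheaf_iff]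
  refine Presieve.isSheaf_iso _ (Functor.isoWhiskerLeft (unopUnop _) e).symm ?_
  exact Presieve.isSheaf_comp_uliftFunctor _ (isSheaf_coyoneda H)

section quotient

variable {k : Type u} [Field k] {N G N' G' : GrpFunctor k}

theorem cokernel_π_app_surjective (φ : N ⟶ G) (R : CommAlgCat.{u} k) :
    Function.Surjective ((cokernel.π φ).app R) :=
  (AddCommGrpCat.epi_iff_surjective _).1 inferInstance

theorem cokernel_π_app_eq_zero_iff (φ : N ⟶ G) {R : CommAlgCat.{u} k} {x : G.obj R} :
    (cokernel.π φ).app R x = 0 ↔ ∃ n, φ.app R n = x := by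
  have h := (ShortComplex.exact_cokernel φ).map ((evaluation _ AddCommGrpCat.{u + 1}).obj R)
  rw [ShortComplex.ab_exact_iff] at h
  refine ⟨h x, ?_⟩
  rintro ⟨n, rfl⟩
  rw [← ConcreteCategory.comp_apply, ← NatTrans.comp_app, cokernel.condition]
  rfl

/-- The projection `G ⟶ G / N` to an fppf quotient. -/
noncomputable def fppfQuotientProj (φ : N ⟶ G) : G ⟶ fppfQuotient φ :=
  cokernel.π φ ≫ fppfUnit _

theorem isFppfSheaf_fppfQuotient (φ : N ⟶ G) : IsFppfSheaf (fppfQuotient φ) :=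
  isFppfSheaf_fppfSheafify _

theorem fppfQuotientProj_app_comp (φ : N ⟶ G) {R : CommAlgCat.{u} k} (n : N.obj R) :
    (fppfQuotientProj φ).app R (φ.app R n) = 0 := by
  refine Eq.trans ?_ (map_zero ((fppfUnit (cokernel φ)).app R).hom)
  exact congrArg ((fppfUnit (cokernel φ)).app R) ((cokernel_π_app_eq_zero_iff φ).2 ⟨n, rfl⟩)

theorem exists_sieve_of_fppfQuotientProj_eq_zero (φ : N ⟶ G) {R : CommAlgCat.{u} k} {x : G.obj R}
    (h : (fppfQuotientProj φ).app R x = 0) :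
    ∃ U ∈ fppfTopology k (op R), ∀ (S : CommAlgCat.{u} k) (ψ : R ⟶ S), U ψ.op →
      ∃ n, φ.app S n = G.map ψ x := by
  obtain ⟨U, hU, hl⟩ := exists_sieve_of_fppfUnit_eq (F := cokernel φ)
    (x := (cokernel.π φ).app R x) (y := 0) (h.trans (map_zero _).symm)
  refine ⟨U, hU, fun S ψ hψ => (cokernel_π_app_eq_zero_iff φ).1 ?_⟩
  have := hl S ψ hψ
  rw [map_zero] at this
  rw [← this]
  exact ConcreteCategory.congr_hom ((cokernel.π φ).naturality ψ) x

theorem exists_sieve_fppfQuotientProj (φ : N ⟶ G) {R : CommAlgCat.{u} k}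
    (h : (fppfQuotient φ).obj R) :
    ∃ U ∈ fppfTopology k (op R), ∀ (S : CommAlgCat.{u} k) (ψ : R ⟶ S), U ψ.op →
      ∃ x, (fppfQuotientProj φ).app S x = (fppfQuotient φ).map ψ h := by
  obtain ⟨U, hU, hl⟩ := exists_sieve_fppfUnit h
  refine ⟨U, hU, fun S ψ hψ => ?_⟩
  obtain ⟨y, hy⟩ := hl S ψ hψ
  obtain ⟨x, rfl⟩ := cokernel_π_app_surjective φ S y
  exact ⟨x, hy⟩

theorem fppfQuotientProj_map (φ : N ⟶ G) (φ' : N' ⟶ G')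
    (a : N ⟶ N') (b : G ⟶ G') (h : φ ≫ b = a ≫ φ') :
    fppfQuotientProj φ ≫ fppfQuotientMap φ φ' a b h = b ≫ fppfQuotientProj φ' := by
  refine (Category.assoc _ _ _).trans ?_
  refine (congrArg (cokernel.π φ ≫ ·) (fppfUnit_map (cokernel.map φ φ' a b h))).trans ?_
  refine (Category.assoc _ _ _).symm.trans ?_
  refine (congrArg (· ≫ fppfUnit (cokernel φ')) (cokernel.π_desc _ _ _)).trans ?_
  exact Category.assoc _ _ _

theorem fppfQuotient_hom_ext (φ : N ⟶ G) {Z : GrpFunctor k} (hZ : IsFppfSheaf Z)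
    {α β : fppfQuotient φ ⟶ Z} (h : fppfQuotientProj φ ≫ α = fppfQuotientProj φ ≫ β) : α = β := by
  refine fppfSheafify_hom_ext hZ ?_
  rw [← cancel_epi (cokernel.π φ)]
  exact (Category.assoc _ _ _).symm.trans (h.trans (Category.assoc _ _ _))

/-- A homomorphism to a sheaf with kernel `N` that is locally surjective identifies the sheaf with
`G / N`. -/
theorem exists_iso_fppfQuotient (φ : N ⟶ G) {Z : GrpFunctor k} (hZ : IsFppfSheaf Z) (α : G ⟶ Z)
    (hker : ∀ (R : CommAlgCat.{u} k) (x : G.obj R), α.app R x = 0 ↔ ∃ n, φ.app R n = x)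
    (hsurj : ∀ (R : CommAlgCat.{u} k) (z : Z.obj R), ∃ U ∈ fppfTopology k (op R),
      ∀ (S : CommAlgCat.{u} k) (φ : R ⟶ S), U φ.op → ∃ x, α.app S x = Z.map φ z) :
    ∃ e : fppfQuotient φ ≅ Z, fppfQuotientProj φ ≫ e.hom = α := by
  have h0 : φ ≫ α = 0 := by
    ext R n
    exact (hker R _).2 ⟨n, rfl⟩
  let β : cokernel φ ⟶ Z := cokernel.desc φ α h0
  have hβ : ∀ R x, β.app R ((cokernel.π φ).app R x) = α.app R x := fun R x => by
    rw [← ConcreteCategory.comp_apply, ← NatTrans.comp_app, cokernel.π_desc]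
  have hinj : ∀ R, Function.Injective (β.app R) := fun R => by
    rw [injective_iff_map_eq_zero]
    intro y hy
    obtain ⟨x, rfl⟩ := cokernel_π_app_surjective φ R y
    rw [hβ, hker] at hy
    exact (cokernel_π_app_eq_zero_iff φ).2 hy
  have : IsIso (fppfDesc β hZ) := isIso_fppfDesc β hZ hinj fun R z => by
    obtain ⟨U, hU, hl⟩ := hsurj R z
    refine ⟨U, hU, fun S ψ hψ => ?_⟩
    obtain ⟨x, hx⟩ := hl S ψ hψ
    exact ⟨_, (hβ S x).trans hx⟩
  refine ⟨@asIso _ _ (fppfQuotient φ) Z (fppfDesc β hZ) this, ?_⟩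
  refine (Category.assoc _ _ _).trans ?_
  exact (congrArg (cokernel.π φ ≫ ·) (fppfUnit_desc β hZ)).trans (cokernel.π_desc _ _ _)

end quotient

section units

variable {k : Type u} [Field k] {A B A' B' : Type u} [CommRing A] [CommRing B]
  [CommRing A'] [CommRing B'] [Algebra k A] [Algebra k B] [Algebra k A'] [Algebra k B']

/-- The class in `μ^{B/A}(R)` of a unit of `B ⊗ R`. -/
noncomputable def relMk (f : A →ₐ[k] B) (R : CommAlgCat.{u} k) :
    Additive (B ⊗[k] R)ˣ →+ (relMu f).obj R :=
  ((fppfQuotientProj (muMap f)).app R).hom.comp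
    (AddEquiv.ulift (α := Additive (B ⊗[k] R)ˣ)).symm.toAddMonoidHom

theorem relMk_map (f : A →ₐ[k] B) {R S : CommAlgCat.{u} k} (φ : R ⟶ S) (x : (B ⊗[k] R)ˣ) :
    (relMu f).map φ (relMk f R (.ofMul x)) =
      relMk f S (.ofMul (tensorUnitsMap (AlgHom.id k B) φ.hom x)) :=
  (ConcreteCategory.congr_hom ((fppfQuotientProj (muMap f)).naturality φ)
    (ULift.up (Additive.ofMul x))).symm

theorem relMuMap_relMk (f : A →ₐ[k] B) (f' : A' →ₐ[k] B') (a : A →ₐ[k] A') (b : B →ₐ[k] B')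
    (h : b.comp f = f'.comp a) {R : CommAlgCat.{u} k} (x : (B ⊗[k] R)ˣ) :
    (relMuMap f f' a b h).app R (relMk f R (.ofMul x)) =
      relMk f' R (.ofMul (tensorUnitsMap b (AlgHom.id k R) x)) :=
  ConcreteCategory.congr_hom (congr_app (fppfQuotientProj_map (muMap f) (muMap f') (muMap a)
    (muMap b) (muMap_comm h)) R) (ULift.up (Additive.ofMul x))

theorem mem_range_map_of_injective (f : A →ₐ[k] B) {R S : Type*} [CommRing R]
    [CommRing S] [Algebra k R] [Algebra k S] {g : R →ₐ[k] S} (hg : Function.Injective g)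
    {x : B ⊗[k] R}
    (hx : Algebra.TensorProduct.map (AlgHom.id k B) g x ∈
      (Algebra.TensorProduct.map f (AlgHom.id k S)).range) :
    x ∈ (Algebra.TensorProduct.map f (AlgHom.id k R)).range := by
  let q := (LinearMap.range f.toLinearMap).mkQ
  have hex : Function.Exact f.toLinearMap q := LinearMap.exact_map_mkQ_range _
  have hq : Function.Surjective q := Submodule.mkQ_surjective _
  have key : q.rTensor R x = 0 := by
    apply Module.Flat.lTensor_preserves_injective_linearMap (M := B ⧸ LinearMap.range f.toLinearMap)
      g.toLinearMap hg
    rw [map_zero]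
    have h1 : g.toLinearMap.lTensor _ (q.rTensor R x) =
        q.rTensor S (Algebra.TensorProduct.map (AlgHom.id k B) g x) := by
      rw [← LinearMap.comp_apply, LinearMap.lTensor_comp_rTensor, ← LinearMap.rTensor_comp_lTensor]
      rfl
    rw [h1]
    exact (rTensor_exact S hex hq _).2 hx
  exact (rTensor_exact R hex hq x).1 key

theorem piRight_apply_eq {ι : Type*} [Fintype ι] [DecidableEq ι] (S : ι → Type*)
    [∀ i, CommRing (S i)] [∀ i, Algebra k (S i)] (i : ι) (z : B ⊗[k] (Π i, S i)) :
    Algebra.TensorProduct.piRight k k B S z i =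
      Algebra.TensorProduct.map (AlgHom.id k B) (Pi.evalAlgHom k S i) z := by
  induction z with
  | zero => simp
  | add x y hx hy => rw [map_add, Pi.add_apply, hx, hy, map_add]
  | tmul x y => simp

theorem map_map_comm (f : A →ₐ[k] B) {R S : Type*} [CommRing R] [CommRing S] [Algebra k R]
    [Algebra k S] (g : R →ₐ[k] S) (x : A ⊗[k] R) :
    Algebra.TensorProduct.map (AlgHom.id k B) g (Algebra.TensorProduct.map f (AlgHom.id k R) x) =
      Algebra.TensorProduct.map f (AlgHom.id k S)
        (Algebra.TensorProduct.map (AlgHom.id k A) g x) := by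
  induction x with
  | zero => simp
  | add x y hx hy => simp only [map_add, hx, hy]
  | tmul x y => simp

theorem map_id_comp_apply {R S T : Type*} [CommRing R] [CommRing S] [CommRing T] [Algebra k R]
    [Algebra k S] [Algebra k T] (g : R →ₐ[k] S) (h : S →ₐ[k] T) (x : B ⊗[k] R) :
    Algebra.TensorProduct.map (AlgHom.id k B) h (Algebra.TensorProduct.map (AlgHom.id k B) g x) =
      Algebra.TensorProduct.map (AlgHom.id k B) (h.comp g) x := by
  induction x with
  | zero => simp
  | add x y hx hy => simp only [map_add, hx, hy]
  | tmul x y => simp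

theorem map_injective_of_injective {f : A →ₐ[k] B} (hf : Function.Injective f) (R : Type*)
    [CommRing R] [Algebra k R] :
    Function.Injective (Algebra.TensorProduct.map f (AlgHom.id k R)) :=
  Module.Flat.rTensor_preserves_injective_linearMap (M := R) f.toLinearMap hf

theorem mem_range_map_pi (f : A →ₐ[k] B) {ι : Type*} [Finite ι] (S : ι → Type*)
    [∀ i, CommRing (S i)] [∀ i, Algebra k (S i)] {y : B ⊗[k] (Π i, S i)}
    (hy : ∀ i, Algebra.TensorProduct.map (AlgHom.id k B) (Pi.evalAlgHom k S i) y ∈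
      (Algebra.TensorProduct.map f (AlgHom.id k (S i))).range) :
    y ∈ (Algebra.TensorProduct.map f (AlgHom.id k (Π i, S i))).range := by
  classical
  cases nonempty_fintype ι
  choose a ha using hy
  obtain ⟨a, rfl⟩ := (Algebra.TensorProduct.piRight k k A S).surjective a
  refine ⟨a, (Algebra.TensorProduct.piRight k k B S).injective (funext fun i => ?_)⟩
  rw [piRight_apply_eq, piRight_apply_eq]
  refine Eq.trans ?_ (ha i)
  rw [piRight_apply_eq]
  exact map_map_comm f (Pi.evalAlgHom k S i) a

theorem exists_tensorUnitsMap_iff {f : A →ₐ[k] B} (hf : Function.Injective f) {R : Type u}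
    [CommRing R] [Algebra k R] (x : (B ⊗[k] R)ˣ) :
    (∃ a, tensorUnitsMap f (AlgHom.id k R) a = x) ↔
      (x : B ⊗[k] R) ∈ (Algebra.TensorProduct.map f (AlgHom.id k R)).range ∧
      ((x⁻¹ : (B ⊗[k] R)ˣ) : B ⊗[k] R) ∈ (Algebra.TensorProduct.map f (AlgHom.id k R)).range := by
  constructor
  · rintro ⟨a, rfl⟩
    exact ⟨⟨a, rfl⟩, ⟨(a⁻¹ : (A ⊗[k] R)ˣ), rfl⟩⟩
  · rintro ⟨⟨a, ha⟩, ⟨b, hb⟩⟩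
    have hab : a * b = 1 := map_injective_of_injective hf R (by
      rw [map_mul, map_one]
      exact (congrArg₂ _ ha hb).trans x.mul_inv)
    exact ⟨⟨a, b, hab, (mul_comm _ _).trans hab⟩, Units.ext ha⟩

theorem relMk_eq_zero_iff {f : A →ₐ[k] B} (hf : Function.Injective f) {R : CommAlgCat.{u} k}
    (x : (B ⊗[k] R)ˣ) :
    relMk f R (.ofMul x) = 0 ↔ ∃ a, tensorUnitsMap f (AlgHom.id k R) a = x := by
  constructor
  · intro h
    obtain ⟨U, ⟨ι, _, Y, g, hg, hU⟩, hl⟩ := exists_sieve_of_fppfQuotientProj_eq_zero (muMap f) h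
    have key (i : ι) : ∃ a, tensorUnitsMap f (AlgHom.id k (Y i).unop) a =
        tensorUnitsMap (AlgHom.id k B) (g i).unop.hom x := by
      obtain ⟨n, hn⟩ := hl _ (g i).unop (hU i)
      exact ⟨n.down.toMul, congrArg (fun z => Additive.toMul (ULift.down z)) hn⟩
    rw [exists_tensorUnitsMap_iff hf]
    simp only [exists_tensorUnitsMap_iff hf] at key
    have hpi : ∀ y : B ⊗[k] R, (∀ i, Algebra.TensorProduct.map (AlgHom.id k B) (g i).unop.hom y ∈
        (Algebra.TensorProduct.map f (AlgHom.id k (Y i).unop)).range) →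
        y ∈ (Algebra.TensorProduct.map f (AlgHom.id k R)).range := by
      intro y hy
      refine mem_range_map_of_injective f hg.isCover_pi.injective
        (mem_range_map_pi f (fun i => ((Y i).unop : Type u)) fun i => ?_)
      have h1 := map_id_comp_apply (B := B) (piCover g).hom (piProj Y i).hom y
      exact (congrArg (· ∈ _) h1).mpr (hy i)
    exact ⟨hpi _ fun i => (key i).1, hpi _ fun i => (key i).2⟩
  · rintro ⟨a, rfl⟩
    exact fppfQuotientProj_app_comp (muMap f) (ULift.up (Additive.ofMul a))

theorem exists_sieve_relMk (f : A →ₐ[k] B) {R : CommAlgCat.{u} k} (h : (relMu f).obj R) :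
    ∃ U ∈ fppfTopology k (op R), ∀ (S : CommAlgCat.{u} k) (ψ : R ⟶ S), U ψ.op →
      ∃ x, relMk f S (.ofMul x) = (relMu f).map ψ h := by
  obtain ⟨U, hU, hl⟩ := exists_sieve_fppfQuotientProj (muMap f) h
  refine ⟨U, hU, fun S ψ hψ => ?_⟩
  obtain ⟨x, hx⟩ := hl S ψ hψ
  exact ⟨x.down.toMul, hx⟩

/-- Every section of `μ^{B/A}` is represented by a unit on a single fppf covering. -/
theorem exists_isCover_relMk (f : A →ₐ[k] B) {R : CommAlgCat.{u} k} (h : (relMu f).obj R) :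
    ∃ (S : CommAlgCat.{u} k) (φ : R ⟶ S) (_ : IsCover φ) (x : (B ⊗[k] S)ˣ),
      relMk f S (.ofMul x) = (relMu f).map φ h := by
  classical
  obtain ⟨U, ⟨ι, _, Y, g, hg, hU⟩, hl⟩ := exists_sieve_relMk f h
  cases nonempty_fintype ι
  choose x hx using fun i => hl _ (g i).unop (hU i)
  let e := Algebra.TensorProduct.piRight k k B fun i => ((Y i).unop : Type u)
  let y : (B ⊗[k] (Π i, ((Y i).unop : Type u)))ˣ :=
    (Units.mapEquiv e.toMulEquiv).symm (MulEquiv.piUnits.symm x)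
  have hy (i : ι) : tensorUnitsMap (AlgHom.id k B) (piProj Y i).hom y = x i := by
    refine Units.ext ((piRight_apply_eq _ i _).symm.trans ?_)
    exact congrFun (e.apply_symm_apply _) i
  refine ⟨_, piCover g, hg.isCover_pi, y, ?_⟩
  refine (isFppfSheaf_fppfQuotient (muMap f)).ext_sieve (U := Sieve.generate (Presieve.ofArrows Y
    fun i => (piProj Y i).op)) ⟨ι, inferInstance, Y, _, isFppfCovering_piProj Y,
      fun i => ⟨_, 𝟙 _, _, ⟨i⟩, Category.id_comp _⟩⟩ fun T ψ hψ => ?_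
  obtain ⟨i, c, rfl⟩ : ∃ i, ∃ c : (Y i).unop ⟶ T, ψ = piProj Y i ≫ c := by
    obtain ⟨_, c, _, ⟨i⟩, hc⟩ := hψ
    exact ⟨i, c.unop, Quiver.Hom.op_inj hc.symm⟩
  have h1 : (relMu f).map (piProj Y i) (relMk f _ (.ofMul y)) =
      (relMu f).map (piProj Y i) ((relMu f).map (piCover g) h) := by
    rw [relMk_map, hy, hx, ← ConcreteCategory.comp_apply, ← Functor.map_comp]
    rfl
  have h2 := congrArg ((relMu f).map c) h1
  rw [← ConcreteCategory.comp_apply, ← ConcreteCategory.comp_apply, ← Functor.map_comp] at h2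
  exact h2

end units

/-- Ideals descend along faithfully flat algebras. -/
theorem le_map_comap_of_faithfullyFlat {R S : Type*} [CommRing R] [CommRing S] [Algebra R S]
    [Module.FaithfullyFlat R S] (I : Ideal S)
    (hI : I.map (Algebra.TensorProduct.includeLeft (R := R) (S := R) (A := S) (B := S)) ≤
      I.map (Algebra.TensorProduct.includeRight (R := R) (A := S) (B := S))) :
    I ≤ (I.comap (algebraMap R S)).map (algebraMap R S) := by
  intro x hx
  set K := I.comap (algebraMap R S) with hK
  let ι : (R ⧸ K) →ₐ[R] S ⧸ I :=
    { Ideal.quotientMap I (algebraMap R S) le_rfl with commutes' := fun r => rfl }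
  have hι : Function.Injective ι := Ideal.quotientMap_injective
  have h1 : x ⊗ₜ[R] (1 : R ⧸ K) = 0 := by
    apply Module.Flat.lTensor_preserves_injective_linearMap (M := S) ι.toLinearMap hι
    rw [map_zero, LinearMap.lTensor_tmul]
    have h2 : (Algebra.TensorProduct.includeLeft (R := R) (S := R) (A := S) (B := S)) x ∈
        RingHom.ker (Algebra.TensorProduct.map (AlgHom.id R S) (Ideal.Quotient.mkₐ R I)) := by
      refine (hI.trans (Ideal.map_le_iff_le_comap.2 fun y hy => ?_)) (Ideal.mem_map_of_mem _ hx)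
      have : Ideal.Quotient.mk I y = 0 := Ideal.Quotient.eq_zero_iff_mem.2 hy
      simp [RingHom.mem_ker, this]
    have h3 := (RingHom.mem_ker).1 h2
    rw [Algebra.TensorProduct.includeLeft_apply, Algebra.TensorProduct.map_tmul] at h3
    refine Eq.trans ?_ h3
    simp
  let μ : (R ⧸ K) →ₐ[R] S ⧸ K.map (algebraMap R S) :=
    { Ideal.quotientMap (K.map (algebraMap R S)) (algebraMap R S) Ideal.le_comap_map with
      commutes' := fun r => rfl }
  have h4 := congrArg (Algebra.TensorProduct.productMap
    (Ideal.Quotient.mkₐ R (K.map (algebraMap R S))) μ) h1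
  rw [Algebra.TensorProduct.productMap_apply_tmul, map_zero, map_one, mul_one] at h4
  exact Ideal.Quotient.eq_zero_iff_mem.1 h4

variable {k : Type u} [Field k]

theorem IsCover.exists_pushout {R S T : CommAlgCat.{u} k} {φ : R ⟶ S} (hφ : IsCover φ) (ρ : R ⟶ T) :
    ∃ (P : CommAlgCat.{u} k) (a : S ⟶ P) (b : T ⟶ P), φ ≫ a = ρ ≫ b ∧ IsCover b := by
  let : Algebra R T := ρ.hom.toRingHom.toAlgebra
  let : Algebra R S := φ.hom.toRingHom.toAlgebra
  have : IsScalarTower k R T := .of_algebraMap_eq fun x => (ρ.hom.commutes x).symm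
  have : IsScalarTower k R S := .of_algebraMap_eq fun x => (φ.hom.commutes x).symm
  have hfl : Module.Flat R S := hφ.1
  have hfp : Algebra.FinitePresentation R S := hφ.2
  refine ⟨.of k (T ⊗[R] S), CommAlgCat.ofHom ((Algebra.TensorProduct.includeRight (R := R) (A := T)
    (B := S)).restrictScalars k), CommAlgCat.ofHom (IsScalarTower.toAlgHom k T (T ⊗[R] S)), ?_,
    ⟨?_, ?_, fun p => ?_⟩⟩
  · ext x
    exact (Algebra.TensorProduct.tmul_one_eq_one_tmul (R := R) (A := T) (B := S) x).symm
  · exact RingHom.flat_algebraMap_iff.2 (inferInstance : Module.Flat T (T ⊗[R] S))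
  · exact RingHom.finitePresentation_algebraMap.2
      (inferInstance : Algebra.FinitePresentation T (T ⊗[R] S))
  · obtain ⟨q, hq⟩ := hφ.surjective (PrimeSpectrum.comap ρ.hom.toRingHom p)
    exact exists_comap_tensor p q hq

theorem IsCover.comp {R S T : CommAlgCat.{u} k} {φ : R ⟶ S} {ψ : S ⟶ T} (hφ : IsCover φ)
    (hψ : IsCover ψ) : IsCover (φ ≫ ψ) where
  flat := RingHom.Flat.comp hφ.flat hψ.flat
  finitePresentation := RingHom.FinitePresentation.comp hψ.finitePresentation hφ.finitePresentation
  surjective := hφ.surjective.comp hψ.surjective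

theorem map_preimage {T G : GrpFunctor k} {j : T ⟶ G} {R S : CommAlgCat.{u} k} (φ : R ⟶ S)
    {h : G.obj R}
    (hh : ∃ g, j.app R g = h) : ∃ g, j.app S g = G.map φ h := by
  obtain ⟨g, rfl⟩ := hh
  exact ⟨T.map φ g, ConcreteCategory.congr_hom (j.naturality φ) g⟩

/-- Being a closed subsheaf can be checked locally. -/
theorem isClosedImmersion_of_local {T G : GrpFunctor k} (hT : IsFppfSheaf T) (hG : IsFppfSheaf G)
    (j : T ⟶ G) (hj : ∀ R, Function.Injective (j.app R))
    (hloc : ∀ (R : CommAlgCat.{u} k) (h : G.obj R), ∃ (S : CommAlgCat.{u} k) (φ : R ⟶ S)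
      (_ : IsCover φ) (I : Ideal S), ∀ (S' : CommAlgCat.{u} k) (ψ : S ⟶ S'),
        (∃ g, j.app S' g = G.map ψ (G.map φ h)) ↔ ∀ x ∈ I, ψ.hom x = 0) :
    IsClosedImmersion j := by
  refine ⟨hj, fun R h => ?_⟩
  obtain ⟨S, φ, hφ, I, hI⟩ := hloc R h
  let : Algebra R S := φ.hom.toRingHom.toAlgebra
  have : IsScalarTower k R S := .of_algebraMap_eq fun x => (φ.hom.commutes x).symm
  have hff : Module.FaithfullyFlat R S := hφ.faithfullyFlat
  have hdesc : I ≤ (I.comap (algebraMap R S)).map (algebraMap R S) := by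
    apply le_map_comap_of_faithfullyFlat
    let K := I.map (Algebra.TensorProduct.includeRight (R := R) (A := S) (B := S))
    let P : CommAlgCat.{u} k := .of k ((S ⊗[R] S) ⧸ K)
    let p₁ : S ⟶ P := CommAlgCat.ofHom ((Ideal.Quotient.mkₐ k K).comp
      ((Algebra.TensorProduct.includeLeft (R := R) (S := R) (A := S) (B := S)).restrictScalars k))
    let p₂ : S ⟶ P := CommAlgCat.ofHom ((Ideal.Quotient.mkₐ k K).comp
      ((Algebra.TensorProduct.includeRight (R := R) (A := S) (B := S)).restrictScalars k))
    have hp : φ ≫ p₁ = φ ≫ p₂ := by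
      ext x
      exact congrArg (Ideal.Quotient.mk K)
        (Algebra.TensorProduct.tmul_one_eq_one_tmul (R := R) (A := S) (B := S) x)
    have h₂ := (hI P p₂).2 fun x hx => Ideal.Quotient.eq_zero_iff_mem.2 (Ideal.mem_map_of_mem _ hx)
    rw [← ConcreteCategory.comp_apply, ← G.map_comp, ← hp, G.map_comp,
      ConcreteCategory.comp_apply] at h₂
    rw [Ideal.map_le_iff_le_comap]
    intro x hx
    have h₃ := (hI P p₁).1 h₂ x hx
    rw [Ideal.mem_comap]
    exact (Ideal.Quotient.eq_zero_iff_mem (I := K)).1 h₃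
  refine ⟨I.comap (algebraMap R S), fun T' ρ => ?_⟩
  obtain ⟨P, a, b, hab, hb⟩ := hφ.exists_pushout ρ
  have hmaps : G.map a (G.map φ h) = G.map b (G.map ρ h) := by
    rw [← ConcreteCategory.comp_apply, ← G.map_comp, hab, G.map_comp, ConcreteCategory.comp_apply]
  have hring : ∀ r : R, a.hom (φ.hom r) = b.hom (ρ.hom r) := ConcreteCategory.congr_hom hab
  have h1 : (∃ g, j.app T' g = G.map ρ h) ↔ ∀ x ∈ I, a.hom x = 0 := by
    rw [← hI P a, hmaps]
    exact ⟨map_preimage b, exists_preimage_of_isCover hT hG j hj _ hb⟩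
  rw [h1]
  constructor
  · intro H r hr
    apply hb.injective
    rw [map_zero, ← hring]
    exact H _ hr
  · intro H x hx
    have : (I.comap (algebraMap R S)).map (algebraMap R S) ≤ RingHom.ker a.hom :=
      Ideal.map_le_iff_le_comap.2 fun r hr => by
        rw [Ideal.mem_comap, RingHom.mem_ker]
        exact (hring r).trans (by rw [H r hr, map_zero])
    exact (RingHom.mem_ker).1 (this (hdesc hx))

section etale

theorem etale_of_isReduced_of_perfectField (K : Type u) (A : Type u) [Field K] [PerfectField K]
    [CommRing A] [Algebra K A] [Module.Finite K A] [IsReduced A] : Algebra.Etale K A := by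
  have : IsArtinianRing A := isArtinian_of_tower K inferInstance
  let _ (m : MaximalSpectrum A) : Field (A ⧸ m.asIdeal) := Ideal.Quotient.field m.asIdeal
  rw [Algebra.Etale.iff_exists_algEquiv_prod]
  exact ⟨_, inferInstance, _, _, _, (IsArtinianRing.equivPi A).restrictScalars K,
    fun m => ⟨inferInstance, inferInstance⟩⟩

/-- A subalgebra of an étale algebra over a field is étale. -/
theorem etale_of_injective {k C D : Type u} [Field k] [CommRing C] [CommRing D] [Algebra k C]
    [Algebra k D] (f : C →ₐ[k] D) (hf : Function.Injective f) [Algebra.Etale k D] :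
    Algebra.Etale k C := by
  have : Module.Finite k D := Algebra.FormallyUnramified.finite_of_free k D
  have : Module.Finite k C := Module.Finite.of_injective f.toLinearMap hf
  have h1 : IsReduced (AlgebraicClosure k ⊗[k] D) :=
    Algebra.FormallyUnramified.isReduced_of_field (AlgebraicClosure k) _
  have h2 : Algebra.IsGeometricallyReduced k D :=
    (Algebra.isGeometricallyReduced_field_iff k D).2 h1
  have h3 := (Algebra.isGeometricallyReduced_field_iff k C).1 (.of_injective f hf)
  have h4 := etale_of_isReduced_of_perfectField (AlgebraicClosure k) (AlgebraicClosure k ⊗[k] C)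
  exact Algebra.Etale.of_etale_tensorProduct_of_faithfullyFlat (T := AlgebraicClosure k)

variable {k : Type u} [Field k]

/-- Evaluation of elements of `D ⊗ R` at the `L`-points of `D`, for an `L`-algebra `R`. -/
noncomputable def evalPoints {L : Type*} [Field L] [Algebra k L] (D : Type*) [CommRing D]
    [Algebra k D] {R : Type*} [CommRing R] [Algebra k R] (l : L →ₐ[k] R) :
    D ⊗[k] R →ₐ[k] ((D →ₐ[k] L) → R) :=
  AlgHom.pi fun σ => Algebra.TensorProduct.productMap (l.comp σ) (AlgHom.id k R)

variable {L : Type*} [Field L] [Algebra k L] {C D : Type*} [CommRing C] [CommRing D]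
  [Algebra k C] [Algebra k D] {R S : Type*} [CommRing R] [Algebra k R] [CommRing S] [Algebra k S]

@[simp]
theorem evalPoints_tmul (l : L →ₐ[k] R) (d : D) (r : R) (σ : D →ₐ[k] L) :
    evalPoints D l (d ⊗ₜ r) σ = l (σ d) * r := by
  simp [evalPoints]

theorem evalPoints_map (l : L →ₐ[k] R) (g : R →ₐ[k] S) (x : D ⊗[k] R) (σ : D →ₐ[k] L) :
    evalPoints D (g.comp l) (Algebra.TensorProduct.map (AlgHom.id k D) g x) σ =
      g (evalPoints D l x σ) := by
  induction x with
  | zero => simp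
  | add x y hx hy => simp only [map_add, Pi.add_apply, hx, hy]
  | tmul x y => simp

theorem evalPoints_comp (l : L →ₐ[k] R) (f : C →ₐ[k] D) (x : C ⊗[k] R) (σ : D →ₐ[k] L) :
    evalPoints D l (Algebra.TensorProduct.map f (AlgHom.id k R) x) σ =
      evalPoints C l x (σ.comp f) := by
  induction x with
  | zero => simp
  | add x y hx hy => simp only [map_add, Pi.add_apply, hx, hy]
  | tmul x y => simp

/-- `D` is split by `L` if `D ⊗ L` is the algebra of functions on the `L`-points of `D`. -/
def IsSplitBy (k : Type u) [Field k] (L D : Type*) [Field L] [Algebra k L] [CommRing D]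
    [Algebra k D] : Prop :=
  Function.Bijective (evalPoints D (AlgHom.id k L))

theorem finite_algHom [Module.Finite k D] : Finite (D →ₐ[k] L) := by
  have : Module.Finite L (D →ₗ[k] L) := inferInstance
  exact (linearIndependent_toLinearMap k D L).finite

theorem IsSplitBy.bijective [Module.Finite k D] (h : IsSplitBy k L D) (l : L →ₐ[k] R) :
    Function.Bijective (evalPoints D l) := by
  classical
  have : Finite (D →ₐ[k] L) := finite_algHom
  cases nonempty_fintype (D →ₐ[k] L)
  choose e he using fun σ : D →ₐ[k] L => h.2 (Pi.single σ 1)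
  let e' σ := Algebra.TensorProduct.map (AlgHom.id k D) l (e σ)
  have he' : ∀ σ, evalPoints D l (e' σ) = Pi.single σ 1 := fun σ => by
    funext τ
    have := evalPoints_map (AlgHom.id k L) l (e σ) τ
    rw [he] at this
    refine this.trans ?_
    by_cases hτ : τ = σ
    · subst hτ; simp
    · simp [hτ]
  have hinv : ∀ x : D ⊗[k] R, x = ∑ σ, e' σ * (1 ⊗ₜ evalPoints D l x σ) := by
    intro x
    induction x with
    | zero => simp
    | add x y hx hy =>
      conv_lhs => rw [hx, hy]
      simp [TensorProduct.tmul_add, mul_add, Finset.sum_add_distrib]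
    | tmul d r =>
      have h1 : d ⊗ₜ[k] (1 : L) = ∑ σ, e σ * (1 ⊗ₜ σ d) := by
        apply h.1
        funext τ
        simp [Finset.sum_apply, he, Pi.single_apply]
      have h2 := congrArg (Algebra.TensorProduct.map (AlgHom.id k D) l) h1
      rw [map_sum] at h2
      have h3 : d ⊗ₜ[k] r = (d ⊗ₜ[k] (1 : R)) * (1 ⊗ₜ r) := by simp
      have h4 : d ⊗ₜ[k] (1 : R) =
          Algebra.TensorProduct.map (AlgHom.id k D) l (d ⊗ₜ[k] (1 : L)) := by
        simp
      conv_lhs => rw [h3, h4, h2, Finset.sum_mul]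
      refine Finset.sum_congr rfl fun σ _ => ?_
      simp [e', mul_assoc]
  refine ⟨fun x y hxy => ?_, fun v => ⟨∑ σ, e' σ * (1 ⊗ₜ v σ), ?_⟩⟩
  · rw [hinv x, hinv y, hxy]
  · funext τ
    simp [Finset.sum_apply, he', Pi.single_apply]

end etale

theorem isSplitBy_of_forall_mem {k : Type u} [Field k] {D : Type u} [CommRing D] [Algebra k D]
    [Algebra.Etale k D] (L : IntermediateField k (AlgebraicClosure k))
    (hL : ∀ (σ : D →ₐ[k] AlgebraicClosure k) d, σ d ∈ L) : IsSplitBy k L D := by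
  constructor
  · rw [injective_iff_map_eq_zero]
    intro x hx
    let g : D ⊗[k] L →ₐ[k] AlgebraicClosure k ⊗[k] D :=
      (Algebra.TensorProduct.comm k D (AlgebraicClosure k)).toAlgHom.comp
        (Algebra.TensorProduct.map (AlgHom.id k D) L.val)
    have hg : Function.Injective g := (Algebra.TensorProduct.comm k D _).injective.comp
      (Module.Flat.lTensor_preserves_injective_linearMap (M := D) L.val.toLinearMap L.val.injective)
    apply hg
    rw [map_zero]
    apply (Algebra.FormallyEtale.equivPiOfIsSepClosed (AlgebraicClosure k)
      (AlgebraicClosure k ⊗[k] D)).injective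
    rw [map_zero]
    funext p
    let φ : AlgebraicClosure k ⊗[k] D →ₐ[AlgebraicClosure k] AlgebraicClosure k :=
      (Pi.evalAlgHom _ _ p).comp (Algebra.FormallyEtale.equivPiOfIsSepClosed (AlgebraicClosure k)
        (AlgebraicClosure k ⊗[k] D)).toAlgHom
    let σ₀ : D →ₐ[k] AlgebraicClosure k := (φ.restrictScalars k).comp
      Algebra.TensorProduct.includeRight
    let σ : D →ₐ[k] L := σ₀.codRestrict L.toSubalgebra (hL σ₀)
    have key : ∀ y : D ⊗[k] L, φ (g y) = (evalPoints D (AlgHom.id k L) y σ : L) := by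
      intro y
      induction y with
      | zero => simp
      | add x y hx hy => simp [map_add, hx, hy]
      | tmul d l =>
        have h1 : g (d ⊗ₜ l) = algebraMap _ _ (l : AlgebraicClosure k) *
            Algebra.TensorProduct.includeRight d := by
          simp [g]
        rw [h1, map_mul, AlgHom.commutes, evalPoints_tmul, mul_comm]
        rfl
    refine (key x).trans ?_
    rw [hx]
    rfl
  · have hspan : Submodule.span L (Set.range fun (d : D) (σ : D →ₐ[k] L) => σ d) = ⊤ := by
      by_contra hne
      obtain ⟨c, hc, hle⟩ := Submodule.exists_le_ker_of_lt_top _ (lt_top_iff_ne_top.2 hne)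
      have : Module.Finite k D := Algebra.FormallyUnramified.finite_of_free k D
      have : Finite (D →ₐ[k] L) := finite_algHom
      cases nonempty_fintype (D →ₐ[k] L)
      classical
      have hli := Fintype.linearIndependent_iff.1 (linearIndependent_toLinearMap k D L)
        (fun σ => c (Pi.single σ 1)) (by
          refine LinearMap.ext fun d => ?_
          have h1 : c (fun σ : D →ₐ[k] L => σ d) = 0 := hle (Submodule.subset_span ⟨d, rfl⟩)
          have h2 := LinearMap.pi_apply_eq_sum_univ c (fun σ : D →ₐ[k] L => σ d)
          rw [h1] at h2
          rw [LinearMap.sum_apply, LinearMap.zero_apply, h2]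
          refine Finset.sum_congr rfl fun σ _ => ?_
          have h3 : (Pi.single σ 1 : (D →ₐ[k] L) → L) = fun τ => if σ = τ then 1 else 0 := by
            funext τ
            simp [Pi.single_apply, eq_comm]
          rw [LinearMap.smul_apply, smul_eq_mul, smul_eq_mul, mul_comm, h3]
          rfl)
      apply hc
      refine LinearMap.pi_ext' fun σ => ?_
      exact LinearMap.ext_ring (hli σ)
    intro v
    have hv : v ∈ Submodule.span L (Set.range fun (d : D) (σ : D →ₐ[k] L) => σ d) :=
      hspan ▸ Submodule.mem_top
    induction hv using Submodule.span_induction with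
    | mem v hv =>
      obtain ⟨d, rfl⟩ := hv
      exact ⟨d ⊗ₜ 1, by funext σ; simp⟩
    | zero => exact ⟨0, map_zero _⟩
    | add v w _ _ hv hw =>
      obtain ⟨x, rfl⟩ := hv
      obtain ⟨y, rfl⟩ := hw
      exact ⟨x + y, map_add _ _ _⟩
    | smul l v _ hv =>
      obtain ⟨x, rfl⟩ := hv
      exact ⟨x * (1 ⊗ₜ l), by funext σ; simp [mul_comm]⟩

/-- If `C ⊂ D` and `L` splits both, every `L`-point of `C` extends to `D`. -/
theorem IsSplitBy.exists_extension {k : Type u} [Field k] {L : Type*} [Field L] [Algebra k L]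
    {C D : Type*} [CommRing C] [CommRing D] [Algebra k C] [Algebra k D]
    (hC : IsSplitBy k L C) (hD : IsSplitBy k L D) (f : C →ₐ[k] D)
    (hf : Function.Injective f) (τ : C →ₐ[k] L) : ∃ σ : D →ₐ[k] L, σ.comp f = τ := by
  classical
  obtain ⟨e, he⟩ := hC.2 (Pi.single τ 1)
  have h1 : Algebra.TensorProduct.map f (AlgHom.id k L) e ≠ 0 := by
    intro h0
    have : e = 0 := Module.Flat.rTensor_preserves_injective_linearMap (M := L) f.toLinearMap hf
      (h0.trans (map_zero _).symm)
    rw [this, map_zero] at he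
    have := congrFun he τ
    simp at this
  by_contra! hne
  apply h1
  apply hD.1
  rw [map_zero]
  funext σ
  rw [evalPoints_comp, he]
  simp [hne σ]

theorem exists_isSplitBy {k : Type u} [Field k] {C D : Type u} [CommRing C] [CommRing D]
    [Algebra k C] [Algebra k D] [Algebra.Etale k C] [Algebra.Etale k D] :
    ∃ L : IntermediateField k (AlgebraicClosure k), Module.Finite k L ∧ IsSplitBy k L C ∧
      IsSplitBy k L D := by
  have main : ∀ (E : Type u) [CommRing E] [Algebra k E] [Algebra.Etale k E],
      ∃ L : IntermediateField k (AlgebraicClosure k), Module.Finite k L ∧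
        ∀ (σ : E →ₐ[k] AlgebraicClosure k) d, σ d ∈ L := by
    intro E _ _ _
    have : Module.Finite k E := Algebra.FormallyUnramified.finite_of_free k E
    have : Finite (E →ₐ[k] AlgebraicClosure k) := finite_algHom
    let b := Module.finBasis k E
    let s : Set (AlgebraicClosure k) := Set.range fun p : (E →ₐ[k] AlgebraicClosure k) ×
      Fin (Module.finrank k E) => p.1 (b p.2)
    have : Finite s := (Set.finite_range _).to_subtype
    refine ⟨IntermediateField.adjoin k s, IntermediateField.finiteDimensional_adjoin
      fun x _ => Algebra.IsIntegral.isIntegral x, fun σ d => ?_⟩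
    rw [← b.sum_repr d, map_sum]
    refine sum_mem fun i _ => ?_
    rw [map_smul]
    exact IntermediateField.smul_mem _ (IntermediateField.subset_adjoin k s ⟨(σ, i), rfl⟩)
  obtain ⟨L₁, h₁, hL₁⟩ := main C
  obtain ⟨L₂, h₂, hL₂⟩ := main D
  exact ⟨L₁ ⊔ L₂, IntermediateField.finiteDimensional_sup L₁ L₂,
    isSplitBy_of_forall_mem _ fun σ d => (le_sup_left : L₁ ≤ L₁ ⊔ L₂) (hL₁ σ d),
    isSplitBy_of_forall_mem _ fun σ d => (le_sup_right : L₂ ≤ L₁ ⊔ L₂) (hL₂ σ d)⟩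

section sep

variable {k : Type u} [Field k] {B : Type u} [CommRing B] [Algebra k B]

theorem isNilpotent_nilradical_of_finite (k : Type u) [Field k] (B : Type u) [CommRing B]
    [Algebra k B] [Module.Finite k B] : IsNilpotent (nilradical B) := by
  have : IsNoetherianRing B := IsNoetherianRing.of_finite k B
  exact IsNoetherianRing.isNilpotent_nilradical B

theorem isReduced_red (B : Type u) [CommRing B] : IsReduced (Red B) :=
  (Ideal.isRadical_iff_quotient_reduced _).1 (Ideal.radical_isRadical _)

theorem etale_sepPart {D : Type u} [CommRing D] [Algebra k D] [Module.Finite k D]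
    (C : Subalgebra k D) : Algebra.Etale k (sepPart C) :=
  (sepPart_isGreatest C).1.2

theorem toRed_lift {s : sepTop k B →ₐ[k] B} (hs : (toRed k B).comp s = (sepTop k B).val)
    (x : sepTop k B) : toRed k B (s x) = x :=
  DFunLike.congr_fun hs x

theorem lift_injective {s : sepTop k B →ₐ[k] B} (hs : (toRed k B).comp s = (sepTop k B).val) :
    Function.Injective s :=
  fun x y h => Subtype.ext (by rw [← toRed_lift hs x, h, toRed_lift hs y])

variable [Module.Finite k B]

theorem existsUnique_lift {S : Type u} [CommRing S] [Algebra k S] [Algebra.Etale k S]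
    (g : S →ₐ[k] Red B) : ∃! s : S →ₐ[k] B, (toRed k B).comp s = g := by
  have hnil := isNilpotent_nilradical_of_finite k B
  obtain ⟨s, hs⟩ := Algebra.FormallySmooth.exists_lift (nilradical B) hnil g
  exact ⟨s, hs, fun s' hs' => Algebra.FormallyUnramified.lift_unique (nilradical B) hnil _ _
    (hs'.trans hs.symm)⟩

variable {A : Subalgebra k B} {s : sepTop k B →ₐ[k] B}

theorem lift_sepIncl_mem (hs : (toRed k B).comp s = (sepTop k B).val) (x : sepSub A) :
    s (sepIncl A x) ∈ A := by
  have := etale_sepPart (redSub A)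
  have hnil := isNilpotent_nilradical_of_finite k B
  let g : sepSub A →ₐ[k] redSub A := Subalgebra.inclusion (sepPart_isGreatest (redSub A)).1.1
  obtain ⟨t, ht⟩ : ∃ t : sepSub A →ₐ[k] A, (toRedSub A).comp t = g := by
    have h1 : IsNilpotent (RingHom.ker (toRedSub A).toRingHom) :=
      (ker_toRedSub A).symm ▸ isNilpotent_nilradical_of_finite k A
    exact ⟨Algebra.FormallySmooth.liftOfSurjective g (toRedSub A) (toRedSub_surjective A) h1,
      Algebra.FormallySmooth.comp_liftOfSurjective _ _ _ _⟩
  have h2 : A.val.comp t = s.comp (sepIncl A) :=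
    Algebra.FormallyUnramified.lift_unique (nilradical B) hnil _ _ (by
      ext y
      have h3 : ((toRedSub A) (t y) : Red B) = y := congrArg Subtype.val (DFunLike.congr_fun ht y)
      exact h3.trans (toRed_lift hs (sepIncl A y)).symm)
  rw [← AlgHom.comp_apply, ← h2]
  exact (t x).2

theorem mem_range_sepIncl (hs : (toRed k B).comp s = (sepTop k B).val) {x : sepTop k B}
    (hx : s x ∈ A) : ∃ y, sepIncl A y = x := by
  have := etale_sepPart (⊤ : Subalgebra k (Red B))
  have h1 : Algebra.Etale k (A.comap s) :=
    etale_of_injective (D := sepTop k B) (A.comap s).val Subtype.val_injective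
  let g : A.comap s →ₐ[k] Red B := (sepTop k B).val.comp (A.comap s).val
  have hg : Function.Injective g := Subtype.val_injective.comp Subtype.val_injective
  have h2 : Algebra.Etale k g.range :=
    etale_of_injective (AlgEquiv.ofInjective g hg).symm.toAlgHom (AlgEquiv.injective _)
  have h3 : g.range ≤ sepSub A := (sepPart_isGreatest (redSub A)).2 ⟨by
    rintro _ ⟨y, rfl⟩
    exact ⟨s y, y.2, toRed_lift hs y⟩, h2⟩
  exact ⟨⟨x, h3 ⟨⟨x, hx⟩, rfl⟩⟩, rfl⟩

theorem sepTop_eq_top_of_perfectField [PerfectField k] : sepTop k B = ⊤ := by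
  have := isReduced_red B
  have := etale_of_isReduced_of_perfectField k (Red B)
  refine top_le_iff.1 ((sepPart_isGreatest (⊤ : Subalgebra k (Red B))).2 ⟨le_rfl, ?_⟩)
  exact etale_of_injective (⊤ : Subalgebra k (Red B)).val Subtype.val_injective

theorem sepSub_eq_redSub (h : sepTop k B = ⊤) (A : Subalgebra k B) : sepSub A = redSub A := by
  have h0 : Algebra.Etale k (sepTop k B) := etale_sepPart _
  rw [h] at h0
  refine le_antisymm (sepPart_isGreatest (redSub A)).1.1 ((sepPart_isGreatest (redSub A)).2
    ⟨le_rfl, ?_⟩)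
  exact etale_of_injective (Subalgebra.inclusion le_top : redSub A →ₐ[k] (⊤ : Subalgebra k (Red B)))
    (Subalgebra.inclusion_injective _)

theorem add_pow_char_pow_of_algebra (k : Type*) [Field k] {R : Type*} [CommRing R] [Algebra k R]
    (p : ℕ)
    [Fact p.Prime] [CharP k p] (x y : R) (n : ℕ) :
    (x + y) ^ p ^ n = x ^ p ^ n + y ^ p ^ n := by
  rcases subsingleton_or_nontrivial R with _ | _
  · exact Subsingleton.elim _ _
  · have : CharP R p := charP_of_injective_algebraMap (algebraMap k R).injective p
    exact add_pow_char_pow x y p n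

theorem sub_pow_char_pow_of_algebra (k : Type*) [Field k] {R : Type*} [CommRing R] [Algebra k R]
    (p : ℕ)
    [Fact p.Prime] [CharP k p] (x y : R) (n : ℕ) :
    (x - y) ^ p ^ n = x ^ p ^ n - y ^ p ^ n := by
  rw [eq_sub_iff_add_eq, ← add_pow_char_pow_of_algebra k, sub_add_cancel]

theorem exists_pow_mem_sepTop (p : ℕ) [Fact p.Prime] [CharP k p] (x : Red B) :
    ∃ n : ℕ, x ^ p ^ n ∈ sepTop k B := by
  have := isReduced_red B
  have : IsArtinianRing (Red B) := isArtinian_of_tower k inferInstance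
  let _ (m : MaximalSpectrum (Red B)) : Field (Red B ⧸ m.asIdeal) := Ideal.Quotient.field m.asIdeal
  let F (m : MaximalSpectrum (Red B)) := separableClosure k (Red B ⧸ m.asIdeal)
  let S : Subalgebra k (Red B) :=
    ⨅ m, (F m).toSubalgebra.comap (Ideal.Quotient.mkₐ k m.asIdeal)
  have hmem : ∀ y, y ∈ S ↔ ∀ m : MaximalSpectrum (Red B), Ideal.Quotient.mk m.asIdeal y ∈ F m :=
    fun y => Algebra.mem_iInf
  have hS : Algebra.Etale k S := by
    have (m : MaximalSpectrum (Red B)) : Algebra.Etale k (F m) := by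
      have := Algebra.FormallyEtale.of_isSeparable k (F m)
      exact ⟨this, Algebra.FinitePresentation.of_finiteType.1 inferInstance⟩
    let g : S →ₐ[k] Π m, F m := AlgHom.pi fun m =>
      ((Ideal.Quotient.mkₐ k m.asIdeal).comp S.val).codRestrict (F m).toSubalgebra
        fun y => (hmem y).1 y.2 m
    refine etale_of_injective g ((injective_iff_map_eq_zero g).2 fun y hy => Subtype.ext ?_)
    apply (IsArtinianRing.equivPi (Red B)).injective
    rw [ZeroMemClass.coe_zero, map_zero]
    funext m
    exact congrArg Subtype.val (congrFun hy m)
  have key (m : MaximalSpectrum (Red B)) :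
      ∃ n : ℕ, Ideal.Quotient.mk m.asIdeal x ^ p ^ n ∈ F m := by
    have : CharP (F m) p := charP_of_injective_algebraMap (algebraMap k (F m)).injective p
    have : ExpChar (F m) p := .prime Fact.out
    obtain ⟨n, y, hy⟩ := IsPurelyInseparable.pow_mem (F m) p (Ideal.Quotient.mk m.asIdeal x)
    exact ⟨n, hy ▸ y.2⟩
  choose n hn using key
  cases nonempty_fintype (MaximalSpectrum (Red B))
  refine ⟨∑ m, n m, (sepPart_isGreatest (⊤ : Subalgebra k (Red B))).2 ⟨le_top, hS⟩
    ((hmem _).2 fun m => ?_)⟩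
  obtain ⟨d, hd⟩ := Nat.exists_eq_add_of_le
    (Finset.single_le_sum (f := n) (fun _ _ => Nat.zero_le _) (Finset.mem_univ m))
  rw [hd, pow_add, pow_mul, map_pow, map_pow]
  exact pow_mem (hn m) _

/-- In characteristic `p`, some power of Frobenius maps `B` to the lift of `B_sep`. -/
theorem exists_pow_eq_lift (hs : (toRed k B).comp s = (sepTop k B).val) (p : ℕ) [Fact p.Prime]
    [CharP k p] : ∃ n : ℕ, ∀ b : B, ∃ t, s t = b ^ p ^ n := by
  have hp : 1 < p := (Fact.out : p.Prime).one_lt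
  have h1 (b : B) : ∃ n : ℕ, ∃ t, s t = b ^ p ^ n := by
    obtain ⟨n, hn⟩ := exists_pow_mem_sepTop (k := k) p (toRed k B b)
    have h2 : s ⟨_, hn⟩ - b ^ p ^ n ∈ nilradical B := by
      rw [← Ideal.Quotient.eq_zero_iff_mem, map_sub, sub_eq_zero]
      exact (toRed_lift hs ⟨_, hn⟩).trans (map_pow (toRed k B) b _).symm
    obtain ⟨N, hN⟩ := mem_nilradical.1 h2
    refine ⟨n + N, (⟨_, hn⟩ : sepTop k B) ^ p ^ N, ?_⟩
    have h3 := pow_eq_zero_of_le (Nat.lt_pow_self hp).le hN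
    rw [sub_pow_char_pow_of_algebra k, sub_eq_zero] at h3
    rw [map_pow, h3, ← pow_mul, ← pow_add]
  have h2 (b : B) (n m : ℕ) (hnm : n ≤ m) (h : ∃ t, s t = b ^ p ^ n) : ∃ t, s t = b ^ p ^ m := by
    obtain ⟨t, ht⟩ := h
    obtain ⟨d, rfl⟩ := Nat.exists_eq_add_of_le hnm
    exact ⟨t ^ p ^ d, by rw [map_pow, ht, ← pow_mul, ← pow_add]⟩
  choose n hn using h1
  let v := Module.finBasis k B
  refine ⟨∑ i, n (v i), fun b => ?_⟩
  change _ ∈ Set.range s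
  rw [← v.sum_repr b]
  generalize (v.repr b : _ → k) = c
  suffices ∀ I : Finset (Fin (Module.finrank k B)), ∃ t, s t =
      (∑ i ∈ I, c i • v i) ^ p ^ ∑ i, n (v i) from this _
  intro I
  induction I using Finset.induction_on with
  | empty =>
    exact ⟨0, by rw [Finset.sum_empty, map_zero, zero_pow (pow_pos (by omega) _).ne']⟩
  | insert i I hi ih =>
    obtain ⟨t, ht⟩ := ih
    obtain ⟨t', ht'⟩ := h2 (v i) _ _ (Finset.single_le_sum (f := fun i => n (v i))
      (fun _ _ => Nat.zero_le _) (Finset.mem_univ i)) (hn (v i))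
    refine ⟨c i ^ (p ^ ∑ i, n (v i)) • t' + t, ?_⟩
    rw [Finset.sum_insert hi, add_pow_char_pow_of_algebra k, map_add, ht, map_smul, ht', smul_pow]

end sep

section pairing

variable {k : Type*} [Field k] {A B C D : Type*} [CommRing A] [CommRing B] [CommRing C] [CommRing D]
  [Algebra k A] [Algebra k B] [Algebra k C] [Algebra k D] {R S : Type*} [CommRing R] [CommRing S]
  [Algebra k R] [Algebra k S]

/-- The scalar extension `V ⊗ R → R` of a linear form on `V`. -/
noncomputable def pairing {V : Type*} [AddCommGroup V] [Module k V] (ℓ : V →ₗ[k] k) (R : Type*)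
    [CommRing R] [Algebra k R] : V ⊗[k] R →ₗ[k] R :=
  (TensorProduct.lid k R).toLinearMap ∘ₗ ℓ.rTensor R

theorem pairing_tmul {V : Type*} [AddCommGroup V] [Module k V] (ℓ : V →ₗ[k] k) (b : V) (r : R) :
    pairing ℓ R (b ⊗ₜ r) = ℓ b • r := by
  simp [pairing]

theorem pairing_map (ℓ : B →ₗ[k] k) (g : R →ₐ[k] S) (x : B ⊗[k] R) :
    pairing ℓ S (Algebra.TensorProduct.map (AlgHom.id k B) g x) = g (pairing ℓ R x) := by
  induction x with
  | zero => simp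
  | add x y hx hy => simp only [map_add, hx, hy]
  | tmul x y => simp [pairing_tmul]

theorem pairing_rTensor {V W : Type*} [AddCommGroup V] [Module k V] [AddCommGroup W] [Module k W]
    (ℓ : W →ₗ[k] k) (f : V →ₗ[k] W) (x : V ⊗[k] R) :
    pairing ℓ R (f.rTensor R x) = pairing (ℓ ∘ₗ f) R x := by
  rw [pairing, pairing, LinearMap.rTensor_comp]
  rfl

theorem eq_zero_of_pairing {V : Type*} [AddCommGroup V] [Module k V] {x : V ⊗[k] R}
    (h : ∀ ℓ : V →ₗ[k] k, pairing ℓ R x = 0) : x = 0 := by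
  classical
  let b := Module.Basis.ofVectorSpace k V
  have key : ∀ (y : V ⊗[k] R) i, TensorProduct.equivFinsuppOfBasisLeft (N := R) b y i =
      pairing (b.coord i) R y := by
    intro y i
    induction y with
    | zero => simp
    | add x y hx hy => simp only [map_add, Finsupp.add_apply, hx, hy]
    | tmul x y => simp [pairing_tmul]
  apply (TensorProduct.equivFinsuppOfBasisLeft (N := R) b).injective
  rw [map_zero]
  ext i
  rw [Finsupp.zero_apply, key, h]

theorem mem_range_map_iff (f : A →ₐ[k] B) {x : B ⊗[k] R} :
    x ∈ (Algebra.TensorProduct.map f (AlgHom.id k R)).range ↔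
      ∀ ℓ : B →ₗ[k] k, (∀ a, ℓ (f a) = 0) → pairing ℓ R x = 0 := by
  constructor
  · rintro ⟨y, rfl⟩ ℓ hℓ
    change pairing ℓ R (f.toLinearMap.rTensor R y) = 0
    rw [pairing_rTensor, show ℓ ∘ₗ f.toLinearMap = 0 from LinearMap.ext hℓ]
    simp [pairing]
  · intro h
    let q := (LinearMap.range f.toLinearMap).mkQ
    have hex : Function.Exact f.toLinearMap q := LinearMap.exact_map_mkQ_range _
    refine (rTensor_exact R hex (Submodule.mkQ_surjective _) x).1 (eq_zero_of_pairing fun ℓ => ?_)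
    rw [pairing_rTensor]
    refine h _ fun a => ?_
    have : q (f a) = 0 := hex.apply_apply_eq_zero a
    rw [LinearMap.comp_apply, this, map_zero]

/-- If `i` has image `s⁻¹ (im g)`, the same holds over every `k`-algebra `R`. -/
theorem mem_range_map_of_map_mem {g : A →ₐ[k] B} {s : D →ₐ[k] B} {i : C →ₐ[k] D}
    (h : ∀ d, s d ∈ g.range → d ∈ i.range) {x : D ⊗[k] R}
    (hx : Algebra.TensorProduct.map s (AlgHom.id k R) x ∈
      (Algebra.TensorProduct.map g (AlgHom.id k R)).range) :
    x ∈ (Algebra.TensorProduct.map i (AlgHom.id k R)).range := by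
  rw [mem_range_map_iff] at hx ⊢
  intro ℓ hℓ
  let K : Submodule k D := (LinearMap.range g.toLinearMap).comap s.toLinearMap
  have hK : K ≤ LinearMap.ker ℓ := fun d hd => by
    obtain ⟨c, rfl⟩ := h d hd
    exact hℓ c
  let u : D ⧸ K →ₗ[k] B ⧸ LinearMap.range g.toLinearMap :=
    K.mapQ (LinearMap.range g.toLinearMap) s.toLinearMap le_rfl
  have hu : LinearMap.ker u = ⊥ := by
    rw [Submodule.ker_mapQ, Submodule.mkQ_map_self]
  obtain ⟨r, hr⟩ := u.exists_leftInverse_of_injective hu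
  let m : B →ₗ[k] k := (K.liftQ ℓ hK ∘ₗ r) ∘ₗ (LinearMap.range g.toLinearMap).mkQ
  have hm : m ∘ₗ s.toLinearMap = ℓ := by
    ext d
    have h1 : r (u (K.mkQ d)) = K.mkQ d := DFunLike.congr_fun hr _
    change K.liftQ ℓ hK (r (u (K.mkQ d))) = ℓ d
    rw [h1]
    rfl
  rw [← hm, ← pairing_rTensor]
  refine hx m fun a => ?_
  have : (LinearMap.range g.toLinearMap).mkQ (g a) = 0 :=
    (Submodule.Quotient.mk_eq_zero _).2 ⟨a, rfl⟩
  simp only [m, LinearMap.comp_apply, this, map_zero]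

theorem isIntegral_map [Algebra.IsIntegral k B] (g : A →ₐ[k] B) (R : Type*) [CommRing R]
    [Algebra k R] : (Algebra.TensorProduct.map g (AlgHom.id k R)).toRingHom.IsIntegral := by
  intro z
  induction z with
  | zero => exact RingHom.isIntegralElem_zero _
  | add x y hx hy => exact hx.add _ hy
  | tmul b r =>
    rw [show b ⊗ₜ[k] r = (b ⊗ₜ 1) * (1 ⊗ₜ r) by simp]
    refine RingHom.IsIntegralElem.mul _ ?_ ?_
    · let : Algebra (A ⊗[k] R) (B ⊗[k] R) :=
        (Algebra.TensorProduct.map g (AlgHom.id k R)).toRingHom.toAlgebra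
      have : IsScalarTower k (A ⊗[k] R) (B ⊗[k] R) := .of_algebraMap_eq fun x =>
        ((Algebra.TensorProduct.map g (AlgHom.id k R)).commutes x).symm
      have h1 : IsIntegral k (b ⊗ₜ[k] (1 : R)) := (Algebra.IsIntegral.isIntegral b).map
        (Algebra.TensorProduct.includeLeft : B →ₐ[k] B ⊗[k] R)
      exact h1.tower_top (A := A ⊗[k] R)
    · have : (1 : B) ⊗ₜ[k] r =
          (Algebra.TensorProduct.map g (AlgHom.id k R)).toRingHom (1 ⊗ₜ r) := by
        simp
      rw [this]
      exact RingHom.isIntegralElem_map _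

end pairing

section abbrevs

variable {k : Type u} [Field k] {A B : Type u} [CommRing A] [CommRing B] [Algebra k A] [Algebra k B]
  {R S : Type*} [CommRing R] [CommRing S] [Algebra k R] [Algebra k S]

/-- The map `A ⊗ R → B ⊗ R` induced by `A → B`. -/
noncomputable abbrev mapL (f : A →ₐ[k] B) (R : Type*) [CommRing R] [Algebra k R] :
    A ⊗[k] R →ₐ[k] B ⊗[k] R :=
  Algebra.TensorProduct.map f (AlgHom.id k R)

/-- The map `B ⊗ R → B ⊗ S` induced by `R → S`. -/
noncomputable abbrev mapR (B : Type*) [CommRing B] [Algebra k B] (φ : R →ₐ[k] S) :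
    B ⊗[k] R →ₐ[k] B ⊗[k] S :=
  Algebra.TensorProduct.map (AlgHom.id k B) φ

theorem mapR_mem_range (f : A →ₐ[k] B) (φ : R →ₐ[k] S) {x : B ⊗[k] R}
    (hx : x ∈ (mapL f R).range) : mapR B φ x ∈ (mapL f S).range := by
  rw [AlgHom.mem_range] at hx ⊢
  obtain ⟨a, ha⟩ := hx
  refine ⟨mapR A φ a, ?_⟩
  rw [← ha]
  exact (map_map_comm f φ a).symm

end abbrevs

section sections

variable {k : Type u} [Field k] {C D : Type u} [CommRing C] [CommRing D] [Algebra k C] [Algebra k D]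
  {L : Type*} [Field L] [Algebra k L] {R : Type*} [CommRing R] [Algebra k R]

theorem evalPoints_eq_of_mem_range {i : C →ₐ[k] D} {e : (C →ₐ[k] L) → (D →ₐ[k] L)}
    (he : ∀ τ, (e τ).comp i = τ) (l : L →ₐ[k] R) {x : D ⊗[k] R} (hx : x ∈ (mapL i R).range)
    (σ : D →ₐ[k] L) : evalPoints D l x σ = evalPoints D l x (e (σ.comp i)) := by
  obtain ⟨y, rfl⟩ := hx
  exact (evalPoints_comp l i y σ).trans ((evalPoints_comp l i y _).trans (by rw [he])).symm

theorem mem_range_of_evalPoints_eq [Module.Finite k C] [Module.Finite k D] (hC : IsSplitBy k L C)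
    (hD : IsSplitBy k L D) {i : C →ₐ[k] D} {e : (C →ₐ[k] L) → (D →ₐ[k] L)} (l : L →ₐ[k] R)
    {x : D ⊗[k] R}
    (hx : ∀ σ, evalPoints D l x σ = evalPoints D l x (e (σ.comp i))) : x ∈ (mapL i R).range := by
  obtain ⟨y, hy⟩ := (hC.bijective l).2 fun τ => evalPoints D l x (e τ)
  refine ⟨y, (hD.bijective l).1 (funext fun σ => ?_)⟩
  exact (evalPoints_comp l i y σ).trans (by rw [hy, hx σ])

end sections

variable {k : Type u} [Field k] {A B C D : Type u} [CommRing A] [CommRing B] [CommRing C]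
  [CommRing D] [Algebra k A] [Algebra k B] [Algebra k C] [Algebra k D]

/-- The situation of `C = A_sep ⊂ D = B_sep`, lifted to `A ⊂ B` by `s`; the last field is a form of
the statement that `B` is radicial over `D` up to nilpotents. -/
structure SepPair (g : A →ₐ[k] B) (i : C →ₐ[k] D) (s : D →ₐ[k] B) : Prop where
  injective_g : Function.Injective g
  injective_i : Function.Injective i
  mem_iff : ∀ d, s d ∈ g.range ↔ d ∈ i.range
  exists_pow : ∃ q : ℕ, 0 < q ∧ ∀ (R : Type u) [CommRing R] [Algebra k R] (x : (B ⊗[k] R)ˣ),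
    ∃ c : (D ⊗[k] R)ˣ, ∀ (S : Type u) [CommRing S] [Algebra k S] (ψ : R →ₐ[k] S) (t : D ⊗[k] S),
      mapL s S t * mapR B ψ x ∈ (mapL g S).range → t ^ q * mapR D ψ c ∈ (mapL i S).range

namespace SepPair

variable {g : A →ₐ[k] B} {i : C →ₐ[k] D} {s : D →ₐ[k] B}

theorem mem_range_iff (P : SepPair g i s) {R : Type u} [CommRing R] [Algebra k R] {x : D ⊗[k] R} :
    mapL s R x ∈ (mapL g R).range ↔ x ∈ (mapL i R).range := by
  refine ⟨mem_range_map_of_map_mem fun d => (P.mem_iff d).1, ?_⟩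
  rintro ⟨y, rfl⟩
  change mapL s R (mapL i R y) ∈ _
  induction y with
  | zero => rw [map_zero, map_zero]; exact zero_mem _
  | add x y hx hy => rw [map_add, map_add]; exact add_mem hx hy
  | tmul c r =>
    obtain ⟨a, ha⟩ := (P.mem_iff (i c)).2 ⟨c, rfl⟩
    exact ⟨a ⊗ₜ r, by simpa using congrArg (· ⊗ₜ[k] r) ha⟩

variable {L : Type u} [Field L] [Algebra k L] {e : (C →ₐ[k] L) → (D →ₐ[k] L)}

theorem evalPoints_pow (he : ∀ τ, (e τ).comp i = τ) {R : Type u} [CommRing R] [Algebra k R]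
    (l : L →ₐ[k] R) {q : ℕ} {t : D ⊗[k] R} {c : (D ⊗[k] R)ˣ}
    (ht : t ^ q * c ∈ (mapL i R).range) (h1 : ∀ τ, evalPoints D l t (e τ) = 1) (σ : D →ₐ[k] L) :
    evalPoints D l t σ ^ q =
      evalPoints D l c (e (σ.comp i)) * evalPoints D l (c⁻¹ : (D ⊗[k] R)ˣ) σ := by
  have h2 := evalPoints_eq_of_mem_range he l ht σ
  have h3 : evalPoints D l c σ * evalPoints D l (c⁻¹ : (D ⊗[k] R)ˣ) σ = 1 := by
    rw [← Pi.mul_apply, ← map_mul, Units.mul_inv, map_one, Pi.one_apply]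
  simp only [map_mul, map_pow, Pi.mul_apply, Pi.pow_apply, h1, one_pow, one_mul] at h2
  rw [← h2, mul_assoc, h3, mul_one]

theorem isUnit_of_normalized [Module.Finite k D] (hD : IsSplitBy k L D)
    (he : ∀ τ, (e τ).comp i = τ) {R : Type u} [CommRing R] [Algebra k R]
    (l : L →ₐ[k] R) {q : ℕ} (hq : 0 < q) {t : D ⊗[k] R} {c : (D ⊗[k] R)ˣ}
    (ht : t ^ q * c ∈ (mapL i R).range) (h1 : ∀ τ, evalPoints D l t (e τ) = 1) : IsUnit t := by
  rw [← isUnit_pow_iff hq.ne']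
  have h2 := evalPoints_pow he l ht h1
  have hu : ∀ (c : (D ⊗[k] R)ˣ) σ, IsUnit (evalPoints D l c σ) := fun c σ =>
    (c.isUnit.map (evalPoints D l)).map (Pi.evalAlgHom k _ σ)
  have h3 : IsUnit (evalPoints D l (t ^ q)) := Pi.isUnit_iff.2 fun σ => by
    rw [map_pow, Pi.pow_apply, h2]
    exact (hu _ _).mul (hu _ _)
  exact (isUnit_map_iff (AlgEquiv.ofBijective _ (hD.bijective l)) _).1 h3

theorem normalized_unique [Module.Finite k B] [Module.Finite k D] (P : SepPair g i s)
    (hD : IsSplitBy k L D) (he : ∀ τ, (e τ).comp i = τ) {R : Type u} [CommRing R] [Algebra k R]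
    (l : L →ₐ[k] R) {x : (B ⊗[k] R)ˣ} {t t' : D ⊗[k] R}
    (ht : mapL s R t * x ∈ (mapL g R).range) (h1 : ∀ τ, evalPoints D l t (e τ) = 1)
    (ht' : mapL s R t' * x ∈ (mapL g R).range) (h1' : ∀ τ, evalPoints D l t' (e τ) = 1) :
    t = t' := by
  obtain ⟨q, hq, hpow⟩ := P.exists_pow
  obtain ⟨c, hc⟩ := hpow R x
  have hid : ∀ (E : Type u) [CommRing E] [Algebra k E] (y : E ⊗[k] R),
      mapR E (AlgHom.id k R) y = y := fun E _ _ y =>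
    DFunLike.congr_fun (Algebra.TensorProduct.map_id (R := k) (S := k) (A := E) (B := R)) y
  have hcR := hc R (AlgHom.id k R) t (by rwa [hid])
  rw [hid] at hcR
  obtain ⟨t, rfl⟩ := isUnit_of_normalized hD he l hq hcR h1
  obtain ⟨a, ha⟩ := ht
  obtain ⟨a', ha'⟩ := ht'
  have hloc := (isIntegral_map g R).isLocalHom (map_injective_of_injective P.injective_g R)
  have hau : IsUnit a := by
    apply hloc.map_nonunit
    change IsUnit (mapL g R a)
    rw [show mapL g R a = _ from ha]
    exact ((t.isUnit.map (mapL s R)).mul x.isUnit)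
  obtain ⟨a, rfl⟩ := hau
  have key : t' * (t⁻¹ : (D ⊗[k] R)ˣ) ∈ (mapL i R).range := by
    rw [← P.mem_range_iff]
    refine ⟨a' * (a⁻¹ : (A ⊗[k] R)ˣ), ?_⟩
    change mapL g R _ = _
    have h2 : mapL g R (a : A ⊗[k] R) * mapL g R (a⁻¹ : (A ⊗[k] R)ˣ) = 1 := by
      rw [← map_mul, Units.mul_inv, map_one]
    have h3 : mapL s R (t : D ⊗[k] R) * mapL s R (t⁻¹ : (D ⊗[k] R)ˣ) = 1 := by
      rw [← map_mul, Units.mul_inv, map_one]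
    have ha2 : mapL g R (a : A ⊗[k] R) = _ := ha
    have ha3 : mapL g R a' = _ := ha'
    rw [map_mul, map_mul, ha3]
    rw [ha2] at h2
    linear_combination (mapL s R t' * mapL s R (t⁻¹ : (D ⊗[k] R)ˣ)) * h2
      - (mapL s R t' * x * mapL g R (a⁻¹ : (A ⊗[k] R)ˣ)) * h3
  have h2 : t' * (t⁻¹ : (D ⊗[k] R)ˣ) = 1 := by
    apply (hD.bijective l).1
    funext σ
    rw [evalPoints_eq_of_mem_range he l key, map_mul, Pi.mul_apply, h1', one_mul, map_one,
      Pi.one_apply]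
    have h3 :
        evalPoints D l t (e (σ.comp i)) * evalPoints D l (t⁻¹ : (D ⊗[k] R)ˣ) (e (σ.comp i)) = 1 := by
      rw [← Pi.mul_apply, ← map_mul, Units.mul_inv, map_one, Pi.one_apply]
    rwa [h1, one_mul] at h3
  exact (Units.mul_inv_eq_one.1 h2).symm

end SepPair

theorem mapR_comp {k : Type u} [Field k] {B : Type u} [CommRing B] [Algebra k B] {R S T : Type*}
    [CommRing R] [CommRing S] [CommRing T] [Algebra k R] [Algebra k S] [Algebra k T]
    (φ : R →ₐ[k] S) (ψ : S →ₐ[k] T) (x : B ⊗[k] R) :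
    mapR B ψ (mapR B φ x) = mapR B (ψ.comp φ) x := by
  induction x with
  | zero => simp
  | add x y hx hy => simp only [map_add, hx, hy]
  | tmul x y => simp

namespace SepPair

variable {k : Type u} [Field k] {A B C D : Type u} [CommRing A] [CommRing B] [CommRing C]
  [CommRing D] [Algebra k A] [Algebra k B] [Algebra k C] [Algebra k D]
  {g : A →ₐ[k] B} {i : C →ₐ[k] D} {s : D →ₐ[k] B}
  {L : Type u} [Field L] [Algebra k L] {e : (C →ₐ[k] L) → (D →ₐ[k] L)}

/-- The universal normalized `t` which moves `x` into `A`. -/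
theorem exists_universal [Module.Finite k D] (g : A →ₐ[k] B) (s : D →ₐ[k] B)
    (hD : IsSplitBy k L D) (e : (C →ₐ[k] L) → (D →ₐ[k] L))
    {R : Type u} [CommRing R] [Algebra k R] (l : L →ₐ[k] R) (x : B ⊗[k] R) :
    ∃ (E : Type u) (_ : CommRing E) (_ : Algebra k E) (_ : Algebra R E) (_ : IsScalarTower k R E)
      (t : D ⊗[k] E), mapL s E t * mapR B (IsScalarTower.toAlgHom k R E) x ∈ (mapL g E).range ∧
      (∀ τ, evalPoints D ((IsScalarTower.toAlgHom k R E).comp l) t (e τ) = 1) ∧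
      Algebra.adjoin R (Set.range
        (evalPoints D ((IsScalarTower.toAlgHom k R E).comp l) t)) = ⊤ ∧
      ∀ (S : Type u) [CommRing S] [Algebra k S] (ψ : R →ₐ[k] S) (t : D ⊗[k] S),
        mapL s S t * mapR B ψ x ∈ (mapL g S).range →
        (∀ τ, evalPoints D (ψ.comp l) t (e τ) = 1) →
        ∃ θ : E →ₐ[k] S, θ.comp (IsScalarTower.toAlgHom k R E) = ψ := by
  let M := MvPolynomial (D →ₐ[k] L) R
  let φM : R →ₐ[k] M := IsScalarTower.toAlgHom k R M
  obtain ⟨tM, htM⟩ := (hD.bijective (φM.comp l)).2 fun σ => MvPolynomial.X σ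
  let J₀ : Ideal M := Ideal.span ({z | ∃ τ, z = MvPolynomial.X (e τ) - 1} ∪
    {z | ∃ ℓ : B →ₗ[k] k, (∀ a, ℓ (g a) = 0) ∧
      z = pairing ℓ M (mapL s M tM * mapR B φM x)})
  let π : M →ₐ[R] M ⧸ J₀ := Ideal.Quotient.mkₐ R J₀
  let πk : M →ₐ[k] M ⧸ J₀ := π.restrictScalars k
  let φE : R →ₐ[k] M ⧸ J₀ := IsScalarTower.toAlgHom k R (M ⧸ J₀)
  have hφE : πk.comp φM = φE := AlgHom.ext fun r => π.commutes r
  have htE : ∀ σ, evalPoints D (φE.comp l) (mapR D πk tM) σ = π (MvPolynomial.X σ) := fun σ => by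
    rw [← hφE, AlgHom.comp_assoc]
    exact (evalPoints_map (φM.comp l) πk tM σ).trans (by rw [htM]; rfl)
  refine ⟨M ⧸ J₀, inferInstance, inferInstance, inferInstance, inferInstance, mapR D πk tM,
    ?_, fun τ => ?_, ?_, ?_⟩
  · have hEr : mapL s (M ⧸ J₀) (mapR D πk tM) * mapR B φE x =
        mapR B πk (mapL s M tM * mapR B φM x) := by
      rw [map_mul, mapR_comp, hφE]
      exact congrArg (· * _) (map_map_comm s πk tM).symm
    rw [hEr, mem_range_map_iff]
    intro ℓ hℓ
    refine (pairing_map ℓ πk _).trans ?_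
    exact Ideal.Quotient.eq_zero_iff_mem.2 (Ideal.subset_span (.inr ⟨ℓ, hℓ, rfl⟩))
  · rw [htE, ← sub_eq_zero, ← map_one π, ← map_sub]
    exact Ideal.Quotient.eq_zero_iff_mem.2 (Ideal.subset_span (.inl ⟨τ, rfl⟩))
  · rw [show evalPoints D (φE.comp l) (mapR D πk tM) = π ∘ MvPolynomial.X from funext htE,
      Set.range_comp, ← AlgHom.map_adjoin, MvPolynomial.adjoin_range_X, Algebra.map_top,
      AlgHom.range_eq_top]
    exact Ideal.Quotient.mkₐ_surjective R J₀
  · intro S _ _ ψ t ht ht1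
    let θM : M →ₐ[k] S :=
      { MvPolynomial.eval₂Hom (ψ : R →+* S) (fun σ => evalPoints D (ψ.comp l) t σ) with
        commutes' := fun r => (MvPolynomial.eval₂Hom_C _ _ _).trans (ψ.commutes r) }
    have hθC : θM.comp φM = ψ := AlgHom.ext fun r => MvPolynomial.eval₂Hom_C _ _ _
    have hθX : ∀ σ, θM (MvPolynomial.X σ) = evalPoints D (ψ.comp l) t σ :=
      fun σ => MvPolynomial.eval₂Hom_X' _ _ _
    have hθt : mapR D θM tM = t := by
      apply (hD.bijective (ψ.comp l)).1
      funext σ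
      rw [← hθX, ← hθC, AlgHom.comp_assoc]
      exact (evalPoints_map (φM.comp l) θM tM σ).trans (by rw [htM])
    have hJ : ∀ z ∈ J₀, θM z = 0 := by
      change J₀ ≤ RingHom.ker θM
      rw [Ideal.span_le]
      rintro _ (⟨τ, rfl⟩ | ⟨ℓ, hℓ, rfl⟩)
      · change θM _ = 0
        rw [map_sub, hθX, ht1, map_one, sub_self]
      · change θM _ = 0
        rw [← pairing_map]
        refine (mem_range_map_iff g).1 ?_ ℓ hℓ
        have h1 : mapR B θM (mapL s M tM) = mapL s S t :=
          (map_map_comm s θM tM).trans (congrArg _ hθt)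
        have h2 : mapR B θM (mapR B φM x) = mapR B ψ x := by rw [mapR_comp, hθC]
        have h3 : mapR B θM (mapL s M tM * mapR B φM x) = mapL s S t * mapR B ψ x := by
          rw [map_mul, h1, h2]
        rw [← h3] at ht
        exact ht
    exact ⟨Ideal.Quotient.liftₐ J₀ θM hJ, AlgHom.ext fun r => DFunLike.congr_fun hθC r⟩

theorem surjective_algebraMap_of_normalized [Module.Finite k B] [Module.Finite k D]
    (P : SepPair g i s) (hD : IsSplitBy k L D) (he : ∀ τ, (e τ).comp i = τ)
    {R : Type u} [CommRing R] [Algebra k R] (l : L →ₐ[k] R) (x : (B ⊗[k] R)ˣ)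
    {E : Type u} [CommRing E] [Algebra k E] [Algebra R E] [IsScalarTower k R E] {t : D ⊗[k] E}
    (ht : mapL s E t * mapR B (IsScalarTower.toAlgHom k R E) x ∈ (mapL g E).range)
    (ht1 : ∀ τ, evalPoints D ((IsScalarTower.toAlgHom k R E).comp l) t (e τ) = 1)
    (hadj : Algebra.adjoin R (Set.range
        (evalPoints D ((IsScalarTower.toAlgHom k R E).comp l) t)) = ⊤) :
    Function.Surjective (algebraMap R E) := by
  obtain ⟨q, hq, hpow⟩ := P.exists_pow
  obtain ⟨c, hc⟩ := hpow R x
  have : Finite (D →ₐ[k] L) := finite_algHom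
  let φE : R →ₐ[k] E := IsScalarTower.toAlgHom k R E
  have hint : ∀ σ, IsIntegral R (evalPoints D (φE.comp l) t σ) := fun σ => by
    have h := evalPoints_pow (c := Units.map (mapR D φE).toRingHom.toMonoidHom c) he (φE.comp l)
      (hc E φE t ht) ht1 σ
    have h1 : ∀ (c : (D ⊗[k] R)ˣ) σ, evalPoints D (φE.comp l) (mapR D φE c) σ =
      algebraMap R E (evalPoints D l c σ) := fun c σ => evalPoints_map l φE c σ
    have h4 := h.trans (congrArg₂ _ (h1 c _) (h1 c⁻¹ σ))
    rw [← map_mul] at h4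
    exact IsIntegral.of_pow hq (h4 ▸ isIntegral_algebraMap)
  have : Algebra.FiniteType R E :=
    ⟨(Set.finite_range (evalPoints D (φE.comp l) t)).toFinset, by simpa using hadj⟩
  have hI : Algebra.IsIntegral R E := by
    refine ⟨fun z => ?_⟩
    have hz : z ∈ Algebra.adjoin R (Set.range (evalPoints D (φE.comp l) t)) := hadj ▸ trivial
    refine Algebra.adjoin_le (S := integralClosure R E) ?_ hz
    rintro _ ⟨σ, rfl⟩
    exact hint σ
  have hfin : Module.Finite R E := Algebra.IsIntegral.finite
  have hepi : Algebra.IsEpi R E := by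
    let φ₂ : R →ₐ[k] E ⊗[R] E := IsScalarTower.toAlgHom k R (E ⊗[R] E)
    have hφ : ∀ j : E →ₐ[R] E ⊗[R] E, (j.restrictScalars k).comp φE = φ₂ :=
      fun j => AlgHom.ext fun r => j.commutes r
    have hev : ∀ (j : E →ₐ[R] E ⊗[R] E) σ,
        evalPoints D (φ₂.comp l) (mapR D (j.restrictScalars k) t) σ =
          j (evalPoints D (φE.comp l) t σ) := by
      intro j σ
      rw [← hφ j, AlgHom.comp_assoc]
      exact evalPoints_map (φE.comp l) (j.restrictScalars k) t σ
    have hmem : ∀ j : E →ₐ[R] E ⊗[R] E, mapL s _ (mapR D (j.restrictScalars k) t) * mapR B φ₂ x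
        ∈ (mapL g (E ⊗[R] E)).range := by
      intro j
      have h0 : mapR B (j.restrictScalars k) (mapL s E t * mapR B φE x) =
          mapL s _ (mapR D (j.restrictScalars k) t) * mapR B φ₂ x := by
        rw [map_mul, mapR_comp, hφ]
        exact congrArg (· * _) (map_map_comm s (j.restrictScalars k) t)
      rw [← h0]
      exact mapR_mem_range g (j.restrictScalars k) ht
    have hone : ∀ (j : E →ₐ[R] E ⊗[R] E) τ,
        evalPoints D (φ₂.comp l) (mapR D (j.restrictScalars k) t) (e τ) = 1 := fun j τ => by
      rw [hev]
      exact (congrArg j (ht1 τ)).trans (map_one j)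
    let i₁ : E →ₐ[R] E ⊗[R] E := Algebra.TensorProduct.includeLeft
    let i₂ : E →ₐ[R] E ⊗[R] E := Algebra.TensorProduct.includeRight
    have heq := P.normalized_unique hD he (φ₂.comp l)
      (x := Units.map (mapR B φ₂).toRingHom.toMonoidHom x) (hmem i₁) (hone i₁) (hmem i₂) (hone i₂)
    have h12 : i₁ = i₂ := by
      refine AlgHom.ext_of_adjoin_eq_top hadj ?_
      rintro _ ⟨σ, rfl⟩
      change i₁ (evalPoints D (φE.comp l) t σ) = i₂ (evalPoints D (φE.comp l) t σ)
      rw [← hev, ← hev, heq]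
    rw [Algebra.isEpi_iff_forall_one_tmul_eq]
    exact fun z => (DFunLike.congr_fun h12 z).symm
  exact Algebra.isEpi_iff_surjective_algebraMap_of_finite.1 hepi

/-- The `t` which move `x` into `A` and are normalized on the chosen points `e τ` are
parametrized by a quotient of the base ring. -/
theorem exists_ideal_normalized [Module.Finite k B] [Module.Finite k D]
    (P : SepPair g i s) (hD : IsSplitBy k L D) (he : ∀ τ, (e τ).comp i = τ)
    {R : Type u} [CommRing R] [Algebra k R] (l : L →ₐ[k] R) (x : (B ⊗[k] R)ˣ) :
    ∃ I : Ideal R, ∀ (S : Type u) [CommRing S] [Algebra k S] (ψ : R →ₐ[k] S),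
      (∃ t : D ⊗[k] S, (mapL s S t * mapR B ψ x ∈ (mapL g S).range) ∧
        ∀ τ, evalPoints D (ψ.comp l) t (e τ) = 1) ↔ ∀ y ∈ I, ψ y = 0 := by
  obtain ⟨E, _, _, _, _, t, ht, ht1, hadj, huniv⟩ := exists_universal g s hD e l (x : B ⊗[k] R)
  have hsurj := P.surjective_algebraMap_of_normalized hD he l x ht ht1 hadj
  let φE : R →ₐ[k] E := IsScalarTower.toAlgHom k R E
  refine ⟨RingHom.ker φE, fun S _ _ ψ => ⟨?_, fun hψ => ?_⟩⟩
  · rintro ⟨t', ht', ht1'⟩ y hy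
    obtain ⟨θ, rfl⟩ := huniv S ψ t' ht' ht1'
    exact (congrArg θ hy).trans (map_zero θ)
  · let θ : E →ₐ[k] S := AlgHom.liftOfSurjective φE hsurj ψ hψ
    have hθ : θ.comp φE = ψ := AlgHom.liftOfSurjective_comp φE hsurj ψ hψ
    refine ⟨mapR D θ t, ?_, fun τ => ?_⟩
    · have h0 : mapR B θ (mapL s E t * mapR B φE x) = mapL s S (mapR D θ t) * mapR B ψ x := by
        rw [map_mul, mapR_comp, hθ]
        exact congrArg (· * _) (map_map_comm s θ t)
      rw [← h0]
      exact mapR_mem_range g θ ht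
    · rw [← hθ, AlgHom.comp_assoc]
      exact (evalPoints_map (φE.comp l) θ t (e τ)).trans ((congrArg θ (ht1 τ)).trans (map_one θ))

theorem exists_ideal [Module.Finite k B] [Module.Finite k C] [Module.Finite k D]
    (P : SepPair g i s) (hC : IsSplitBy k L C) (hD : IsSplitBy k L D)
    {R : Type u} [CommRing R] [Algebra k R] (l : L →ₐ[k] R) (x : (B ⊗[k] R)ˣ) :
    ∃ I : Ideal R, ∀ (S : Type u) [CommRing S] [Algebra k S] (ψ : R →ₐ[k] S),
      (∃ t : (D ⊗[k] S)ˣ, mapL s S t * mapR B ψ x ∈ (mapL g S).range) ↔ ∀ y ∈ I, ψ y = 0 := by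
  choose e he using hC.exists_extension hD i P.injective_i
  obtain ⟨I, hI⟩ := P.exists_ideal_normalized hD he l x
  obtain ⟨q, hq, hpow⟩ := P.exists_pow
  obtain ⟨c, hc⟩ := hpow R x
  refine ⟨I, fun S _ _ ψ => ?_⟩
  rw [← hI]
  constructor
  · rintro ⟨t, ht⟩
    obtain ⟨y, hy⟩ := (hC.bijective (ψ.comp l)).2
      fun τ => evalPoints D (ψ.comp l) (t⁻¹ : (D ⊗[k] S)ˣ) (e τ)
    refine ⟨t * mapL i S y, ?_, fun τ => ?_⟩
    · rw [map_mul, mul_right_comm]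
      exact mul_mem ht (P.mem_range_iff.2 ⟨y, rfl⟩)
    · have h1 : evalPoints D (ψ.comp l) (mapL i S y) (e τ) =
          evalPoints D (ψ.comp l) (t⁻¹ : (D ⊗[k] S)ˣ) (e τ) := by
        refine (evalPoints_comp _ i y _).trans ?_
        rw [he, hy]
      rw [map_mul, Pi.mul_apply, h1, ← Pi.mul_apply, ← map_mul, Units.mul_inv, map_one,
        Pi.one_apply]
  · rintro ⟨t, ht, ht1⟩
    have hu : IsUnit t := isUnit_of_normalized (c := Units.map (mapR D ψ).toRingHom.toMonoidHom c)
      hD he (ψ.comp l) hq (hc S ψ t ht) ht1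
    obtain ⟨t, rfl⟩ := hu
    exact ⟨t, ht⟩

end SepPair

section closed

variable {k : Type u} [Field k] {A B C D : Type u} [CommRing A] [CommRing B] [CommRing C]
  [CommRing D] [Algebra k A] [Algebra k B] [Algebra k C] [Algebra k D]

theorem isFppfSheaf_relMu (f : A →ₐ[k] B) : IsFppfSheaf (relMu f) :=
  isFppfSheaf_fppfQuotient _

theorem inv_mem_range [Module.Finite k B] {g : A →ₐ[k] B} (hg : Function.Injective g)
    {R : Type u} [CommRing R] [Algebra k R] {x : (B ⊗[k] R)ˣ}
    (hx : (x : B ⊗[k] R) ∈ (mapL g R).range) :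
    ((x⁻¹ : (B ⊗[k] R)ˣ) : B ⊗[k] R) ∈ (mapL g R).range := by
  obtain ⟨a, ha⟩ := hx
  have hloc := (isIntegral_map g R).isLocalHom (map_injective_of_injective hg R)
  have hau : IsUnit a := hloc.map_nonunit _ (ha ▸ x.isUnit)
  obtain ⟨a, rfl⟩ := hau
  have h1 : Units.map (mapL g R).toRingHom.toMonoidHom a = x := Units.ext ha
  exact ⟨(a⁻¹ : (A ⊗[k] R)ˣ), h1 ▸ rfl⟩

theorem relMk_eq_zero_iff_mem [Module.Finite k B] {g : A →ₐ[k] B} (hg : Function.Injective g)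
    {R : CommAlgCat.{u} k} {x : (B ⊗[k] R)ˣ} :
    relMk g R (.ofMul x) = 0 ↔ (x : B ⊗[k] R) ∈ (mapL g R).range := by
  rw [relMk_eq_zero_iff hg, exists_tensorUnitsMap_iff hg]
  exact ⟨And.left, fun h => ⟨h, inv_mem_range hg h⟩⟩

theorem relMk_eq_relMk_iff [Module.Finite k B] {g : A →ₐ[k] B} (hg : Function.Injective g)
    {R : CommAlgCat.{u} k} {x y : (B ⊗[k] R)ˣ} :
    relMk g R (.ofMul x) = relMk g R (.ofMul y) ↔
      (y⁻¹ : (B ⊗[k] R)ˣ) * (x : B ⊗[k] R) ∈ (mapL g R).range := by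
  rw [← sub_eq_zero, ← map_sub, ← ofMul_div, relMk_eq_zero_iff_mem hg, div_eq_inv_mul,
    Units.val_mul]

theorem isCover_ofId (L : Type u) [Field L] [Algebra k L] [Module.Finite k L] :
    IsCover (CommAlgCat.ofHom (Algebra.ofId k L)) where
  flat := RingHom.flat_algebraMap_iff.2 (inferInstance : Module.Flat k L)
  finitePresentation := RingHom.finitePresentation_algebraMap.2
    (Algebra.FinitePresentation.of_finiteType.1 inferInstance)
  surjective := fun _ => ⟨⊥, Subsingleton.elim (α := PrimeSpectrum k) _ _⟩

theorem exists_isCover_algHom (L : Type u) [Field L] [Algebra k L] [Module.Finite k L]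
    (R : CommAlgCat.{u} k) : ∃ (S : CommAlgCat.{u} k) (φ : R ⟶ S) (_ : IsCover φ),
      Nonempty (L →ₐ[k] S) := by
  obtain ⟨P, a, b, -, hb⟩ := (isCover_ofId L).exists_pushout (CommAlgCat.ofHom (Algebra.ofId k R))
  exact ⟨P, b, hb, ⟨a.hom⟩⟩

namespace SepPair

variable {g : A →ₐ[k] B} {i : C →ₐ[k] D} {s : D →ₐ[k] B}

theorem relMuMap_injective [Module.Finite k B] [Module.Finite k D] (P : SepPair g i s)
    {c : C →ₐ[k] A} (h : s.comp i = g.comp c) (R : CommAlgCat.{u} k) :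
    Function.Injective ((relMuMap i g c s h).app R) := by
  rw [injective_iff_map_eq_zero]
  intro y hy
  obtain ⟨S, φ, hφ, x, hx⟩ := exists_isCover_relMk i y
  refine (isFppfSheaf_relMu i).ext hφ ?_
  rw [map_zero]
  refine hx.symm.trans ?_
  rw [relMk_eq_zero_iff_mem P.injective_i, ← P.mem_range_iff]
  refine (relMk_eq_zero_iff_mem (x := tensorUnitsMap s (AlgHom.id k S) x) P.injective_g).1 ?_
  rw [← relMuMap_relMk i g c s h, hx]
  refine (ConcreteCategory.congr_hom ((relMuMap i g c s h).naturality φ) y).trans ?_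
  exact (congrArg ((relMu g).map φ).hom hy).trans (map_zero ((relMu g).map φ).hom)

theorem isClosedImmersion [Module.Finite k B] [Module.Finite k C] [Module.Finite k D]
    [Algebra.Etale k C] [Algebra.Etale k D] (P : SepPair g i s) {c : C →ₐ[k] A}
    (h : s.comp i = g.comp c) : IsClosedImmersion (relMuMap i g c s h) := by
  obtain ⟨L, _, hC, hD⟩ := exists_isSplitBy (k := k) (C := C) (D := D)
  refine isClosedImmersion_of_local (isFppfSheaf_relMu i) (isFppfSheaf_relMu g) _
    (P.relMuMap_injective h) fun R z => ?_
  obtain ⟨S₁, φ₁, hφ₁, x₁, hx₁⟩ := exists_isCover_relMk g z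
  obtain ⟨S, φ₂, hφ₂, ⟨l⟩⟩ := exists_isCover_algHom L S₁
  let x : (B ⊗[k] S)ˣ := tensorUnitsMap (AlgHom.id k B) φ₂.hom x₁
  have hx : relMk g S (.ofMul x) = (relMu g).map (φ₁ ≫ φ₂) z := by
    rw [← relMk_map, hx₁, Functor.map_comp]
    rfl
  obtain ⟨I, hI⟩ := P.exists_ideal hC hD l x
  refine ⟨S, φ₁ ≫ φ₂, hφ₁.comp hφ₂, I, fun S' ψ => ?_⟩
  rw [← hx, relMk_map]
  set y : (B ⊗[k] S')ˣ := tensorUnitsMap (AlgHom.id k B) ψ.hom x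
  have hj : ∀ (T : CommAlgCat.{u} k) (t : (D ⊗[k] T)ˣ),
      relMk g T (.ofMul (tensorUnitsMap s (AlgHom.id k T) t)) =
      (relMuMap i g c s h).app T (relMk i T (.ofMul t)) := fun T t =>
        (relMuMap_relMk i g c s h t).symm
  constructor
  · rintro ⟨w, hw⟩
    obtain ⟨T, φ, hφ, t, ht⟩ := exists_isCover_relMk i w
    have h1 : relMk g T (.ofMul (tensorUnitsMap (AlgHom.id k B) φ.hom y)) =
        relMk g T (.ofMul (tensorUnitsMap s (AlgHom.id k T) t)) := by
      rw [hj, ht, ← relMk_map, ← hw]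
      exact (ConcreteCategory.congr_hom ((relMuMap i g c s h).naturality φ) w).symm
    rw [relMk_eq_relMk_iff P.injective_g] at h1
    have h2 : ∃ t : (D ⊗[k] T)ˣ, mapL s T t * mapR B (φ.hom.comp ψ.hom) x ∈ (mapL g T).range := by
      refine ⟨t⁻¹, ?_⟩
      rw [← mapR_comp]
      exact h1
    intro a ha
    apply hφ.injective
    rw [map_zero]
    exact (hI T (φ.hom.comp ψ.hom)).1 h2 a ha
  · intro hψ
    obtain ⟨t, ht⟩ := (hI S' ψ.hom).2 hψ
    refine ⟨relMk i S' (.ofMul t⁻¹), ?_⟩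
    rw [← hj]
    refine ((relMk_eq_relMk_iff P.injective_g).2 ?_).symm
    rw [← map_inv, inv_inv]
    exact ht

end SepPair

end closed

section sep

variable {k : Type u} [Field k] {B : Type u} [CommRing B] [Algebra k B]
  {A : Subalgebra k B} {s : sepTop k B →ₐ[k] B}

theorem exists_mapL_eq_pow {D : Type u} [CommRing D] [Algebra k D] {s : D →ₐ[k] B} (p : ℕ)
    [Fact p.Prime] [CharP k p] {n : ℕ}
    (hn : ∀ b : B, ∃ t, s t = b ^ p ^ n) {R : Type u} [CommRing R] [Algebra k R]
    (x : B ⊗[k] R) : ∃ c : D ⊗[k] R, mapL s R c = x ^ p ^ n := by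
  have hp : 0 < p ^ n := pow_pos (Fact.out : p.Prime).pos _
  induction x with
  | zero => exact ⟨0, by rw [map_zero, zero_pow hp.ne']⟩
  | add x y hx hy =>
    obtain ⟨c, hc⟩ := hx
    obtain ⟨d, hd⟩ := hy
    exact ⟨c + d, by rw [map_add, hc, hd, add_pow_char_pow_of_algebra k]⟩
  | tmul b r =>
    obtain ⟨t, ht⟩ := hn b
    exact ⟨t ⊗ₜ (r ^ p ^ n), by
      rw [Algebra.TensorProduct.map_tmul, ht, Algebra.TensorProduct.tmul_pow]; rfl⟩

/-- A retraction of the lift of `B_sep`, if `B_red` is separable. -/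
theorem exists_retraction (hs : (toRed k B).comp s = (sepTop k B).val) (h : sepTop k B = ⊤) :
    ∃ p : B →ₐ[k] sepTop k B, p.comp s = AlgHom.id k _ ∧
      (sepTop k B).val.comp p = toRed k B := by
  let p : B →ₐ[k] sepTop k B := (toRed k B).codRestrict _ fun x => h ▸ trivial
  exact ⟨p, AlgHom.ext fun x => Subtype.ext (toRed_lift hs x), rfl⟩

variable [Module.Finite k B]

theorem exists_mapL_eq_pow_unit {D : Type u} [CommRing D] [Algebra k D] {s : D →ₐ[k] B}
    (hs : Function.Injective s) (p : ℕ) [Fact p.Prime] [CharP k p] {n : ℕ}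
    (hn : ∀ b : B, ∃ t, s t = b ^ p ^ n) {R : Type u} [CommRing R] [Algebra k R]
    (x : (B ⊗[k] R)ˣ) : ∃ c : (D ⊗[k] R)ˣ, mapL s R c = (x : B ⊗[k] R) ^ p ^ n := by
  obtain ⟨c, hc⟩ := exists_mapL_eq_pow p hn (x : B ⊗[k] R)
  have hloc := (isIntegral_map s R).isLocalHom (map_injective_of_injective hs R)
  have hcu : IsUnit c := by
    refine hloc.map_nonunit _ ?_
    change IsUnit (mapL s R c)
    rw [hc]
    exact x.isUnit.pow _
  exact ⟨hcu.unit, hc⟩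

theorem exists_pow_spec {D : Type u} [CommRing D] [Algebra k D] {s : D →ₐ[k] B}
    (hs : Function.Injective s) {C : Type u} [CommRing C] [Algebra k C] {A : Type u} [CommRing A]
    [Algebra k A] {g : A →ₐ[k] B} {i : C →ₐ[k] D}
    (h : ∀ d, s d ∈ g.range → d ∈ i.range) (p : ℕ) [Fact p.Prime] [CharP k p] {n : ℕ}
    (hn : ∀ b : B, ∃ t, s t = b ^ p ^ n) {R : Type u} [CommRing R] [Algebra k R]
    (x : (B ⊗[k] R)ˣ) : ∃ c : (D ⊗[k] R)ˣ, ∀ (S : Type u) [CommRing S] [Algebra k S]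
      (ψ : R →ₐ[k] S) (t : D ⊗[k] S), mapL s S t * mapR B ψ x ∈ (mapL g S).range →
        t ^ p ^ n * mapR D ψ c ∈ (mapL i S).range := by
  obtain ⟨c, hc⟩ := exists_mapL_eq_pow_unit hs p hn x
  refine ⟨c, fun S _ _ ψ t ht => ?_⟩
  refine mem_range_map_of_map_mem h ?_
  have h1 : mapL s S (mapR D ψ c) = mapR B ψ x ^ p ^ n := by
    rw [← map_pow, ← hc]
    exact (map_map_comm s ψ (c : D ⊗[k] R)).symm
  have h2 := pow_mem ht (p ^ n)
  rw [mul_pow, ← h1, ← map_pow, ← map_mul] at h2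
  exact h2

theorem map_retraction_mem (h : sepTop k B = ⊤)
    {p : B →ₐ[k] sepTop k B} (hp : (sepTop k B).val.comp p = toRed k B) {a : B} (ha : a ∈ A) :
    p a ∈ (sepIncl A).range := by
  have h1 : ((p a : sepTop k B) : Red B) ∈ sepSub A := by
    rw [sepSub_eq_redSub h]
    exact ⟨a, ha, (DFunLike.congr_fun hp a).symm⟩
  exact ⟨⟨_, h1⟩, rfl⟩

theorem sepPair (hs : (toRed k B).comp s = (sepTop k B).val) :
    SepPair A.val (sepIncl A) s where
  injective_g := Subtype.val_injective
  injective_i := Subalgebra.inclusion_injective _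
  mem_iff d := by
    rw [Subalgebra.range_val]
    refine ⟨mem_range_sepIncl hs, ?_⟩
    rintro ⟨y, rfl⟩
    exact lift_sepIncl_mem hs y
  exists_pow := by
    obtain ⟨p, hp⟩ := CharP.exists k
    rcases CharP.char_is_prime_or_zero k p with hp' | rfl
    · have : Fact p.Prime := ⟨hp'⟩
      obtain ⟨n, hn⟩ := exists_pow_eq_lift hs p
      refine ⟨p ^ n, pow_pos hp'.pos _, fun R _ _ x => exists_pow_spec (lift_injective hs)
        (fun d hd => ?_) p hn x⟩
      rw [Subalgebra.range_val] at hd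
      exact mem_range_sepIncl hs hd
    · have : CharZero k := CharP.charP_to_charZero k
      have htop : sepTop k B = ⊤ := sepTop_eq_top_of_perfectField
      obtain ⟨r, hr, hr'⟩ := exists_retraction hs htop
      refine ⟨1, one_pos, fun R _ _ x => ⟨Units.map (mapL r R).toRingHom.toMonoidHom x,
        fun S _ _ ψ t ht => ?_⟩⟩
      obtain ⟨a, ha⟩ := ht
      have h1 : mapL r S (mapL s S t * mapR B ψ x) = t * mapR (sepTop k B) ψ (mapL r R x) := by
        rw [map_mul]
        refine congrArg₂ _ ?_ (map_map_comm r ψ (x : B ⊗[k] R)).symm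
        have h2 := DFunLike.congr_fun (Algebra.TensorProduct.map_comp r s (AlgHom.id k S)
          (AlgHom.id k S)) t
        rw [hr] at h2
        refine h2.symm.trans ?_
        exact DFunLike.congr_fun (Algebra.TensorProduct.map_id (R := k) (S := k)
          (A := sepTop k B) (B := S)) t
      rw [pow_one]
      refine (congrArg (· ∈ _) h1).mp ?_
      rw [← ha]
      change mapL r S (mapL A.val S a) ∈ _
      clear ha h1
      induction a with
      | zero => rw [map_zero, map_zero]; exact zero_mem _
      | add x y hx hy => rw [map_add, map_add]; exact add_mem hx hy
      | tmul a z =>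
        obtain ⟨c, hc⟩ := map_retraction_mem htop hr' a.2
        exact ⟨c ⊗ₜ z, by simpa using congrArg (· ⊗ₜ[k] z) hc⟩

theorem isClosedImmersion_sepToRelMu (hs : (toRed k B).comp s = (sepTop k B).val)
    (hA : ∀ x, s (sepIncl A x) ∈ A) : IsClosedImmersion (sepToRelMu A s hA) := by
  have := etale_sepPart (⊤ : Subalgebra k (Red B))
  have := etale_sepPart (redSub A)
  exact (sepPair hs).isClosedImmersion _

end sep

section functors

variable {k : Type u} [Field k]

theorem exists_desc {G H M : GrpFunctor k} (α : M ⟶ G) (β : M ⟶ H)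
    (hα : ∀ R, Function.Surjective (α.app R)) (h : ∀ R x, α.app R x = 0 → β.app R x = 0) :
    ∃ γ : G ⟶ H, α ≫ γ = β := by
  let γ (R : CommAlgCat.{u} k) : G.obj R →+ H.obj R :=
    AddMonoidHom.liftOfRightInverse (α.app R).hom _ (Function.rightInverse_surjInv (hα R))
      ⟨(β.app R).hom, fun x hx => h R x hx⟩
  have hγ (R x) : γ R (α.app R x) = β.app R x :=
    AddMonoidHom.liftOfRightInverse_comp_apply (α.app R).hom _
      (Function.rightInverse_surjInv (hα R)) ⟨(β.app R).hom, fun x hx => h R x hx⟩ x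
  refine ⟨{ app := fun R => AddCommGrpCat.ofHom (γ R), naturality := fun R S φ => ?_ }, ?_⟩
  · ext y
    obtain ⟨x, rfl⟩ := hα R y
    have h1 : G.map φ (α.app R x) = α.app S (M.map φ x) :=
      (ConcreteCategory.congr_hom (α.naturality φ) x).symm
    change γ S (G.map φ (α.app R x)) = H.map φ (γ R (α.app R x))
    rw [h1, hγ, hγ]
    exact ConcreteCategory.congr_hom (β.naturality φ) x
  · ext R x
    exact hγ R x

theorem hom_ext_of_surjective {G H M : GrpFunctor k} {α : M ⟶ G}
    (hα : ∀ R, Function.Surjective (α.app R)) {β γ : G ⟶ H} (h : α ≫ β = α ≫ γ) : β = γ := by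
  ext R y
  obtain ⟨x, rfl⟩ := hα R y
  exact ConcreteCategory.congr_hom (congr_app h R) x

theorem exists_iso_of_surjective {G H M : GrpFunctor k} (α : M ⟶ G) (β : M ⟶ H)
    (hα : ∀ R, Function.Surjective (α.app R)) (hβ : ∀ R, Function.Surjective (β.app R))
    (h : ∀ R x, α.app R x = 0 ↔ β.app R x = 0) : Nonempty (G ≅ H) := by
  obtain ⟨γ, hγ⟩ := exists_desc α β hα fun R x => (h R x).1
  obtain ⟨δ, hδ⟩ := exists_desc β α hβ fun R x => (h R x).2
  exact ⟨⟨γ, δ, hom_ext_of_surjective hα (by rw [reassoc_of% hγ, hδ, Category.comp_id]),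
    hom_ext_of_surjective hβ (by rw [reassoc_of% hδ, hγ, Category.comp_id])⟩⟩

/-- A universal element represents a group functor. -/
theorem nonempty_iso_of_universal {G : GrpFunctor k} {H : CommAlgCat.{u} k} (y : G.obj H)
    (hinj : ∀ (R : CommAlgCat.{u} k) (ψ ψ' : H ⟶ R), G.map ψ y = G.map ψ' y → ψ = ψ')
    (hsurj : ∀ (R : CommAlgCat.{u} k) (z : G.obj R), ∃ ψ : H ⟶ R, G.map ψ y = z) :
    Nonempty (G ⋙ forget AddCommGrpCat.{u + 1} ≅
      coyoneda.obj (op H) ⋙ uliftFunctor.{u + 1, u}) := by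
  let e (R : CommAlgCat.{u} k) : ULift.{u + 1} (H ⟶ R) ≃ G.obj R :=
    Equiv.ofBijective (fun ψ => G.map ψ.down y) ⟨fun ψ ψ' h => ULift.ext _ _ (hinj R _ _ h),
      fun z => let ⟨ψ, hψ⟩ := hsurj R z; ⟨⟨ψ⟩, hψ⟩⟩
  refine ⟨(NatIso.ofComponents (fun R => (e R).toIso) fun {R S} φ => ?_).symm⟩
  ext ψ
  change G.map (ψ.down ≫ φ) y = G.map φ (G.map ψ.down y)
  rw [G.map_comp]
  rfl

/-- The kernel of a homomorphism of group functors. -/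
def kernelFunctor {G H : GrpFunctor k} (β : G ⟶ H) : GrpFunctor k where
  obj R := AddCommGrpCat.of (β.app R).hom.ker
  map {R S} φ := AddCommGrpCat.ofHom (((G.map φ).hom.comp (AddSubgroup.subtype _)).codRestrict _
    fun x => (ConcreteCategory.congr_hom (β.naturality φ) x.1).trans
      ((congrArg (H.map φ).hom x.2).trans (map_zero (H.map φ).hom)))
  map_id R := by
    refine ConcreteCategory.hom_ext _ _ fun x => Subtype.ext ?_
    exact ConcreteCategory.congr_hom (G.map_id R) x.1
  map_comp φ ψ := by
    refine ConcreteCategory.hom_ext _ _ fun x => Subtype.ext ?_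
    exact ConcreteCategory.congr_hom (G.map_comp φ ψ) x.1

end functors

section cocycles

variable {k : Type u} [Field k] {E F : Type u} [CommRing E] [CommRing F] [Algebra k E] [Algebra k F]

theorem sum_tmul_pairing {V : Type*} [AddCommGroup V] [Module k V] {ι : Type*} [Fintype ι]
    (b : Module.Basis ι k V) {R : Type*} [CommRing R] [Algebra k R] (y : V ⊗[k] R) :
    ∑ i, b i ⊗ₜ pairing (b.coord i) R y = y := by
  induction y with
  | zero => simp
  | add x y hx hy => simp only [map_add, TensorProduct.tmul_add, Finset.sum_add_distrib, hx, hy]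
  | tmul x r =>
    simp only [pairing_tmul, ← TensorProduct.smul_tmul, ← TensorProduct.sum_tmul]
    rw [show ∑ i, b.coord i x • b i = x from b.sum_repr x]

/-- The units `y` of `E ⊗ R` with `q₁ y * q₂ y = q₃ y` are parametrized by an algebra of finite
type. -/
theorem exists_universal_cocycle [Module.Finite k E] (q₁ q₂ q₃ : E →ₐ[k] F) :
    ∃ (H : CommAlgCat.{u} k) (_ : Algebra.FiniteType k H) (y : (E ⊗[k] H)ˣ),
      mapL q₁ H y * mapL q₂ H y = mapL q₃ H y ∧
      (∀ (R : CommAlgCat.{u} k) (ψ ψ' : H ⟶ R),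
        tensorUnitsMap (AlgHom.id k E) ψ.hom y = tensorUnitsMap (AlgHom.id k E) ψ'.hom y → ψ = ψ') ∧
      ∀ (R : CommAlgCat.{u} k) (z : (E ⊗[k] R)ˣ), mapL q₁ R z * mapL q₂ R z = mapL q₃ R z →
        ∃ ψ : H ⟶ R, tensorUnitsMap (AlgHom.id k E) ψ.hom y = z := by
  let b := Module.finBasis k E
  let ι := Fin (Module.finrank k E)
  let M := MvPolynomial (ι ⊕ ι) k
  let xM : E ⊗[k] M := ∑ i : ι, b i ⊗ₜ MvPolynomial.X (.inl i)
  let xM' : E ⊗[k] M := ∑ i : ι, b i ⊗ₜ MvPolynomial.X (.inr i)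
  let J : Ideal M := Ideal.span ({z | ∃ ℓ : E →ₗ[k] k, z = pairing ℓ M (xM * xM' - 1)} ∪
    {z | ∃ ℓ : F →ₗ[k] k, z = pairing ℓ M (mapL q₁ M xM * mapL q₂ M xM - mapL q₃ M xM)})
  let π : M →ₐ[k] M ⧸ J := Ideal.Quotient.mkₐ k J
  have hπ : Function.Surjective π := Ideal.Quotient.mkₐ_surjective k J
  have h1 : mapR E π xM * mapR E π xM' = 1 := by
    rw [← sub_eq_zero, ← map_mul, ← map_one (mapR E π), ← map_sub]
    refine eq_zero_of_pairing fun ℓ => (pairing_map ℓ π _).trans ?_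
    exact Ideal.Quotient.eq_zero_iff_mem.2 (Ideal.subset_span (.inl ⟨ℓ, rfl⟩))
  have h2 : mapL q₁ (M ⧸ J) (mapR E π xM) * mapL q₂ (M ⧸ J) (mapR E π xM) =
      mapL q₃ (M ⧸ J) (mapR E π xM) := by
    have h3 : mapR F π (mapL q₁ M xM * mapL q₂ M xM - mapL q₃ M xM) = 0 := by
      refine eq_zero_of_pairing fun ℓ => (pairing_map ℓ π _).trans ?_
      exact Ideal.Quotient.eq_zero_iff_mem.2 (Ideal.subset_span (.inr ⟨ℓ, rfl⟩))
    rw [map_sub, map_mul, sub_eq_zero] at h3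
    exact (congrArg₂ (· * ·) (map_map_comm q₁ π xM) (map_map_comm q₂ π xM)).symm.trans
      (h3.trans (map_map_comm q₃ π xM))
  have hx : ∀ {R : Type u} [CommRing R] [Algebra k R] (ψ : M →ₐ[k] R) i,
      pairing (b.coord i) R (mapR E ψ xM) = ψ (MvPolynomial.X (.inl i)) := by
    intro R _ _ ψ i
    refine (pairing_map (b.coord i) ψ xM).trans (congrArg ψ ?_)
    simp only [xM, map_sum, pairing_tmul]
    rw [Finset.sum_eq_single i] <;> simp +contextual
  have hx' : ∀ {R : Type u} [CommRing R] [Algebra k R] (ψ : M →ₐ[k] R) i,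
      pairing (b.coord i) R (mapR E ψ xM') = ψ (MvPolynomial.X (.inr i)) := by
    intro R _ _ ψ i
    refine (pairing_map (b.coord i) ψ xM').trans (congrArg ψ ?_)
    simp only [xM', map_sum, pairing_tmul]
    rw [Finset.sum_eq_single i] <;> simp +contextual
  let y : (E ⊗[k] (M ⧸ J))ˣ := ⟨mapR E π xM, mapR E π xM', h1, (mul_comm _ _).trans h1⟩
  refine ⟨.of k (M ⧸ J), Algebra.FiniteType.of_surjective π hπ, y, h2, fun R ψ ψ' h => ?_,
    fun R z hz => ?_⟩
  · have key : ψ.hom.comp π = ψ'.hom.comp π := by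
      refine MvPolynomial.algHom_ext fun i => ?_
      rcases i with i | i
      · rw [← hx, ← hx, ← mapR_comp, ← mapR_comp]
        exact congrArg (pairing (b.coord i) R) (congrArg Units.val h)
      · rw [← hx', ← hx', ← mapR_comp, ← mapR_comp]
        exact congrArg (pairing (b.coord i) R) (congrArg (fun u => Units.val u⁻¹) h)
    ext x
    obtain ⟨m, rfl⟩ := hπ x
    exact DFunLike.congr_fun key m
  · let θ : M →ₐ[k] R := MvPolynomial.aeval (Sum.elim
      (fun i => pairing (b.coord i) R (z : E ⊗[k] R))
      fun i => pairing (b.coord i) R ((z⁻¹ : (E ⊗[k] R)ˣ) : E ⊗[k] R))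
    have hθ : mapR E θ xM = z := by
      rw [← sum_tmul_pairing b (mapR E θ xM), ← sum_tmul_pairing b (z : E ⊗[k] R)]
      refine Finset.sum_congr rfl fun i _ => ?_
      rw [hx]
      exact congrArg (b i ⊗ₜ[k] ·) (MvPolynomial.aeval_X _ _)
    have hθ' : mapR E θ xM' = (z⁻¹ : (E ⊗[k] R)ˣ) := by
      rw [← sum_tmul_pairing b (mapR E θ xM'), ← sum_tmul_pairing b
        ((z⁻¹ : (E ⊗[k] R)ˣ) : E ⊗[k] R)]
      refine Finset.sum_congr rfl fun i _ => ?_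
      rw [hx']
      exact congrArg (b i ⊗ₜ[k] ·) (MvPolynomial.aeval_X _ _)
    have hJ : ∀ w ∈ J, θ w = 0 := by
      change J ≤ RingHom.ker θ
      rw [Ideal.span_le]
      rintro _ (⟨ℓ, rfl⟩ | ⟨ℓ, rfl⟩)
      · refine (pairing_map ℓ θ _).symm.trans ?_
        have h3 : mapR E θ (xM * xM' - 1) = 0 := by
          rw [map_sub, map_mul, hθ, hθ', Units.mul_inv, map_one, sub_self]
        exact (congrArg _ h3).trans (map_zero _)
      · refine (pairing_map ℓ θ _).symm.trans ?_
        have h4 : ∀ q : E →ₐ[k] F, mapR F θ (mapL q M xM) = mapL q R z := fun q =>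
          (map_map_comm q θ xM).trans (congrArg _ hθ)
        have h3 : mapR F θ (mapL q₁ M xM * mapL q₂ M xM - mapL q₃ M xM) = 0 := by
          rw [map_sub, map_mul, h4, h4, h4, hz, sub_self]
        exact (congrArg _ h3).trans (map_zero _)
    refine ⟨CommAlgCat.ofHom (Ideal.Quotient.liftₐ J θ hJ), Units.ext ?_⟩
    refine Eq.trans ?_ hθ
    change mapR E (Ideal.Quotient.liftₐ J θ hJ) (mapR E π xM) = _
    rw [mapR_comp]
    congr 1

/-- The functor `R ↦ {y ∈ (E ⊗ R)ˣ | q₁ y * q₂ y = q₃ y}`. -/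
noncomputable abbrev cocycleFunctor (q₁ q₂ q₃ : E →ₐ[k] F) : GrpFunctor k :=
  kernelFunctor (muMap q₁ + muMap q₂ - muMap q₃)

theorem cocycle_mem_iff (q₁ q₂ q₃ : E →ₐ[k] F) {R : CommAlgCat.{u} k} (y : (E ⊗[k] R)ˣ) :
    (muMap q₁ + muMap q₂ - muMap q₃).app R (ULift.up (Additive.ofMul y)) = 0 ↔
      mapL q₁ R y * mapL q₂ R y = mapL q₃ R y := by
  have h1 : (muMap q₁ + muMap q₂ - muMap q₃).app R (ULift.up (Additive.ofMul y)) = ULift.up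
    (Additive.ofMul (tensorUnitsMap q₁ (AlgHom.id k R) y * tensorUnitsMap q₂ (AlgHom.id k R) y /
      tensorUnitsMap q₃ (AlgHom.id k R) y)) := rfl
  rw [h1]
  constructor
  · intro h
    exact congrArg Units.val (div_eq_one.1 (congrArg (fun z => Additive.toMul (ULift.down z)) h))
  · intro h
    rw [div_eq_one.2 (Units.ext h)]
    rfl

theorem isAffineGroupScheme_cocycleFunctor [Module.Finite k E] (q₁ q₂ q₃ : E →ₐ[k] F) :
    IsAffineGroupScheme (cocycleFunctor q₁ q₂ q₃) := by
  obtain ⟨H, hH, y, hy, hinj, hsurj⟩ := exists_universal_cocycle q₁ q₂ q₃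
  refine ⟨H, hH, nonempty_iso_of_universal (G := cocycleFunctor q₁ q₂ q₃)
    ⟨ULift.up (Additive.ofMul y), (cocycle_mem_iff q₁ q₂ q₃ y).2 hy⟩ (fun R ψ ψ' h => ?_)
      fun R z => ?_⟩
  · exact hinj R ψ ψ' (congrArg (fun z => Additive.toMul (ULift.down (Subtype.val z))) h)
  · obtain ⟨⟨z⟩, hz⟩ := z
    obtain ⟨ψ, hψ⟩ := hsurj R (Additive.toMul z) ((cocycle_mem_iff q₁ q₂ q₃ _).1 hz)
    exact ⟨ψ, Subtype.ext (congrArg (fun u => ULift.up (Additive.ofMul u)) hψ)⟩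

end cocycles

section retraction

variable {k : Type u} [Field k] {C D : Type u} [CommRing C] [CommRing D] [Algebra k C]
  [Algebra C D] {R : Type u} [CommRing R] [Algebra k R]

/-- The retraction `(X ⊗_C D) ⊗ R → X ⊗ R` deduced from a `C`-linear algebra map
`ρ : D → C ⊗ R`. -/
noncomputable def retractionMap (ρ : D →ₐ[C] C ⊗[k] R) (X : Type u) [CommRing X] [Algebra k X]
    [Algebra C X] [IsScalarTower k C X] : (X ⊗[C] D) ⊗[k] R →ₐ[k] X ⊗[k] R :=
  Algebra.TensorProduct.productMap
    ((Algebra.TensorProduct.productMap (Algebra.TensorProduct.includeLeft : X →ₐ[C] X ⊗[k] R)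
      ((Algebra.TensorProduct.map (Algebra.ofId C X) (AlgHom.id k R)).comp ρ)).restrictScalars k)
    Algebra.TensorProduct.includeRight

variable (ρ : D →ₐ[C] C ⊗[k] R) {X Y : Type u} [CommRing X] [Algebra k X] [Algebra C X]
  [IsScalarTower k C X] [CommRing Y] [Algebra k Y] [Algebra C Y] [IsScalarTower k C Y]

theorem retractionMap_tmul (x : X) (d : D) (r : R) :
    retractionMap ρ X ((x ⊗ₜ[C] d) ⊗ₜ r) = (x ⊗ₜ 1) *
      Algebra.TensorProduct.map (Algebra.ofId C X) (AlgHom.id k R) (ρ d) * (1 ⊗ₜ r) := by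
  simp [retractionMap]

theorem retractionMap_includeLeft (x : X ⊗[k] R) :
    retractionMap ρ X (mapL ((Algebra.TensorProduct.includeLeft :
      X →ₐ[C] X ⊗[C] D).restrictScalars k)
      R x) = x := by
  induction x with
  | zero => simp only [map_zero]
  | add x y hx hy => simp only [map_add, hx, hy]
  | tmul x r =>
    rw [Algebra.TensorProduct.map_tmul]
    refine (retractionMap_tmul ρ x 1 r).trans ?_
    rw [map_one, map_one, mul_one, Algebra.TensorProduct.tmul_mul_tmul, mul_one, one_mul]

theorem retractionMap_map (h : X →ₐ[C] Y) (z : (X ⊗[C] D) ⊗[k] R) :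
    retractionMap ρ Y (mapL ((Algebra.TensorProduct.map h (AlgHom.id C D)).restrictScalars k) R z) =
      mapL (h.restrictScalars k) R (retractionMap ρ X z) := by
  induction z with
  | zero => simp only [map_zero]
  | add x y hx hy => simp only [map_add, hx, hy]
  | tmul z r =>
    induction z with
    | zero => simp only [map_zero, TensorProduct.zero_tmul]
    | add x y hx hy => simp only [map_add, hx, hy, TensorProduct.add_tmul]
    | tmul x d =>
      rw [Algebra.TensorProduct.map_tmul]
      refine (retractionMap_tmul ρ (h x) d r).trans ?_
      rw [retractionMap_tmul, map_mul, map_mul]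
      refine congrArg₂ _ (congrArg₂ _ (by simp) ?_) (by simp)
      generalize ρ d = w
      induction w with
      | zero => simp only [map_zero]
      | add x y hx hy => simp only [map_add, hx, hy]
      | tmul c r => simp [Algebra.ofId_apply]

end retraction

section descent

/-- The factorization of a homomorphism through a kernel. -/
def kernelLift {k : Type u} [Field k] {M G H : GrpFunctor k} (β : G ⟶ H) (α : M ⟶ G)
    (h : ∀ R x, β.app R (α.app R x) = 0) : M ⟶ kernelFunctor β where
  app R := AddCommGrpCat.ofHom ((α.app R).hom.codRestrict _ (h R))
  naturality _ _ φ := ConcreteCategory.hom_ext _ _ fun x =>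
    Subtype.ext (ConcreteCategory.congr_hom (α.naturality φ) x)

variable (k : Type u) [Field k] (C D : Type u) [CommRing C] [CommRing D] [Algebra k C] [Algebra k D]
  [Algebra C D] [IsScalarTower k C D]

/-- The first coprojection `D → D ⊗_C D`. -/
noncomputable abbrev coproj₁ : D →ₐ[k] D ⊗[C] D :=
  (Algebra.TensorProduct.includeLeft : D →ₐ[C] D ⊗[C] D).restrictScalars k

/-- The second coprojection `D → D ⊗_C D`. -/
noncomputable abbrev coproj₂ : D →ₐ[k] D ⊗[C] D :=
  (Algebra.TensorProduct.includeRight : D →ₐ[C] D ⊗[C] D).restrictScalars k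

/-- The coprojection of `D ⊗_C D` to the first and second factor of `D ⊗_C D ⊗_C D`. -/
noncomputable abbrev coproj₁₂ : D ⊗[C] D →ₐ[k] (D ⊗[C] D) ⊗[C] D :=
  (Algebra.TensorProduct.includeLeft : D ⊗[C] D →ₐ[C] (D ⊗[C] D) ⊗[C] D).restrictScalars k

/-- The coprojection of `D ⊗_C D` to the second and third factor of `D ⊗_C D ⊗_C D`. -/
noncomputable abbrev coproj₂₃ : D ⊗[C] D →ₐ[k] (D ⊗[C] D) ⊗[C] D :=
  (Algebra.TensorProduct.map (Algebra.TensorProduct.includeRight : D →ₐ[C] D ⊗[C] D)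
    (AlgHom.id C D)).restrictScalars k

/-- The coprojection of `D ⊗_C D` to the first and third factor of `D ⊗_C D ⊗_C D`. -/
noncomputable abbrev coproj₁₃ : D ⊗[C] D →ₐ[k] (D ⊗[C] D) ⊗[C] D :=
  (Algebra.TensorProduct.map (Algebra.TensorProduct.includeLeft : D →ₐ[C] D ⊗[C] D)
    (AlgHom.id C D)).restrictScalars k

/-- The group functor of `1`-cocycles of `D` over `C`. -/
noncomputable abbrev descentCocycles : GrpFunctor k :=
  cocycleFunctor (coproj₁₂ k C D) (coproj₂₃ k C D) (coproj₁₃ k C D)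

variable {k C D}

theorem mapL_comp {A₁ A₂ A₃ : Type u} [CommRing A₁] [CommRing A₂] [CommRing A₃] [Algebra k A₁]
    [Algebra k A₂] [Algebra k A₃] (f : A₁ →ₐ[k] A₂) (g : A₂ →ₐ[k] A₃) (R : Type u) [CommRing R]
    [Algebra k R] (x : A₁ ⊗[k] R) : mapL g R (mapL f R x) = mapL (g.comp f) R x := by
  induction x with
  | zero => simp
  | add x y hx hy => simp only [map_add, hx, hy]
  | tmul x y => simp

theorem coproj_apply_eq (R : Type u) [CommRing R] [Algebra k R] {x : D ⊗[k] R}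
    (hx : x ∈ (mapL (IsScalarTower.toAlgHom k C D) R).range) :
    mapL (coproj₁ k C D) R x = mapL (coproj₂ k C D) R x := by
  obtain ⟨c, rfl⟩ := hx
  change mapL (coproj₁ k C D) R (mapL (IsScalarTower.toAlgHom k C D) R c) =
    mapL (coproj₂ k C D) R (mapL (IsScalarTower.toAlgHom k C D) R c)
  rw [mapL_comp, mapL_comp]
  congr 2
  ext c
  exact Algebra.TensorProduct.tmul_one_eq_one_tmul (R := C) (A := D) (B := D) c

theorem retractionMap_coproj₂ {R : Type u} [CommRing R] [Algebra k R] (ρ : D →ₐ[C] C ⊗[k] R)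
    (x : D ⊗[k] R) :
    retractionMap ρ D (mapL (coproj₂ k C D) R x) ∈
      (mapL (IsScalarTower.toAlgHom k C D) R).range := by
  have h1 : coproj₂ k C D = ((Algebra.TensorProduct.map (Algebra.ofId C D)
      (AlgHom.id C D)).restrictScalars k).comp
      ((Algebra.TensorProduct.includeRight : D →ₐ[C] C ⊗[C] D).restrictScalars k) := by
    ext d
    simp
  rw [h1, ← mapL_comp, retractionMap_map]
  exact ⟨_, rfl⟩

theorem mem_range_of_coproj_eq {R : Type u} [CommRing R] [Algebra k R] (ρ : D →ₐ[C] C ⊗[k] R)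
    {x : D ⊗[k] R} (hx : mapL (coproj₁ k C D) R x = mapL (coproj₂ k C D) R x) :
    x ∈ (mapL (IsScalarTower.toAlgHom k C D) R).range := by
  have h1 : retractionMap ρ D (mapL (coproj₁ k C D) R x) = x := retractionMap_includeLeft ρ x
  rw [← h1, hx]
  exact retractionMap_coproj₂ ρ x

theorem exists_eq_of_cocycle {R : Type u} [CommRing R] [Algebra k R] (ρ : D →ₐ[C] C ⊗[k] R)
    {y : ((D ⊗[C] D) ⊗[k] R)ˣ} (hy : mapL (coproj₁₂ k C D) R y * mapL (coproj₂₃ k C D) R y =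
      mapL (coproj₁₃ k C D) R y) :
    ∃ x : (D ⊗[k] R)ˣ, y * mapL (coproj₂ k C D) R x = mapL (coproj₁ k C D) R x := by
  refine ⟨Units.map (retractionMap ρ D).toRingHom.toMonoidHom y, ?_⟩
  have h1 := congrArg (retractionMap ρ (D ⊗[C] D)) hy
  rw [map_mul, retractionMap_map, retractionMap_map, retractionMap_includeLeft] at h1
  exact h1

theorem coboundary_cocycle {R : Type u} [CommRing R] [Algebra k R] (x : (D ⊗[k] R)ˣ) :
    tensorUnitsMap (coproj₁₂ k C D) (AlgHom.id k R)
        (tensorUnitsMap (coproj₁ k C D) (AlgHom.id k R) x /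
          tensorUnitsMap (coproj₂ k C D) (AlgHom.id k R) x) *
      tensorUnitsMap (coproj₂₃ k C D) (AlgHom.id k R)
        (tensorUnitsMap (coproj₁ k C D) (AlgHom.id k R) x /
          tensorUnitsMap (coproj₂ k C D) (AlgHom.id k R) x) =
      tensorUnitsMap (coproj₁₃ k C D) (AlgHom.id k R)
        (tensorUnitsMap (coproj₁ k C D) (AlgHom.id k R) x /
          tensorUnitsMap (coproj₂ k C D) (AlgHom.id k R) x) := by
  have key {q q' : D ⊗[C] D →ₐ[k] (D ⊗[C] D) ⊗[C] D} {r r' : D →ₐ[k] D ⊗[C] D}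
      (h : q.comp r = q'.comp r') : tensorUnitsMap q (AlgHom.id k R)
        (tensorUnitsMap r (AlgHom.id k R) x) = tensorUnitsMap q' (AlgHom.id k R)
        (tensorUnitsMap r' (AlgHom.id k R) x) := by
    refine Units.ext ((mapL_comp r q R (x : D ⊗[k] R)).trans ?_)
    rw [h]
    exact (mapL_comp r' q' R (x : D ⊗[k] R)).symm
  have h1 : (coproj₁₂ k C D).comp (coproj₁ k C D) = (coproj₁₃ k C D).comp (coproj₁ k C D) := by
    ext d; simp
  have h2 : (coproj₁₂ k C D).comp (coproj₂ k C D) = (coproj₂₃ k C D).comp (coproj₁ k C D) := by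
    ext d; simp
  have h3 : (coproj₂₃ k C D).comp (coproj₂ k C D) = (coproj₁₃ k C D).comp (coproj₂ k C D) := by
    ext d; simp
  rw [map_div, map_div, map_div, key h1, key h2, key h3, div_mul_div_cancel]

variable (k C D) in
/-- The coboundary `μ^D ⟶ Z¹`. -/
noncomputable def coboundary : mu k D ⟶ descentCocycles k C D :=
  kernelLift _ (muMap (coproj₁ k C D) - muMap (coproj₂ k C D)) fun R x =>
    (cocycle_mem_iff _ _ _ (tensorUnitsMap (coproj₁ k C D) (AlgHom.id k R) x.down.toMul /
          tensorUnitsMap (coproj₂ k C D) (AlgHom.id k R) x.down.toMul)).2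
      (congrArg Units.val (coboundary_cocycle x.down.toMul))

theorem coboundary_app_eq_zero_iff {R : CommAlgCat.{u} k} (x : (D ⊗[k] R)ˣ) :
    (coboundary k C D).app R (ULift.up (Additive.ofMul x)) = 0 ↔
      mapL (coproj₁ k C D) R x = mapL (coproj₂ k C D) R x := by
  constructor
  · intro h
    have h1 := congrArg (fun z => Additive.toMul (ULift.down (Subtype.val z))) h
    exact congrArg Units.val (div_eq_one.1 h1)
  · intro h
    refine Subtype.ext (congrArg (fun z => ULift.up (Additive.ofMul z)) ?_)
    exact div_eq_one.2 (Units.ext h)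

theorem coboundary_app_surjective {R : CommAlgCat.{u} k} (ρ : D →ₐ[C] C ⊗[k] R) :
    Function.Surjective ((coboundary k C D).app R) := by
  rintro ⟨⟨y⟩, hy⟩
  obtain ⟨x, hx⟩ := exists_eq_of_cocycle ρ (y := Additive.toMul y) ((cocycle_mem_iff _ _ _ _).1 hy)
  refine ⟨ULift.up (Additive.ofMul x), Subtype.ext (congrArg ULift.up ?_)⟩
  change Additive.ofMul (_ / _) = y
  rw [div_eq_of_eq_mul' (c := Additive.toMul y) (Units.ext ?_)]
  · rfl
  · refine hx.symm.trans (mul_comm _ _)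

variable (k C D) in
theorem finite_tensor_self [Module.Finite k D] : Module.Finite k (D ⊗[C] D) := by
  have : Module.Finite C D := Module.Finite.of_restrictScalars_finite k C D
  exact Module.Finite.trans D _

theorem coproj_eq_iff (hρ : ∀ R : CommAlgCat.{u} k, ∃ (S : CommAlgCat.{u} k) (φ : R ⟶ S)
      (_ : IsCover φ), Nonempty (D →ₐ[C] C ⊗[k] S)) {R : CommAlgCat.{u} k} (x : D ⊗[k] R) :
    mapL (coproj₁ k C D) R x = mapL (coproj₂ k C D) R x ↔
      x ∈ (mapL (IsScalarTower.toAlgHom k C D) R).range := by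
  refine ⟨fun h => ?_, coproj_apply_eq R⟩
  obtain ⟨S, φ, hφ, ⟨ρ⟩⟩ := hρ R
  refine mem_range_map_of_injective _ hφ.injective (mem_range_of_coproj_eq ρ ?_)
  have h2 := congrArg (mapR _ φ.hom) h
  exact (map_map_comm (coproj₁ k C D) φ.hom _).symm.trans
    (h2.trans (map_map_comm (coproj₂ k C D) φ.hom _))

theorem exists_iso_descentCocycles [Module.Finite k C] [Module.Finite k D]
    (hf : Function.Injective (algebraMap C D))
    (hρ : ∀ R : CommAlgCat.{u} k, ∃ (S : CommAlgCat.{u} k) (φ : R ⟶ S) (_ : IsCover φ),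
      Nonempty (D →ₐ[C] C ⊗[k] S)) :
    ∃ e : relMu (IsScalarTower.toAlgHom k C D) ≅ descentCocycles k C D,
      fppfQuotientProj _ ≫ e.hom = coboundary k C D := by
  have : Module.Finite k (D ⊗[C] D) := finite_tensor_self k C D
  obtain ⟨H, _, ⟨e⟩⟩ := isAffineGroupScheme_cocycleFunctor (coproj₁₂ k C D) (coproj₂₃ k C D)
    (coproj₁₃ k C D)
  refine exists_iso_fppfQuotient _ (isFppfSheaf_of_representable _ H e) (coboundary k C D)
    (fun R x => ?_) fun R z => ?_
  · obtain ⟨x⟩ := x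
    have h1 := (coboundary_app_eq_zero_iff (Additive.toMul x)).trans
      (coproj_eq_iff hρ ((Additive.toMul x : (D ⊗[k] R)ˣ) : D ⊗[k] R))
    refine h1.trans ?_
    rw [← relMk_eq_zero_iff_mem hf, relMk_eq_zero_iff hf]
    constructor
    · rintro ⟨a, ha⟩
      exact ⟨ULift.up (Additive.ofMul a), congrArg (fun z => ULift.up (Additive.ofMul z)) ha⟩
    · rintro ⟨a, ha⟩
      exact ⟨Additive.toMul a.down, congrArg (fun z => Additive.toMul (ULift.down z)) ha⟩
  · obtain ⟨S, φ, hφ, ⟨ρ⟩⟩ := hρ R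
    refine ⟨Sieve.generate (Presieve.singleton φ.op), hφ.mem
      ⟨_, 𝟙 _, _, Presieve.singleton_self _, Category.id_comp _⟩, fun T ψ hψ => ?_⟩
    obtain ⟨Y, a, _, ⟨⟩, hb⟩ := hψ
    have hψ' : ψ = φ ≫ a.unop := Quiver.Hom.op_inj hb.symm
    subst hψ'
    obtain ⟨x, hx⟩ := coboundary_app_surjective ρ ((descentCocycles k C D).map φ z)
    refine ⟨(mu k D).map a.unop x, ?_⟩
    rw [Functor.map_comp]
    refine (ConcreteCategory.congr_hom ((coboundary k C D).naturality a.unop) x).trans ?_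
    exact congrArg ((descentCocycles k C D).map a.unop) hx

end descent

theorem IsAffineGroupScheme.of_iso {k : Type u} [Field k] {G G' : GrpFunctor k} (e : G ≅ G')
    (h : IsAffineGroupScheme G') : IsAffineGroupScheme G := by
  obtain ⟨H, hH, ⟨i⟩⟩ := h
  exact ⟨H, hH, ⟨Functor.isoWhiskerRight e _ ≪≫ i⟩⟩

section points

variable {k : Type u} [Field k] {C D : Type u} [CommRing C] [CommRing D] [Algebra k C] [Algebra k D]
  {L : Type u} [Field L] [Algebra k L] {R : Type u} [CommRing R] [Algebra k R]

theorem exists_algHom_tensor [Algebra C D] [IsScalarTower k C D] [Module.Finite k C]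
    (hC : IsSplitBy k L C) {e : (C →ₐ[k] L) → (D →ₐ[k] L)}
    (he : ∀ τ, (e τ).comp (IsScalarTower.toAlgHom k C D) = τ) (l : L →ₐ[k] R) :
    Nonempty (D →ₐ[C] C ⊗[k] R) := by
  let a : C ⊗[k] R ≃ₐ[k] ((C →ₐ[k] L) → R) := AlgEquiv.ofBijective _ (hC.bijective l)
  let r : D →ₐ[k] ((C →ₐ[k] L) → R) := AlgHom.pi fun τ => l.comp (e τ)
  refine ⟨{ (a.symm.toAlgHom.comp r : D →+* C ⊗[k] R) with commutes' := fun c => ?_ }⟩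
  apply a.injective
  refine (a.apply_symm_apply _).trans (funext fun τ => ?_)
  have h1 : a (algebraMap C (C ⊗[k] R) c) τ = l (τ c) :=
    (evalPoints_tmul l c 1 τ).trans (mul_one _)
  rw [h1]
  exact congrArg l (DFunLike.congr_fun (he τ) c)

/-- The evaluation of a unit of `D ⊗ R` at a point of `D`. -/
noncomputable def evalUnits (D : Type u) [CommRing D] [Algebra k D] (l : L →ₐ[k] R)
    (σ : D →ₐ[k] L) : (D ⊗[k] R)ˣ →* Rˣ :=
  Units.map (((Pi.evalRingHom (fun _ => R) σ).comp (evalPoints D l).toRingHom) :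
    D ⊗[k] R →* R)

/-- The ratios of the values of a unit of `D ⊗ R` at the points `σ j` and `σ' j`. -/
noncomputable def ratios {ι : Type*} (σ σ' : ι → (D →ₐ[k] L)) (l : L →ₐ[k] R) :
    (D ⊗[k] R)ˣ →* (ι → Rˣ) :=
  MonoidHom.pi fun j => evalUnits D l (σ j) / evalUnits D l (σ' j)

theorem ratios_eq_one_iff {ι : Type*} {σ σ' : ι → (D →ₐ[k] L)} {l : L →ₐ[k] R} {x : (D ⊗[k] R)ˣ} :
    ratios σ σ' l x = 1 ↔ ∀ j, evalPoints D l x (σ j) = evalPoints D l x (σ' j) := by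
  rw [funext_iff]
  refine forall_congr' fun j => ?_
  change evalUnits D l (σ j) x / evalUnits D l (σ' j) x = 1 ↔ _
  rw [div_eq_one, Units.ext_iff]
  rfl

theorem ratios_surjective [Module.Finite k D] (hD : IsSplitBy k L D) {ι : Type*}
    {σ σ' : ι → (D →ₐ[k] L)} (hσ : Function.Injective σ) (hσ' : ∀ i j, σ i ≠ σ' j)
    (l : L →ₐ[k] R) : Function.Surjective (ratios σ σ' l) := by
  classical
  intro w
  let v : (D →ₐ[k] L) → Rˣ := Function.extend σ w fun _ => 1
  let a : D ⊗[k] R ≃ₐ[k] ((D →ₐ[k] L) → R) := AlgEquiv.ofBijective _ (hD.bijective l)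
  let x : (D ⊗[k] R)ˣ := (Units.mapEquiv a.toMulEquiv).symm (MulEquiv.piUnits.symm v)
  have hx : ∀ τ, evalUnits D l τ x = v τ := fun τ => Units.ext (by
    exact congrFun (a.apply_symm_apply _) τ)
  refine ⟨x, funext fun j => ?_⟩
  change evalUnits D l (σ j) x / evalUnits D l (σ' j) x = w j
  rw [hx, hx]
  have h1 : v (σ j) = w j := hσ.extend_apply w _ j
  have h2 : v (σ' j) = 1 := Function.extend_apply' w _ _ (by rintro ⟨i, hi⟩; exact hσ' i j hi)
  rw [h1, h2, div_one]

theorem ratios_map {S : Type u} [CommRing S] [Algebra k S] {ι : Type*} (σ σ' : ι → (D →ₐ[k] L))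
    (l : L →ₐ[k] R) (φ : R →ₐ[k] S) (x : (D ⊗[k] R)ˣ) (j : ι) :
    ratios σ σ' (φ.comp l) (tensorUnitsMap (AlgHom.id k D) φ x) j =
      Units.map φ.toRingHom.toMonoidHom (ratios σ σ' l x j) := by
  have h1 : ∀ τ, evalUnits D (φ.comp l) τ (tensorUnitsMap (AlgHom.id k D) φ x) =
      Units.map φ.toRingHom.toMonoidHom (evalUnits D l τ x) := fun τ =>
    Units.ext (evalPoints_map l φ (x : D ⊗[k] R) τ)
  change evalUnits D _ (σ j) _ / evalUnits D _ (σ' j) _ = Units.map _ (_ / _)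
  rw [h1, h1, map_div]

end points

section torus

variable {k : Type u} [Field k] {C D : Type u} [CommRing C] [CommRing D] [Algebra k C] [Algebra k D]

/-- The structure map of a `K`-algebra, over a subfield. -/
def structureMap {K : Type u} [Field K] [Algebra k K] (L : IntermediateField k K)
    (R : CommAlgCat.{u} K) : L →ₐ[k] (restrictAlg k K).obj R :=
  { (algebraMap K R).comp L.val.toRingHom with commutes' := fun _ => rfl }

/-- The homomorphism to a split torus given by ratios of values at points. -/
noncomputable def ratiosHom {K : Type u} [Field K] [Algebra k K] (L : IntermediateField k K) {n : ℕ}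
    (σ σ' : Fin n → (D →ₐ[k] L)) : baseChange K (mu k D) ⟶ splitTorus K n where
  app R := AddCommGrpCat.uliftFunctor.{u + 1, u}.map
    (AddCommGrpCat.ofHom (ratios σ σ' (structureMap L R)).toAdditive)
  naturality R S φ := by
    refine ConcreteCategory.hom_ext _ _ fun x => ?_
    refine ULift.ext _ _ (funext fun j => ?_)
    have h1 : ((restrictAlg k K).map φ).hom.comp (structureMap L R) = structureMap L S :=
      AlgHom.ext fun x => φ.hom.commutes _
    change ratios σ σ' (structureMap L S) (tensorUnitsMap (AlgHom.id k D)
      ((restrictAlg k K).map φ).hom (Additive.toMul x.down)) j = _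
    rw [← h1]
    exact ratios_map σ σ' (structureMap L R) ((restrictAlg k K).map φ).hom _ j

theorem isTorus_relMu_toAlgHom [Algebra.Etale k C] [Algebra.Etale k D] [Algebra C D]
    [IsScalarTower k C D] (hf : Function.Injective (algebraMap C D)) :
    IsTorus (relMu (IsScalarTower.toAlgHom k C D)) := by
  have : Module.Finite k D := Algebra.FormallyUnramified.finite_of_free k D
  have : Module.Finite k C := Algebra.FormallyUnramified.finite_of_free k C
  obtain ⟨L, _, hC, hD⟩ := exists_isSplitBy (k := k) (C := C) (D := D)
  choose e he using hC.exists_extension hD (IsScalarTower.toAlgHom k C D) hf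
  obtain ⟨i, hi⟩ := exists_iso_descentCocycles (k := k) hf fun R => by
    obtain ⟨S, φ, hφ, ⟨l⟩⟩ := exists_isCover_algHom L R
    exact ⟨S, φ, hφ, exists_algHom_tensor hC he l⟩
  have := finite_tensor_self k C D
  refine ⟨.of_iso i (isAffineGroupScheme_cocycleFunctor _ _ _), ?_⟩
  have : Finite (D →ₐ[k] L) := finite_algHom
  let ι := {σ : D →ₐ[k] L // σ ∉ Set.range e}
  let n := Nat.card ι
  let c : Fin n ≃ ι := (Finite.equivFin ι).symm
  let σ (j : Fin n) : D →ₐ[k] L := (c j).1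
  let σ' (j : Fin n) : D →ₐ[k] L := e ((σ j).comp (IsScalarTower.toAlgHom k C D))
  refine ⟨n, exists_iso_of_surjective (baseChangeMap (AlgebraicClosure k)
    (fppfQuotientProj (muMap (IsScalarTower.toAlgHom k C D)))) (ratiosHom L σ σ')
    (fun R => ?_) (fun R => ?_) fun R x => ?_⟩
  · intro z
    obtain ⟨ρ⟩ := exists_algHom_tensor hC he (structureMap L R)
    obtain ⟨x, hx⟩ := coboundary_app_surjective ρ (i.hom.app _ z)
    refine ⟨x, ?_⟩
    rw [← hi] at hx
    exact (ConcreteCategory.bijective_of_isIso (i.hom.app ((restrictAlg k _).obj R))).1 hx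
  · rintro ⟨w⟩
    obtain ⟨x, hx⟩ := ratios_surjective hD (σ := σ) (σ' := σ')
      (Subtype.val_injective.comp c.injective) (fun a b h => (c a).2 ⟨_, h.symm⟩)
      (structureMap L R) (Additive.toMul w)
    exact ⟨ULift.up (Additive.ofMul x), congrArg (fun z => ULift.up (Additive.ofMul z)) hx⟩
  · obtain ⟨x⟩ := x
    have h1 := relMk_eq_zero_iff_mem (g := IsScalarTower.toAlgHom k C D) hf
      (R := (restrictAlg k (AlgebraicClosure k)).obj R)
      (x := Additive.toMul x)
    refine h1.trans ?_
    have h2 : (ratiosHom L σ σ').app R (ULift.up x) = 0 ↔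
        ratios σ σ' (structureMap L R) (Additive.toMul x) = 1 :=
      ⟨fun h => congrArg (fun z => Additive.toMul (ULift.down z)) h,
        fun h => congrArg (fun z => ULift.up (Additive.ofMul z)) h⟩
    rw [h2, ratios_eq_one_iff]
    refine ⟨fun h j => evalPoints_eq_of_mem_range he _ h (σ j), fun h => ?_⟩
    refine mem_range_of_evalPoints_eq hC hD (e := e) (structureMap L R) fun τ => ?_
    by_cases hτ : τ ∈ Set.range e
    · obtain ⟨τ, rfl⟩ := hτ
      rw [he]
    · obtain ⟨j, hj⟩ := c.surjective ⟨τ, hτ⟩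
      have h3 := h j
      simp only [σ, σ', hj] at h3
      exact h3

theorem isTorus_relMu [Algebra.Etale k C] [Algebra.Etale k D] (f : C →ₐ[k] D)
    (hf : Function.Injective f) : IsTorus (relMu f) := by
  let : Algebra C D := f.toRingHom.toAlgebra
  have : IsScalarTower k C D := .of_algebraMap_eq fun x => (f.commutes x).symm
  exact isTorus_relMu_toAlgHom hf

end torus

section unipotentRoots

/-- A unipotent element has a unique unipotent `m`-th root, if `m` is invertible. -/
theorem existsUnique_unipotent_root {R : Type*} [CommRing R] {m : ℕ} (hm : IsUnit (m : R)) {w : R}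
    (hw : IsNilpotent (w - 1)) : ∃! r : R, IsNilpotent (1 - r) ∧ r ^ m = w := by
  have h1 := Polynomial.existsUnique_nilpotent_sub_and_aeval_eq_zero (R := R) (S := R)
    (P := Polynomial.X ^ m - Polynomial.C w) (x := 1)
    (by simpa using (IsNilpotent.neg hw)) (by simpa [Polynomial.derivative_X_pow] using hm)
  simpa [sub_eq_zero] using h1

theorem mem_range_of_pow_mem {R S : Type*} [CommRing R] [CommRing S] {f : R →+* S}
    (hf : Function.Injective f) {m : ℕ} (hm : IsUnit (m : R)) {u : S} (hu : IsNilpotent (u - 1))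
    (h : u ^ m ∈ f.range) : u ∈ f.range := by
  obtain ⟨w, hw⟩ := h
  have h1 : IsNilpotent (u ^ m - 1) := by
    obtain ⟨c, hc⟩ := sub_dvd_pow_sub_pow u 1 m
    rw [one_pow] at hc
    rw [hc]
    exact (Commute.all _ _).isNilpotent_mul_right hu
  have h2 : IsNilpotent (w - 1) := by
    rw [← IsNilpotent.map_iff hf, map_sub, map_one, hw]
    exact h1
  obtain ⟨v, ⟨hv, hv'⟩, -⟩ := existsUnique_unipotent_root hm h2
  have hm' : IsUnit (m : S) := by simpa using hm.map f
  have h3 := (existsUnique_unipotent_root hm' h1).unique (y₁ := u) (y₂ := f v)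
    ⟨by simpa using hu.neg, rfl⟩ ⟨by simpa using hv.map f, by rw [← map_pow, hv', hw]⟩
  exact ⟨v, h3.symm⟩

end unipotentRoots

section torsion

variable {k : Type u} [Field k] {B : Type u} [CommRing B] [Algebra k B]
  {A : Subalgebra k B} {s : sepTop k B →ₐ[k] B}

theorem sepToRelMu_relMk (hA : ∀ x, s (sepIncl A x) ∈ A) {R : CommAlgCat.{u} k}
    (x : (sepTop k B ⊗[k] R)ˣ) : (sepToRelMu A s hA).app R (relMk (sepIncl A) R (.ofMul x)) =
      relMk A.val R (.ofMul (tensorUnitsMap s (AlgHom.id k R) x)) :=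
  relMuMap_relMk _ _ _ _ _ _

theorem isNilpotent_of_map_eq_zero {D : Type u} [CommRing D] [Algebra k D] {r : B →ₐ[k] D}
    (hr : Function.Surjective r) (hker : RingHom.ker r ≤ nilradical B) {R : Type u} [CommRing R]
    [Algebra k R] {x : B ⊗[k] R} (hx : mapL r R x = 0) : IsNilpotent x := by
  have h1 : x ∈ RingHom.ker (mapL r R) := hx
  rw [Algebra.TensorProduct.rTensor_ker _ hr] at h1
  have h2 : (RingHom.ker r).map (Algebra.TensorProduct.includeLeft : B →ₐ[k] B ⊗[k] R) ≤
      nilradical (B ⊗[k] R) := by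
    rw [Ideal.map_le_iff_le_comap]
    intro b hb
    exact IsNilpotent.map (hker hb) (Algebra.TensorProduct.includeLeft : B →ₐ[k] B ⊗[k] R)
  exact h2 h1

variable [Module.Finite k B]

theorem sepToRelMu_injective (hs : (toRed k B).comp s = (sepTop k B).val)
    (hA : ∀ x, s (sepIncl A x) ∈ A) (R : CommAlgCat.{u} k) :
    Function.Injective ((sepToRelMu A s hA).app R) :=
  (isClosedImmersion_sepToRelMu hs hA).1 R

theorem exists_sepToRelMu_eq_of_local (hs : (toRed k B).comp s = (sepTop k B).val)
    (hA : ∀ x, s (sepIncl A x) ∈ A) {R S : CommAlgCat.{u} k} (h : (relMu A.val).obj R) {φ : R ⟶ S}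
    (hφ : IsCover φ) (hl : ∃ g, (sepToRelMu A s hA).app S g = (relMu A.val).map φ h) :
    ∃ g, (sepToRelMu A s hA).app R g = h :=
  exists_preimage_of_isCover (isFppfSheaf_relMu _) (isFppfSheaf_relMu _) _
    (sepToRelMu_injective hs hA) h hφ hl

theorem exists_eq_nsmul (hs : (toRed k B).comp s = (sepTop k B).val)
    (hA : ∀ x, s (sepIncl A x) ∈ A) (p : ℕ) [Fact p.Prime] [CharP k p] {n : ℕ}
    (hn : ∀ b : B, ∃ t, s t = b ^ p ^ n) {R : CommAlgCat.{u} k} (h : (relMu A.val).obj R) :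
    ∃ t, (sepToRelMu A s hA).app R t = (p ^ n) • h := by
  obtain ⟨S, φ, hφ, y, hy⟩ := exists_isCover_relMk A.val h
  refine exists_sepToRelMu_eq_of_local hs hA _ hφ ?_
  obtain ⟨c, hc⟩ := exists_mapL_eq_pow_unit (lift_injective hs) p hn y
  refine ⟨relMk (sepIncl A) S (.ofMul c), ?_⟩
  have h1 : tensorUnitsMap s (AlgHom.id k S) c = y ^ p ^ n := Units.ext hc
  rw [sepToRelMu_relMk, h1, ofMul_pow, map_nsmul, hy]
  exact (map_nsmul ((relMu A.val).map φ).hom _ _).symm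

theorem exists_of_nsmul_eq_zero_of_charZero [CharZero k]
    (hs : (toRed k B).comp s = (sepTop k B).val) (hA : ∀ x, s (sepIncl A x) ∈ A)
    {R : CommAlgCat.{u} k} {m : ℕ} (hm : m ≠ 0) {h : (relMu A.val).obj R} (h0 : m • h = 0) :
    ∃ t, (sepToRelMu A s hA).app R t = h := by
  have htop : sepTop k B = ⊤ := sepTop_eq_top_of_perfectField
  obtain ⟨r, hr, hr'⟩ := exists_retraction hs htop
  obtain ⟨S, φ, hφ, y, hy⟩ := exists_isCover_relMk A.val h
  refine exists_sepToRelMu_eq_of_local hs hA _ hφ ?_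
  let z : (sepTop k B ⊗[k] S)ˣ := tensorUnitsMap r (AlgHom.id k S) y
  let u : (B ⊗[k] S)ˣ := (tensorUnitsMap s (AlgHom.id k S) z)⁻¹ * y
  have hg : Function.Injective A.val := Subtype.val_injective
  have hym : ((y ^ m : (B ⊗[k] S)ˣ) : B ⊗[k] S) ∈ (mapL A.val S).range := by
    rw [← relMk_eq_zero_iff_mem hg, ofMul_pow, map_nsmul, hy]
    refine (map_nsmul ((relMu A.val).map φ).hom _ _).symm.trans ?_
    exact (congrArg ((relMu A.val).map φ).hom h0).trans (map_zero ((relMu A.val).map φ).hom)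
  have hzm : mapL s S (z ^ m : (sepTop k B ⊗[k] S)ˣ) ∈ (mapL A.val S).range := by
    refine (sepPair hs).mem_range_iff.2 ?_
    have h1 : ((z ^ m : (sepTop k B ⊗[k] S)ˣ) : sepTop k B ⊗[k] S) =
        mapL r S (y ^ m : (B ⊗[k] S)ˣ) := congrArg Units.val (map_pow _ _ _).symm
    obtain ⟨a, ha⟩ := hym
    rw [h1, ← ha]
    change mapL r S (mapL A.val S a) ∈ _
    clear ha h1
    induction a with
    | zero => rw [map_zero, map_zero]; exact zero_mem _
    | add x y hx hy => rw [map_add, map_add]; exact add_mem hx hy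
    | tmul a z =>
      obtain ⟨c, hc⟩ := map_retraction_mem htop hr' a.2
      exact ⟨c ⊗ₜ z, by simpa using congrArg (· ⊗ₜ[k] z) hc⟩
  have hum : (u : B ⊗[k] S) ^ m ∈ (mapL A.val S).range := by
    have h2 := inv_mem_range (x := tensorUnitsMap s (AlgHom.id k S) (z ^ m)) hg hzm
    have h3 : (u : B ⊗[k] S) ^ m = ((tensorUnitsMap s (AlgHom.id k S) (z ^ m))⁻¹ : (B ⊗[k] S)ˣ) *
        ((y ^ m : (B ⊗[k] S)ˣ) : B ⊗[k] S) := by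
      rw [← Units.val_mul, ← Units.val_pow_eq_pow_val, mul_pow, inv_pow, map_pow]
    rw [h3]
    exact mul_mem h2 hym
  have hrs : mapL r S (mapL s S z) = z := by
    rw [mapL_comp, hr]
    exact DFunLike.congr_fun (Algebra.TensorProduct.map_id (R := k) (S := k)
      (A := sepTop k B) (B := S)) (z : sepTop k B ⊗[k] S)
  have hu1 : tensorUnitsMap r (AlgHom.id k S) u = 1 := by
    rw [map_mul, map_inv, inv_mul_eq_one]
    exact Units.ext hrs
  have hunil : IsNilpotent ((u : B ⊗[k] S) - 1) := by
    refine isNilpotent_of_map_eq_zero (r := r) (fun x => ⟨s x, DFunLike.congr_fun hr x⟩) ?_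
      (R := S) ?_
    · intro b hb
      rw [← Ideal.Quotient.eq_zero_iff_mem]
      exact (DFunLike.congr_fun hr' b).symm.trans (congrArg Subtype.val hb)
    · rw [map_sub, map_one, sub_eq_zero]
      exact congrArg Units.val hu1
  have hu : (u : B ⊗[k] S) ∈ (mapL A.val S).range := by
    refine mem_range_of_pow_mem (f := (mapL A.val S).toRingHom) (map_injective_of_injective hg S)
      (m := m) ?_ hunil hum
    have : IsUnit (m : k) := IsUnit.mk0 _ (by exact_mod_cast hm)
    simpa using this.map (algebraMap k (A ⊗[k] S))
  refine ⟨relMk (sepIncl A) S (.ofMul z), ?_⟩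
  rw [sepToRelMu_relMk, ← hy]
  exact ((relMk_eq_relMk_iff hg).2 hu).symm

/-- Torsion of `μ^{B/A}` of order prime to the characteristic lies in `μ^{B_sep/A_sep}`. -/
theorem exists_of_nsmul_eq_zero (hs : (toRed k B).comp s = (sepTop k B).val)
    (hA : ∀ x, s (sepIncl A x) ∈ A) {R : CommAlgCat.{u} k} {m : ℕ} (hm : (m : k) ≠ 0)
    {h : (relMu A.val).obj R} (h0 : m • h = 0) : ∃ t, (sepToRelMu A s hA).app R t = h := by
  obtain ⟨p, hp⟩ := CharP.exists k
  rcases CharP.char_is_prime_or_zero k p with hp' | rfl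
  · have : Fact p.Prime := ⟨hp'⟩
    obtain ⟨n, hn⟩ := exists_pow_eq_lift hs p
    obtain ⟨t, ht⟩ := exists_eq_nsmul hs hA p hn h
    have hcop : IsCoprime (m : ℤ) ((p ^ n : ℕ) : ℤ) := by
      rw [Nat.isCoprime_iff_coprime]
      refine Nat.Coprime.pow_right _ ((Nat.coprime_comm.1
        ((Nat.Prime.coprime_iff_not_dvd hp').2 ?_)))
      rwa [← CharP.cast_eq_zero_iff k p m]
    obtain ⟨a, b, hab⟩ := hcop
    refine ⟨b • t, ?_⟩
    refine (map_zsmul ((sepToRelMu A s hA).app R).hom b t).trans ?_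
    change b • (sepToRelMu A s hA).app R t = h
    rw [ht, ← natCast_zsmul, smul_smul]
    have h1 : (a * m) • h = 0 := by rw [mul_smul, natCast_zsmul, h0, smul_zero]
    calc (b * ((p ^ n : ℕ) : ℤ)) • h = (a * m) • h + (b * ((p ^ n : ℕ) : ℤ)) • h := by
          rw [h1, zero_add]
      _ = h := by rw [← add_smul, hab, one_smul]
  · have : CharZero k := CharP.charP_to_charZero k
    exact exists_of_nsmul_eq_zero_of_charZero hs hA (by rintro rfl; exact hm Nat.cast_zero) h0

end torsion

section laurent

open LaurentPolynomial

/-- A Laurent polynomial over an algebraically closed field which vanishes at the roots of unity of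
invertible order is zero. -/
theorem laurent_eq_zero_of_eval_rootsOfUnity {F : Type*} [Field F] [IsAlgClosed F]
    (f : F[T;T⁻¹]) (h : ∀ (m : ℕ) (ζ : Fˣ), (m : F) ≠ 0 → ζ ^ m = 1 →
      LaurentPolynomial.eval₂ (RingHom.id F) ζ f = 0) : f = 0 := by
  classical
  obtain ⟨n, g, hg⟩ := f.exists_T_pow
  suffices g = 0 by
    rw [this, map_zero] at hg
    exact ((isUnit_T (R := F) (n : ℤ)).mul_left_eq_zero).1 hg.symm
  obtain ⟨m, hmg, hm⟩ : ∃ m : ℕ, g.natDegree < m ∧ (m : F) ≠ 0 := by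
    by_cases h0 : ((g.natDegree + 1 : ℕ) : F) = 0
    · refine ⟨g.natDegree + 2, by omega, fun h1 => one_ne_zero (α := F) ?_⟩
      push_cast at h0 h1
      linear_combination h1 - h0
    · exact ⟨_, by omega, h0⟩
  have : NeZero (m : F) := ⟨hm⟩
  have hm0 : 0 < m := by omega
  obtain ⟨ζ, hζ⟩ := HasEnoughRootsOfUnity.exists_primitiveRoot F m
  by_contra hg0
  have h1 : Polynomial.nthRootsFinset m (1 : F) ⊆ g.roots.toFinset := by
    intro x hx
    rw [Polynomial.mem_nthRootsFinset hm0] at hx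
    rw [Multiset.mem_toFinset, Polynomial.mem_roots hg0, Polynomial.IsRoot.def]
    have hxu : IsUnit x := IsUnit.of_pow_eq_one hx hm0.ne'
    obtain ⟨x, rfl⟩ := hxu
    have h2 := h m x hm (Units.ext hx)
    have h3 := congrArg (LaurentPolynomial.eval₂ (RingHom.id F) x) hg
    rwa [map_mul, h2, zero_mul, eval₂_toLaurent, Polynomial.eval₂_id] at h3
  have h2 := Finset.card_le_card h1
  rw [hζ.card_nthRootsFinset] at h2
  exact absurd ((h2.trans (Multiset.toFinset_card_le _)).trans (Polynomial.card_roots' g))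
    (by omega)

end laurent

section maximal

theorem exists_hom_of_forall_mem {k : Type u} [Field k] {T G M : GrpFunctor k} {j : T ⟶ G}
    (hj : ∀ R, Function.Injective (j.app R)) {i : M ⟶ G} (h : ∀ R x, ∃ t, j.app R t = i.app R x) :
    ∃ f : M ⟶ T, f ≫ j = i := by
  choose f hf using h
  refine ⟨{ app := fun R => AddCommGrpCat.ofHom (AddMonoidHom.mk' (f R) fun x y => hj R ?_)
            naturality := fun R S φ => ConcreteCategory.hom_ext _ _ fun x => hj S ?_ }, ?_⟩
  · refine (hf R _).trans ((map_add (i.app R).hom x y).trans ?_)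
    refine Eq.trans ?_ (map_add (j.app R).hom _ _).symm
    exact congrArg₂ _ (hf R x).symm (hf R y).symm
  · refine (hf S _).trans ((ConcreteCategory.congr_hom (i.naturality φ) x).trans ?_)
    refine Eq.trans ?_ (ConcreteCategory.congr_hom (j.naturality φ) (f R x)).symm
    exact congrArg (G.map φ) (hf R x).symm
  · ext R x
    exact hf R x

variable {F : Type u} [Field F] {T G : GrpFunctor F} {j : T ⟶ G}

/-- The evaluation of Laurent polynomials at a unit. -/
noncomputable def evalLaurent {R : CommAlgCat.{u} F} (u : Rˣ) :
    CommAlgCat.of F (LaurentPolynomial F) ⟶ R :=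
  CommAlgCat.ofHom { LaurentPolynomial.eval₂ (algebraMap F R) u with
    commutes' := fun r => LaurentPolynomial.eval₂_C _ _ r }

theorem exists_preimage_of_splitTorus [IsAlgClosed F] (hj : IsClosedImmersion j)
    (htors : ∀ (m : ℕ), (m : F) ≠ 0 → ∀ h : G.obj (.of F F), m • h = 0 →
      ∃ t, j.app (.of F F) t = h) {n : ℕ} (θ : splitTorus F n ⟶ G) (R : CommAlgCat.{u} F)
    (x : (splitTorus F n).obj R) : ∃ t, j.app R t = θ.app R x := by
  classical
  let emb (S : CommAlgCat.{u} F) (l : Fin n) (u : Sˣ) : (splitTorus F n).obj S :=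
    ULift.up (Additive.ofMul (Pi.mulSingle l u))
  have hemb : ∀ {S S' : CommAlgCat.{u} F} (φ : S ⟶ S') l (u : Sˣ),
      (splitTorus F n).map φ (emb S l u) = emb S' l (Units.map φ.hom.toRingHom.toMonoidHom u) := by
    intro S S' φ l u
    refine congrArg (fun z => ULift.up (Additive.ofMul z)) (funext fun l' => ?_)
    exact Pi.apply_mulSingle (fun _ => Units.map φ.hom.toRingHom.toMonoidHom)
      (fun _ => map_one _) l u l'
  let Λ : CommAlgCat.{u} F := CommAlgCat.of F (LaurentPolynomial F)
  let T₁ : Λˣ := (LaurentPolynomial.isUnit_T (R := F) 1).unit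
  have hT : ∀ {S : CommAlgCat.{u} F} (u : Sˣ),
      Units.map (evalLaurent u).hom.toRingHom.toMonoidHom T₁ = u := fun {S} u =>
    Units.ext ((LaurentPolynomial.eval₂_T (algebraMap F S) u 1).trans (by rw [zpow_one]))
  have hθ : ∀ {S S' : CommAlgCat.{u} F} (φ : S ⟶ S') y, θ.app S' ((splitTorus F n).map φ y) =
      G.map φ (θ.app S y) := fun φ y => ConcreteCategory.congr_hom (θ.naturality φ) y
  have huniv : ∀ l, ∃ t, j.app Λ t = θ.app Λ (emb Λ l T₁) := by
    intro l
    obtain ⟨I, hI⟩ := hj.2 Λ (θ.app Λ (emb Λ l T₁))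
    have h1 := (hI Λ (𝟙 Λ)).2 fun f hf => by
      refine laurent_eq_zero_of_eval_rootsOfUnity (F := F) f fun m ζ hm hζ => ?_
      refine (hI (.of F F) (evalLaurent (R := .of F F) ζ)).1 ?_ f hf
      refine htors m hm _ ?_
      rw [← hθ, hemb, hT]
      refine (map_nsmul (θ.app (.of F F)).hom m _).symm.trans ?_
      refine (congrArg (θ.app (.of F F)).hom ?_).trans (map_zero (θ.app (.of F F)).hom)
      refine congrArg (fun z => ULift.up (Additive.ofMul z)) ?_
      change (Pi.mulSingle l ζ : Fin n → Fˣ) ^ m = 1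
      rw [← Pi.mulSingle_pow, hζ, Pi.mulSingle_one]
    rwa [CategoryTheory.Functor.map_id] at h1
  have hsingle : ∀ l (u : Rˣ), ∃ t, j.app R t = θ.app R (emb R l u) := by
    intro l u
    have h1 := map_preimage (evalLaurent u) (huniv l)
    rwa [← hθ, hemb, hT] at h1
  obtain ⟨w⟩ := x
  have key : ∀ I : Finset (Fin n), ∃ t, j.app R t = θ.app R (ULift.up (Additive.ofMul
      (∏ l ∈ I, Pi.mulSingle l (Additive.toMul w l)))) := by
    intro I
    induction I using Finset.induction_on with
    | empty => exact ⟨0, (map_zero (j.app R).hom).trans (map_zero (θ.app R).hom).symm⟩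
    | insert l I hl ih =>
      obtain ⟨t, ht⟩ := ih
      obtain ⟨t', ht'⟩ := hsingle l (Additive.toMul w l)
      refine ⟨t' + t, (map_add (j.app R).hom t' t).trans ?_⟩
      rw [Finset.prod_insert hl]
      exact (congrArg₂ _ ht' ht).trans (map_add (θ.app R).hom (emb R l (Additive.toMul w l))
        (ULift.up (Additive.ofMul (∏ l ∈ I, Pi.mulSingle l (Additive.toMul w l))))).symm
  have h1 := key Finset.univ
  rwa [Finset.univ_prod_mulSingle] at h1

theorem IsClosedImmersion.baseChange {k : Type u} [Field k] {T G : GrpFunctor k} {j : T ⟶ G}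
    (hj : IsClosedImmersion j) (K : Type u) [Field K] [Algebra k K] :
    IsClosedImmersion (baseChangeMap K j) := by
  refine ⟨fun R => hj.1 _, fun R h => ?_⟩
  obtain ⟨I, hI⟩ := hj.2 ((restrictAlg k K).obj R) h
  exact ⟨I, fun S φ => hI ((restrictAlg k K).obj S) ((restrictAlg k K).map φ)⟩

/-- The map `R → F ⊗_K R`. -/
noncomputable def toTensor (K F : Type u) [Field K] [Field F] [Algebra K F] (R : CommAlgCat.{u} K) :
    R ⟶ (restrictAlg K F).obj (.of F (F ⊗[K] R)) :=
  let ι : R →+* F ⊗[K] R := (Algebra.TensorProduct.includeRight : R →ₐ[K] F ⊗[K] R).toRingHom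
  letI := Algebra.compHom (F ⊗[K] R) (algebraMap K F)
  CommAlgCat.ofHom
    { ι with
      commutes' := fun r => (Algebra.TensorProduct.tmul_one_eq_one_tmul (R := K) (A := F)
        (B := R) r).symm }

theorem toTensor_injective (K F : Type u) [Field K] [Field F] [Algebra K F] (R : CommAlgCat.{u} K) :
    Function.Injective (toTensor K F R).hom :=
  Algebra.TensorProduct.includeRight_injective (R := K) (A := F) (B := R) (algebraMap K F).injective

/-- A closed subgroup which contains the torsion of invertible order contains all tori. -/
theorem exists_hom_of_isTorus {k : Type u} [Field k] {T G : GrpFunctor k} {j : T ⟶ G}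
    (hj : IsClosedImmersion j)
    (htors : ∀ (R : CommAlgCat.{u} k) (m : ℕ), (m : k) ≠ 0 → ∀ h : G.obj R, m • h = 0 →
      ∃ t, j.app R t = h) (K : Type u) [Field K] [Algebra k K] {T' : GrpFunctor K}
    (i : T' ⟶ baseChange K G) (hT' : IsTorus T') :
    ∃ f : T' ⟶ baseChange K T, f ≫ baseChangeMap K j = i := by
  have hK := hj.baseChange K
  refine exists_hom_of_forall_mem hK.1 fun R x => ?_
  obtain ⟨-, n, ⟨e⟩⟩ := hT'
  let F := AlgebraicClosure K
  let R₂ : CommAlgCat.{u} F := .of F (F ⊗[K] R)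
  obtain ⟨I, hI⟩ := hK.2 R (i.app R x)
  let θ : splitTorus F n ⟶ baseChange F (baseChange K G) := e.inv ≫ baseChangeMap F i
  have h1 := exists_preimage_of_splitTorus (hK.baseChange F) (fun m hm h h0 => by
    refine htors _ m ?_ h h0
    rintro h1
    apply hm
    rw [← map_natCast (algebraMap K F), ← map_natCast (algebraMap k K), h1, map_zero, map_zero])
    θ R₂ (e.hom.app R₂ (T'.map (toTensor K F R) x))
  have h2 : θ.app R₂ (e.hom.app R₂ (T'.map (toTensor K F R) x)) =
      (baseChange K G).map (toTensor K F R) (i.app R x) := by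
    have h3 : e.inv.app R₂ (e.hom.app R₂ (T'.map (toTensor K F R) x)) =
        T'.map (toTensor K F R) x :=
      ConcreteCategory.congr_hom (congr_app e.hom_inv_id R₂) (T'.map (toTensor K F R) x)
    refine Eq.trans (congrArg (i.app _) h3) ?_
    exact ConcreteCategory.congr_hom (i.naturality (toTensor K F R)) x
  rw [h2] at h1
  have h3 := (hI _ (toTensor K F R)).1 h1
  have h4 := (hI R (𝟙 R)).2 fun y hy => toTensor_injective K F R ((h3 y hy).trans (map_zero _).symm)
  rwa [CategoryTheory.Functor.map_id] at h4

end maximal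

section splitting

variable {k : Type u} [Field k]

/-- A splitting of a short exact sequence of pairs induces a splitting of fppf quotients. -/
theorem exists_iso_prod_of_splitting {N₁ G₁ N G N₂ G₂ : GrpFunctor k} {φ₁ : N₁ ⟶ G₁} {φ : N ⟶ G}
    {φ₂ : N₂ ⟶ G₂} {a₁ : N₁ ⟶ N} {b₁ : G₁ ⟶ G} (h₁ : φ₁ ≫ b₁ = a₁ ≫ φ) {a₂ : N ⟶ N₂} {b₂ : G ⟶ G₂}
    (h₂ : φ ≫ b₂ = a₂ ≫ φ₂) {c : N ⟶ N₁} {ρ : G ⟶ G₁} (h₃ : φ ≫ ρ = c ≫ φ₁) {d : N₂ ⟶ N}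
    {σ : G₂ ⟶ G} (h₄ : φ₂ ≫ σ = d ≫ φ) (h₁₃ : b₁ ≫ ρ = 𝟙 _) (h₁₂ : b₁ ≫ b₂ = 0) (h₄₃ : σ ≫ ρ = 0)
    (h₄₂ : σ ≫ b₂ = 𝟙 _) (hsum : ρ ≫ b₁ + b₂ ≫ σ = 𝟙 _) :
    ∃ e : fppfQuotient φ ≅ fppfQuotient φ₁ ⨯ fppfQuotient φ₂,
      fppfQuotientMap φ₁ φ a₁ b₁ h₁ ≫ e.hom ≫ Limits.prod.fst = 𝟙 _ ∧
        e.hom ≫ Limits.prod.snd = fppfQuotientMap φ φ₂ a₂ b₂ h₂ := by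
  set i := fppfQuotientMap φ₁ φ a₁ b₁ h₁
  set p := fppfQuotientMap φ φ₂ a₂ b₂ h₂
  set r := fppfQuotientMap φ φ₁ c ρ h₃
  set t := fppfQuotientMap φ₂ φ d σ h₄
  have hi : fppfQuotientProj φ₁ ≫ i = b₁ ≫ fppfQuotientProj φ := fppfQuotientProj_map ..
  have hp : fppfQuotientProj φ ≫ p = b₂ ≫ fppfQuotientProj φ₂ := fppfQuotientProj_map ..
  have hr : fppfQuotientProj φ ≫ r = ρ ≫ fppfQuotientProj φ₁ := fppfQuotientProj_map ..
  have ht : fppfQuotientProj φ₂ ≫ t = σ ≫ fppfQuotientProj φ := fppfQuotientProj_map ..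
  have hir : i ≫ r = 𝟙 _ := fppfQuotient_hom_ext _ (isFppfSheaf_fppfQuotient _) (by
    rw [reassoc_of% hi, hr, reassoc_of% h₁₃, Category.comp_id])
  have hip : i ≫ p = 0 := fppfQuotient_hom_ext _ (isFppfSheaf_fppfQuotient _) (by
    rw [reassoc_of% hi, hp, reassoc_of% h₁₂, zero_comp, comp_zero])
  have htr : t ≫ r = 0 := fppfQuotient_hom_ext _ (isFppfSheaf_fppfQuotient _) (by
    rw [reassoc_of% ht, hr, reassoc_of% h₄₃, zero_comp, comp_zero])
  have htp : t ≫ p = 𝟙 _ := fppfQuotient_hom_ext _ (isFppfSheaf_fppfQuotient _) (by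
    rw [reassoc_of% ht, hp, reassoc_of% h₄₂, Category.comp_id])
  have hs : r ≫ i + p ≫ t = 𝟙 _ := fppfQuotient_hom_ext _ (isFppfSheaf_fppfQuotient _) (by
    rw [Preadditive.comp_add, reassoc_of% hr, reassoc_of% hp, hi, ht, ← Category.assoc,
      ← Category.assoc b₂, ← Preadditive.add_comp, hsum, Category.id_comp, Category.comp_id])
  refine ⟨⟨prod.lift r p, prod.fst ≫ i + prod.snd ≫ t, ?_, ?_⟩, ?_, ?_⟩
  · rw [Preadditive.comp_add, prod.lift_fst_assoc, prod.lift_snd_assoc, hs]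
  · apply Limits.prod.hom_ext
    · rw [Category.assoc, prod.lift_fst, Preadditive.add_comp, Category.assoc, Category.assoc, hir,
        htr, Category.comp_id, comp_zero, add_zero, Category.id_comp]
    · rw [Category.assoc, prod.lift_snd, Preadditive.add_comp, Category.assoc, Category.assoc, hip,
        htp, Category.comp_id, comp_zero, zero_add, Category.id_comp]
  · change i ≫ prod.lift r p ≫ prod.fst = _
    rw [prod.lift_fst, hir]
  · exact prod.lift_snd r p

variable {A B : Type u} [CommRing A] [CommRing B] [Algebra k A] [Algebra k B]

theorem sub_map_mem {J : Ideal B} {π : B →ₐ[k] B} (hπ : ∀ b, b - π b ∈ J) {R : Type u} [CommRing R]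
    [Algebra k R] (x : B ⊗[k] R) : x - mapL π R x ∈ J.map (algebraMap B (B ⊗[k] R)) := by
  induction x with
  | zero => simp
  | add x y hx hy =>
    rw [map_add, add_sub_add_comm]
    exact add_mem hx hy
  | tmul b r =>
    rw [Algebra.TensorProduct.map_tmul, AlgHom.id_apply, ← TensorProduct.sub_tmul]
    rw [show (b - π b) ⊗ₜ[k] r = algebraMap B (B ⊗[k] R) (b - π b) * (1 ⊗ₜ r) by simp]
    exact Ideal.mul_mem_right _ _ (Ideal.mem_map_of_mem _ (hπ b))

theorem div_mem_onePlusSubgroup {J : Ideal B} {π : B →ₐ[k] B} (hπ : ∀ b, b - π b ∈ J) {R : Type u}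
    [CommRing R] [Algebra k R] (x : (B ⊗[k] R)ˣ) :
    x / tensorUnitsMap π (AlgHom.id k R) x ∈ onePlusSubgroup (k := k) J R := by
  rw [onePlusSubgroup, MonoidHom.mem_ker, map_div, div_eq_one]
  exact Units.ext (Ideal.Quotient.eq.2 (sub_map_mem hπ (x : B ⊗[k] R)))

theorem tensorUnitsMap_comm (f : A →ₐ[k] B) {R S : Type u} [CommRing R] [CommRing S] [Algebra k R]
    [Algebra k S] (g : R →ₐ[k] S) (x : (A ⊗[k] R)ˣ) :
    tensorUnitsMap (AlgHom.id k B) g (tensorUnitsMap f (AlgHom.id k R) x) =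
      tensorUnitsMap f (AlgHom.id k S) (tensorUnitsMap (AlgHom.id k A) g x) :=
  Units.ext (map_map_comm f g (x : A ⊗[k] R))

theorem tensorUnitsMap_tensorUnitsMap {C : Type u} [CommRing C] [Algebra k C] (f : A →ₐ[k] B)
    (g : B →ₐ[k] C) {R : Type u} [CommRing R] [Algebra k R] (x : (A ⊗[k] R)ˣ) :
    tensorUnitsMap g (AlgHom.id k R) (tensorUnitsMap f (AlgHom.id k R) x) =
      tensorUnitsMap (g.comp f) (AlgHom.id k R) x :=
  Units.ext (mapL_comp f g R (x : A ⊗[k] R))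

theorem tensorUnitsMap_id {R : Type u} [CommRing R] [Algebra k R] (x : (A ⊗[k] R)ˣ) :
    tensorUnitsMap (AlgHom.id k A) (AlgHom.id k R) x = x :=
  Units.ext (DFunLike.congr_fun (Algebra.TensorProduct.map_id (R := k) (S := k) (A := A) (B := R))
    (x : A ⊗[k] R))

theorem tensorUnitsMap_eq_one {J : Ideal A} {f : A →ₐ[k] B} (hf : ∀ a ∈ J, f a = 0) {R : Type u}
    [CommRing R] [Algebra k R] {x : (A ⊗[k] R)ˣ} (hx : x ∈ onePlusSubgroup (k := k) J R) :
    tensorUnitsMap f (AlgHom.id k R) x = 1 := by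
  rw [mem_onePlusSubgroup] at hx
  have h1 : J.map (algebraMap A (A ⊗[k] R)) ≤ RingHom.ker (mapL f R) := by
    rw [Ideal.map_le_iff_le_comap]
    intro a ha
    simp [RingHom.mem_ker, hf a ha]
  have h2 : mapL f R ((x : A ⊗[k] R) - 1) = 0 := h1 hx
  rw [map_sub, map_one, sub_eq_zero] at h2
  exact Units.ext h2

/-- The homomorphism `x ↦ x / π x` from `μ^B` to `1 + J`, for an endomorphism `π` of `B` congruent
to the identity modulo `J`. -/
noncomputable def muToOnePlus {J : Ideal B} (π : B →ₐ[k] B) (hπ : ∀ b, b - π b ∈ J) :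
    mu k B ⟶ onePlus k J where
  app R := AddCommGrpCat.uliftFunctor.{u + 1, u}.map (AddCommGrpCat.ofHom
    ((MonoidHom.id (B ⊗[k] R)ˣ / tensorUnitsMap π (AlgHom.id k R)).codRestrict
      (onePlusSubgroup (k := k) J R) (div_mem_onePlusSubgroup hπ)).toAdditive)
  naturality R S g := by
    refine ConcreteCategory.hom_ext _ _ fun x => ?_
    refine ULift.ext _ _ (Subtype.ext ?_)
    change tensorUnitsMap (AlgHom.id k B) g.hom (Additive.toMul x.down) /
      tensorUnitsMap π (AlgHom.id k S) (tensorUnitsMap (AlgHom.id k B) g.hom _) =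
        tensorUnitsMap (AlgHom.id k B) g.hom (_ / tensorUnitsMap π (AlgHom.id k R) _)
    rw [map_div, tensorUnitsMap_comm]
    rfl

theorem muMap_muToOnePlus {I : Ideal A} {J : Ideal B} {f : A →ₐ[k] B} (h : I ≤ J.comap f)
    {π : A →ₐ[k] A} (hπ : ∀ a, a - π a ∈ I) {π' : B →ₐ[k] B} (hπ' : ∀ b, b - π' b ∈ J)
    (hf : f.comp π = π'.comp f) :
    muMap f ≫ muToOnePlus π' hπ' = muToOnePlus π hπ ≫ onePlusMap f h := by
  ext R x
  refine ULift.ext _ _ (Subtype.ext ?_)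
  change tensorUnitsMap f (AlgHom.id k R) (Additive.toMul x.down) /
      tensorUnitsMap π' (AlgHom.id k R) (tensorUnitsMap f (AlgHom.id k R) _) =
        tensorUnitsMap f (AlgHom.id k R) (_ / tensorUnitsMap π (AlgHom.id k R) _)
  rw [map_div, tensorUnitsMap_tensorUnitsMap, tensorUnitsMap_tensorUnitsMap, hf]
  rfl

end splitting

section red

variable {k : Type u} [Field k] {B : Type u} [CommRing B] [Algebra k B] [Module.Finite k B]
  {A : Subalgebra k B}

theorem exists_section (h : sepTop k B = ⊤) (A : Subalgebra k B) : ∃ t : Red B →ₐ[k] B,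
    (toRed k B).comp t = AlgHom.id k _ ∧ ∀ x ∈ redSub A, t x ∈ A := by
  have := etale_sepPart (⊤ : Subalgebra k (Red B))
  obtain ⟨s, hs, -⟩ := existsUnique_lift (k := k) (B := B) (sepTop k B).val
  have htop : ∀ x : Red B, x ∈ sepTop k B := fun x => h ▸ trivial
  let c : Red B →ₐ[k] sepTop k B := (AlgHom.id k _).codRestrict _ htop
  refine ⟨s.comp c, AlgHom.ext fun x => toRed_lift hs (c x), fun x hx => ?_⟩
  rw [← sepSub_eq_redSub h A] at hx
  exact lift_sepIncl_mem hs ⟨x, hx⟩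

theorem exists_iso_prod (h : sepTop k B = ⊤) :
    ∃ e : relMu A.val ≅ nilQuot A ⨯ relMu (redSub A).val,
      nilQuotIncl A ≫ e.hom ≫ Limits.prod.fst = 𝟙 (nilQuot A) ∧
        e.hom ≫ Limits.prod.snd = relMuToRed A := by
  obtain ⟨t, ht, htA⟩ := exists_section h A
  have ht' : ∀ x, toRed k B (t x) = x := DFunLike.congr_fun ht
  let π : B →ₐ[k] B := t.comp (toRed k B)
  have hπ : ∀ b, b - π b ∈ nilradical B := fun b => by
    rw [← Ideal.Quotient.eq_zero_iff_mem]
    refine (map_sub (toRed k B) b _).trans ?_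
    rw [sub_eq_zero]
    exact (ht' _).symm
  let tA : redSub A →ₐ[k] A := (t.comp (redSub A).val).codRestrict A fun x => htA x x.2
  let πA : A →ₐ[k] A := tA.comp (toRedSub A)
  have hπA : ∀ a, a - πA a ∈ nilradical A := fun a => by
    have h1 : IsNilpotent (A.val (a - πA a)) := hπ a
    exact (IsNilpotent.map_iff (f := A.val) Subtype.val_injective).1 h1
  refine exists_iso_prod_of_splitting (φ₁ := onePlusMap A.val (nilradical_le A))
    (φ := muMap A.val) (φ₂ := muMap (redSub A).val) (c := muToOnePlus πA hπA)
    (ρ := muToOnePlus π hπ) (d := muMap tA) (σ := muMap t) rfl (muMap_comm rfl)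
    (muMap_muToOnePlus (nilradical_le A) hπA hπ rfl) (muMap_comm rfl) ?_ ?_ ?_ ?_ ?_
  · ext R x
    refine ULift.ext _ _ (Subtype.ext ?_)
    change (_ : (B ⊗[k] R)ˣ) / tensorUnitsMap π (AlgHom.id k R) (Additive.toMul x.down).1 = _
    rw [tensorUnitsMap_eq_one (J := nilradical B) (fun a ha => ?_) (Additive.toMul x.down).2,
      div_one]
    · rfl
    · have h1 : toRed k B a = 0 := Ideal.Quotient.eq_zero_iff_mem.2 ha
      exact (congrArg t h1).trans (map_zero t)
  · ext R x
    refine ULift.ext _ _ ?_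
    exact tensorUnitsMap_eq_one (J := nilradical B) (f := toRed k B)
      (fun a ha => Ideal.Quotient.eq_zero_iff_mem.2 ha) (Additive.toMul x.down).2
  · ext R x
    refine ULift.ext _ _ (Subtype.ext ?_)
    change tensorUnitsMap t (AlgHom.id k R) _ / tensorUnitsMap π (AlgHom.id k R)
      (tensorUnitsMap t (AlgHom.id k R) (Additive.toMul x.down)) = 1
    have h1 : π.comp t = t := AlgHom.ext fun x => congrArg t (ht' x)
    rw [tensorUnitsMap_tensorUnitsMap, h1]
    exact div_self' _
  · ext R x
    refine ULift.ext _ _ ?_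
    refine (tensorUnitsMap_tensorUnitsMap t (toRed k B) (Additive.toMul x.down)).trans ?_
    rw [ht]
    exact tensorUnitsMap_id _
  · ext R x
    refine ULift.ext _ _ ?_
    change (Additive.toMul x.down / tensorUnitsMap π (AlgHom.id k R) (Additive.toMul x.down)) *
      tensorUnitsMap t (AlgHom.id k R) (tensorUnitsMap (toRed k B) (AlgHom.id k R)
        (Additive.toMul x.down)) = Additive.toMul x.down
    rw [tensorUnitsMap_tensorUnitsMap, div_mul_cancel]

end red

section coefficients

variable {k : Type*} [Field k] {ι n : Type*}

theorem coeff_mul_C {R : Type*} [CommRing R] (α : ι →₀ ℕ) (p : MvPolynomial ι R) (r : R) :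
    MvPolynomial.coeff α (p * MvPolynomial.C r) = MvPolynomial.coeff α p * r := by
  rw [mul_comm, MvPolynomial.coeff_C_mul, mul_comm]

/-- The matrix of coefficients of a monomial in a matrix of polynomials. -/
noncomputable def coeffMatrix (α : ι →₀ ℕ) (P : Matrix n n (MvPolynomial ι k)) : Matrix n n k :=
  P.map (MvPolynomial.coeff α)

theorem coeffMatrix_one [DecidableEq n] [DecidableEq ι] (γ : ι →₀ ℕ) :
    coeffMatrix γ (1 : Matrix n n (MvPolynomial ι k)) = if γ = 0 then 1 else 0 := by
  ext i j
  by_cases hij : i = j <;> by_cases hγ : γ = 0 <;>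
    simp [coeffMatrix, Matrix.one_apply, hij, hγ, MvPolynomial.coeff_one, eq_comm]

variable [Fintype n]

theorem coeffMatrix_mul [DecidableEq ι] (γ : ι →₀ ℕ) (P Q : Matrix n n (MvPolynomial ι k)) :
    coeffMatrix γ (P * Q) =
      ∑ x ∈ Finset.HasAntidiagonal.antidiagonal γ, coeffMatrix x.1 P * coeffMatrix x.2 Q := by
  ext i j
  simp only [coeffMatrix, Matrix.map_apply, Matrix.mul_apply, MvPolynomial.coeff_sum,
    MvPolynomial.coeff_mul, Matrix.sum_apply]
  exact Finset.sum_comm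

/-- The set of monomials occurring in a matrix of polynomials. -/
noncomputable def matrixSupport [DecidableEq ι] (P : Matrix n n (MvPolynomial ι k)) :
    Finset (ι →₀ ℕ) :=
  Finset.univ.biUnion fun x : n × n => (P x.1 x.2).support

theorem coeffMatrix_eq_zero [DecidableEq ι] {P : Matrix n n (MvPolynomial ι k)} {α : ι →₀ ℕ}
    (h : α ∉ matrixSupport P) : coeffMatrix α P = 0 := by
  ext i j
  simp only [matrixSupport, Finset.mem_biUnion, Finset.mem_univ, true_and, Prod.exists, not_exists,
    MvPolynomial.mem_support_iff, not_not] at h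
  exact h i j

variable [DecidableEq n]

theorem coeffMatrix_map (ψ : MvPolynomial ι k →ₐ[k] MvPolynomial ι k)
    (P : Matrix n n (MvPolynomial ι k)) (β : ι →₀ ℕ) :
    coeffMatrix β (P.map ψ) ∈ Algebra.adjoin k (Set.range fun α => coeffMatrix α P) := by
  classical
  have h1 : coeffMatrix β (P.map ψ) = ∑ α ∈ matrixSupport P,
      MvPolynomial.coeff β (ψ (MvPolynomial.monomial α 1)) • coeffMatrix α P := by
    ext i j
    have h2 : P i j = ∑ α ∈ matrixSupport P, MvPolynomial.coeff α (P i j) •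
        MvPolynomial.monomial α (1 : k) := by
      refine MvPolynomial.ext _ _ fun γ => ?_
      simp only [MvPolynomial.coeff_sum, MvPolynomial.coeff_smul, MvPolynomial.coeff_monomial,
        smul_eq_mul, mul_ite, mul_one, mul_zero, Finset.sum_ite_eq']
      split_ifs with h
      · rfl
      · exact congrFun (congrFun (coeffMatrix_eq_zero h) i) j
    simp only [coeffMatrix, Matrix.map_apply, Matrix.sum_apply, Matrix.smul_apply]
    conv_lhs => rw [h2]
    simp only [map_sum, map_smul, MvPolynomial.coeff_sum, MvPolynomial.coeff_smul, smul_eq_mul,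
      mul_comm]
  rw [h1]
  exact Subalgebra.sum_mem _ fun α _ =>
    Subalgebra.smul_mem _ (Algebra.subset_adjoin (Set.mem_range_self α)) _

/-- The coefficients of an invertible polynomial with commuting matrix coefficients are nilpotent,
except for the constant one; so they have a common kernel. -/
theorem exists_mulVec_eq_zero [Nonempty n] {P Q : Matrix n n (MvPolynomial ι k)} (hPQ : P * Q = 1)
    (hcomm : ∀ α β, coeffMatrix α P * coeffMatrix β P = coeffMatrix β P * coeffMatrix α P)
    (hQ : ∀ β, coeffMatrix β Q ∈ Algebra.adjoin k (Set.range fun α => coeffMatrix α P)) :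
    ∃ v : n → k, v ≠ 0 ∧ ∀ α, α ≠ 0 → (coeffMatrix α P).mulVec v = 0 := by
  classical
  let 𝒜 := Algebra.adjoin k (Set.range fun α => coeffMatrix α P)
  let _ : CommRing 𝒜 :=
    { (inferInstance : Ring 𝒜) with
      mul_comm := (Algebra.isMulCommutative_adjoin k (by
        rintro _ ⟨α, rfl⟩ _ ⟨β, rfl⟩
        exact hcomm α β)).is_comm.comm }
  have : Module.Finite k 𝒜 := inferInstance
  have : IsNoetherianRing 𝒜 := IsNoetherianRing.of_finite k 𝒜
  let N (α : ι →₀ ℕ) : 𝒜 := ⟨coeffMatrix α P, Algebra.subset_adjoin ⟨α, rfl⟩⟩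
  let N' (α : ι →₀ ℕ) : 𝒜 := ⟨coeffMatrix α Q, hQ α⟩
  let p : MvPolynomial ι 𝒜 := ∑ α ∈ matrixSupport P, MvPolynomial.monomial α (N α)
  let q : MvPolynomial ι 𝒜 := ∑ α ∈ matrixSupport Q, MvPolynomial.monomial α (N' α)
  have hp : ∀ α, p.coeff α = N α := fun α => by
    simp only [p, MvPolynomial.coeff_sum, MvPolynomial.coeff_monomial, Finset.sum_ite_eq']
    split_ifs with h
    · rfl
    · exact Subtype.ext (coeffMatrix_eq_zero h).symm
  have hq : ∀ α, q.coeff α = N' α := fun α => by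
    simp only [q, MvPolynomial.coeff_sum, MvPolynomial.coeff_monomial, Finset.sum_ite_eq']
    split_ifs with h
    · rfl
    · exact Subtype.ext (coeffMatrix_eq_zero h).symm
  have hpq : p * q = 1 := by
    refine MvPolynomial.ext _ _ fun γ => ?_
    have h1 := coeffMatrix_mul γ P Q
    rw [hPQ, coeffMatrix_one] at h1
    rw [MvPolynomial.coeff_mul, MvPolynomial.coeff_one]
    simp only [hp, hq]
    refine Subtype.ext ?_
    refine (map_sum 𝒜.val (fun x : (ι →₀ ℕ) × (ι →₀ ℕ) => N x.1 * N' x.2) _).trans ?_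
    refine h1.symm.trans ?_
    by_cases h : γ = 0 <;> simp [h, eq_comm]
  have hnil : ∀ α, α ≠ 0 → IsNilpotent (N α) := fun α hα => by
    rw [← hp]
    exact (MvPolynomial.isUnit_iff.1 (IsUnit.of_mul_eq_one q hpq)).2 α hα
  let f : 𝒜 →+* Module.End k (n → k) :=
    (Matrix.toLinAlgEquiv' (R := k) (n := n)).toRingEquiv.toRingHom.comp 𝒜.val.toRingHom
  let _ : Module 𝒜 (n → k) := Module.compHom (n → k) f
  obtain ⟨I, hI⟩ := associatedPrimes.nonempty 𝒜 (n → k)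
  rw [AssociatedPrimes.mem_iff, isAssociatedPrime_iff] at hI
  obtain ⟨hI, v, rfl⟩ := hI
  refine ⟨v, ?_, fun α hα => ?_⟩
  · rintro rfl
    exact hI.ne_top (by simp)
  · have h1 : N α ∈ (⊥ : Submodule 𝒜 (n → k)).colon {v} := by
      obtain ⟨m, hm⟩ := hnil α hα
      exact hI.mem_of_pow_mem m (hm ▸ zero_mem _)
    rw [Submodule.mem_colon_singleton, Submodule.mem_bot] at h1
    exact h1

end coefficients

section unipotent

variable {k : Type u} [Field k]

theorem coeffMatrix_comm {ι n : Type*} [Fintype n] [DecidableEq n]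
    {P : Matrix n n (MvPolynomial ι k)}
    (h : P.map (MvPolynomial.C (σ := ι)) * P.map (MvPolynomial.map MvPolynomial.C) =
      P.map (MvPolynomial.map MvPolynomial.C) * P.map (MvPolynomial.C (σ := ι)))
    (α β : ι →₀ ℕ) : coeffMatrix α P * coeffMatrix β P = coeffMatrix β P * coeffMatrix α P := by
  ext i j
  have h1 := congrArg (fun M => MvPolynomial.coeff α (MvPolynomial.coeff β (M i j))) h
  simp only [Matrix.mul_apply, Matrix.map_apply, MvPolynomial.coeff_sum, MvPolynomial.coeff_C_mul,
    MvPolynomial.coeff_map, coeff_mul_C] at h1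
  simpa only [Matrix.mul_apply, coeffMatrix, Matrix.map_apply] using h1

/-- A commutative group functor which is a quotient of an affine space is unipotent. -/
theorem isUnipotent_of_universal {G : GrpFunctor k} (hG : IsAffineGroupScheme G) {d : ℕ}
    (y : G.obj (.of k (MvPolynomial (Fin d) k)))
    (hy : ∀ (R : CommAlgCat.{u} k) (z : G.obj R),
      ∃ ψ : CommAlgCat.of k (MvPolynomial (Fin d) k) ⟶ R, G.map ψ y = z) : IsUnipotent G := by
  classical
  refine ⟨hG, fun n V hn => ?_⟩
  have : Nonempty (Fin n) := ⟨⟨0, hn⟩⟩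
  let Λ : CommAlgCat.{u} k := .of k (MvPolynomial (Fin d) k)
  let Λ₂ : CommAlgCat.{u} k := .of k (MvPolynomial (Fin d) (MvPolynomial (Fin d) k))
  let M {R : CommAlgCat.{u} k} (g : G.obj R) : Matrix (Fin n) (Fin n) R := (V.ρ R (.ofAdd g)).val
  have hMadd : ∀ {R : CommAlgCat.{u} k} (g h : G.obj R), M (g + h) = M g * M h := fun {R} g h =>
    congrArg Units.val (map_mul (V.ρ R) (.ofAdd g) (.ofAdd h))
  have hM0 : ∀ {R : CommAlgCat.{u} k}, M (0 : G.obj R) = 1 := fun {R} =>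
    congrArg Units.val (map_one (V.ρ R))
  have hMmap : ∀ {R S : CommAlgCat.{u} k} (φ : R ⟶ S) (g : G.obj R),
      M (G.map φ g) = (M g).map φ.hom := fun φ g => congrArg Units.val (V.naturality φ g)
  have hcomm := coeffMatrix_comm (P := M y) (by
    let a : Λ ⟶ Λ₂ := CommAlgCat.ofHom (IsScalarTower.toAlgHom k (MvPolynomial (Fin d) k)
      (MvPolynomial (Fin d) (MvPolynomial (Fin d) k)))
    let b : Λ ⟶ Λ₂ := CommAlgCat.ofHom (MvPolynomial.mapAlgHom (σ := Fin d)
      (Algebra.ofId k (MvPolynomial (Fin d) k)))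
    have h1 : M (G.map a y) * M (G.map b y) = M (G.map b y) * M (G.map a y) := by
      rw [← hMadd, ← hMadd, add_comm]
    rw [hMmap, hMmap] at h1
    exact h1)
  obtain ⟨ψ, hψ⟩ := hy Λ (-y)
  obtain ⟨v, hv, hv'⟩ := exists_mulVec_eq_zero (P := M y) (Q := M (-y))
    (by rw [← hMadd, add_neg_cancel, hM0]) hcomm fun β => by
      rw [← hψ, hMmap]
      exact coeffMatrix_map ψ.hom (M y) β
  let w : Fin n → k := (coeffMatrix 0 (M y)).mulVec v
  have hw : (M y).mulVec (fun i => MvPolynomial.C (v i)) = fun i => MvPolynomial.C (w i) := by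
    ext i α
    have h1 : MvPolynomial.coeff α ((M y).mulVec (fun i => MvPolynomial.C (v i)) i) =
        (coeffMatrix α (M y)).mulVec v i := by
      simp only [Matrix.mulVec, dotProduct, MvPolynomial.coeff_sum, coeff_mul_C]
      rfl
    rw [h1, MvPolynomial.coeff_C]
    split_ifs with h
    · rw [← h]
    · rw [hv' α (Ne.symm h)]
      rfl
  have key : ∀ (R : CommAlgCat.{u} k) (g : G.obj R),
      (M g).mulVec (fun i => algebraMap k R (v i)) = fun i => algebraMap k R (w i) := by
    intro R g
    obtain ⟨φ, rfl⟩ := hy R g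
    ext i
    have h1 := congrArg φ.hom (congrFun hw i)
    rw [hMmap]
    simp only [Matrix.mulVec, dotProduct, map_sum, map_mul, Matrix.map_apply] at h1 ⊢
    have h2 : ∀ c : k, φ.hom (MvPolynomial.C c) = algebraMap k R c := fun c => φ.hom.commutes c
    simp only [h2] at h1
    exact h1
  have hvw : v = w := by
    have h1 := key (.of k k) 0
    rw [hM0, Matrix.one_mulVec] at h1
    exact h1
  refine ⟨v, hv, fun R g => ?_⟩
  have h1 := key R g
  rw [← hvw] at h1
  exact h1

end unipotent

section filtration

variable {k V U W : Type*} [Field k] [AddCommGroup V] [Module k V] [AddCommGroup U] [Module k U]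
  [AddCommGroup W] [Module k W]

theorem exists_comp_eq_of_ker_le (f : U →ₗ[k] V) (g : U →ₗ[k] W)
    (h : LinearMap.ker f ≤ LinearMap.ker g) : ∃ r : V →ₗ[k] W, ∀ x, r (f x) = g x := by
  obtain ⟨s, hs⟩ := ((LinearMap.ker f).liftQ f le_rfl).exists_leftInverse_of_injective
    (Submodule.ker_liftQ_eq_bot _ _ _ le_rfl)
  refine ⟨(LinearMap.ker f).liftQ g h ∘ₗ s, fun x => ?_⟩
  have h1 : s (f x) = (LinearMap.ker f).mkQ x := DFunLike.congr_fun hs ((LinearMap.ker f).mkQ x)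
  rw [LinearMap.comp_apply, h1]
  rfl

theorem exists_filtered_projection_aux {F : ℕ → Submodule k V} (hF : Antitone F) {N : ℕ}
    (hN : F N = ⊥) (I : Submodule k V) {m : ℕ} (hm : m ≤ N) :
    ∃ q : V →ₗ[k] V, (∀ x, q x ∈ I ⊓ F m) ∧ (∀ x ∈ I ⊓ F m, q x = x) ∧
      ∀ j, m ≤ j → ∀ x ∈ F j, q x ∈ F j := by
  induction hm using Nat.decreasingInduction with
  | self =>
    refine ⟨0, fun _ => zero_mem _, fun x hx => ?_, fun _ _ _ _ => zero_mem _⟩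
    rw [hN, inf_bot_eq, Submodule.mem_bot] at hx
    rw [hx, map_zero]
  | of_succ m hm ih =>
    obtain ⟨q, h1, h2, h3⟩ := ih
    have hle : I ⊓ F (m + 1) ≤ I ⊓ F m := inf_le_inf_left _ (hF m.le_succ)
    obtain ⟨r, hr⟩ := exists_comp_eq_of_ker_le ((F (m + 1)).mkQ ∘ₗ (I ⊓ F m).subtype)
      (((I ⊓ F m).subtype - q ∘ₗ (I ⊓ F m).subtype).codRestrict (I ⊓ F m)
        fun x => sub_mem x.2 (hle (h1 _))) (by
      intro x hx
      have hx' : (x : V) ∈ F (m + 1) := (Submodule.Quotient.mk_eq_zero _).1 hx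
      rw [LinearMap.mem_ker]
      refine Subtype.ext ?_
      change (x : V) - q x = 0
      rw [h2 x ⟨x.2.1, hx'⟩, sub_self])
    refine ⟨q + (I ⊓ F m).subtype ∘ₗ r ∘ₗ (F (m + 1)).mkQ,
      fun x => add_mem (hle (h1 x)) (r _).2, fun x hx => ?_, fun j hj x hx => ?_⟩
    · have h := congrArg Subtype.val (hr ⟨x, hx⟩)
      change (r ((F (m + 1)).mkQ x) : V) = x - q x at h
      change q x + (r ((F (m + 1)).mkQ x) : V) = x
      rw [h, add_sub_cancel]
    · obtain rfl | hj := hj.eq_or_lt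
      · exact add_mem (hle (h1 x)).2 (r _).2.2
      · have h : (F (m + 1)).mkQ x = 0 := (Submodule.Quotient.mk_eq_zero _).2 (hF hj hx)
        change q x + (r ((F (m + 1)).mkQ x) : V) ∈ F j
        rw [h, map_zero]
        exact add_mem (h3 j hj x hx) (zero_mem _)

/-- A subspace of a filtered vector space is the image of a filtered projection. -/
theorem exists_filtered_projection {F : ℕ → Submodule k V} (hF : Antitone F) (h0 : F 0 = ⊤) {N : ℕ}
    (hN : F N = ⊥) (I : Submodule k V) :
    ∃ q : V →ₗ[k] V, (∀ x, q x ∈ I) ∧ (∀ x ∈ I, q x = x) ∧ ∀ j, ∀ x ∈ F j, q x ∈ F j := by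
  obtain ⟨q, h1, h2, h3⟩ := exists_filtered_projection_aux hF hN I N.zero_le
  rw [h0, inf_top_eq] at h1 h2
  exact ⟨q, h1, h2, fun j => h3 j j.zero_le⟩

end filtration

section factorization

variable {T : Type*} [CommRing T] {J : Ideal T} {Q : T →+ T}

theorem sub_mul_mem (hQ : ∀ m, ∀ x ∈ J ^ m, Q x ∈ J ^ m) {z e : T} (hz : z ∈ J) {m : ℕ}
    (he : e ∈ J ^ m) (he' : e ∈ J) :
    ((z + e) + ((z + e) - Q (z + e)) * Q (z + e)) - (z + (z - Q z) * Q z) - e ∈ J ^ (m + 1) := by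
  have hQ1 : ∀ x ∈ J, Q x ∈ J := by simpa using hQ 1
  have h : ((z + e) + ((z + e) - Q (z + e)) * Q (z + e)) - (z + (z - Q z) * Q z) - e =
      Q e * (z - Q z) + (e - Q e) * (Q z + Q e) := by
    rw [map_add]
    ring
  rw [h, pow_succ]
  exact add_mem (Ideal.mul_mem_mul (hQ m e he) (sub_mem hz (hQ1 z hz)))
    (Ideal.mul_mem_mul (sub_mem he (hQ m e he)) (add_mem (hQ1 z hz) (hQ1 e he')))

/-- For a projection `Q` compatible with the powers of a nilpotent ideal `J`, the elements of
`1 + J` are products of elements of `1 + ker Q` and of `1 + im Q`. -/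
theorem exists_add_mul_eq (hJ : IsNilpotent J) (hQ : ∀ m, ∀ x ∈ J ^ m, Q x ∈ J ^ m) {t : T}
    (ht : t ∈ J) : ∃ z ∈ J, z + (z - Q z) * Q z = t := by
  have key : ∀ m, ∃ z ∈ J, t - (z + (z - Q z) * Q z) ∈ J ∧ t - (z + (z - Q z) * Q z) ∈ J ^ m := by
    intro m
    induction m with
    | zero => exact ⟨0, zero_mem _, by simpa using ht, by simp⟩
    | succ m ih =>
      obtain ⟨z, hz, h1, h2⟩ := ih
      set e := t - (z + (z - Q z) * Q z) with he
      have h := sub_mul_mem hQ hz h2 h1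
      have h' : t - ((z + e) + ((z + e) - Q (z + e)) * Q (z + e)) ∈ J ^ (m + 1) := by
        rw [show t - ((z + e) + ((z + e) - Q (z + e)) * Q (z + e)) =
          -(((z + e) + ((z + e) - Q (z + e)) * Q (z + e)) - (z + (z - Q z) * Q z) - e) by
            rw [he]; ring]
        exact neg_mem h
      exact ⟨z + e, add_mem hz h1, Ideal.pow_le_self m.succ_ne_zero h', h'⟩
  obtain ⟨N, hN⟩ := hJ
  obtain ⟨z, hz, -, h⟩ := key N
  rw [hN, Ideal.zero_eq_bot, Ideal.mem_bot, sub_eq_zero] at h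
  exact ⟨z, hz, h.symm⟩

theorem eq_of_add_mul_eq (hJ : IsNilpotent J) (hQ : ∀ m, ∀ x ∈ J ^ m, Q x ∈ J ^ m) {z z' : T}
    (hz : z ∈ J) (hz' : z' ∈ J) (h : z + (z - Q z) * Q z = z' + (z' - Q z') * Q z') : z = z' := by
  have key : ∀ m, z' - z ∈ J ^ m := by
    intro m
    induction m with
    | zero => simp
    | succ m ih =>
      have h1 := sub_mul_mem hQ hz ih (sub_mem hz' hz)
      rw [add_sub_cancel, h, sub_self, zero_sub] at h1
      exact neg_mem_iff.1 h1
  obtain ⟨N, hN⟩ := hJ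
  have h1 := key N
  rw [hN, Ideal.zero_eq_bot, Ideal.mem_bot, sub_eq_zero] at h1
  exact h1.symm

end factorization

section extended

variable {k : Type u} [Field k] {B : Type u} [CommRing B] [Algebra k B]

theorem map_induction {I : Ideal B} {R : Type*} [CommRing R] [Algebra k R] {p : B ⊗[k] R → Prop}
    (h0 : p 0) (hadd : ∀ x y, p x → p y → p (x + y)) (htmul : ∀ b ∈ I, ∀ r : R, p (b ⊗ₜ r))
    {x : B ⊗[k] R} (hx : x ∈ I.map (algebraMap B (B ⊗[k] R))) : p x := by
  suffices ∀ y, p (y * x) by simpa using this 1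
  rw [Ideal.map] at hx
  induction hx using Submodule.span_induction with
  | mem x hx =>
    obtain ⟨b, hb, rfl⟩ := hx
    intro y
    induction y with
    | zero => rwa [zero_mul]
    | add y z hy hz =>
      rw [add_mul]
      exact hadd _ _ hy hz
    | tmul c r =>
      rw [Algebra.TensorProduct.algebraMap_apply, Algebra.TensorProduct.tmul_mul_tmul, mul_one]
      exact htmul _ (I.mul_mem_left c hb) r
  | zero =>
    intro y
    rwa [mul_zero]
  | add x y _ _ hx hy =>
    intro z
    rw [mul_add]
    exact hadd _ _ (hx z) (hy z)
  | smul a x _ hx =>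
    intro z
    rw [smul_eq_mul, ← mul_assoc]
    exact hx _

theorem tmul_mem_map {I : Ideal B} {R : Type*} [CommRing R] [Algebra k R] {b : B} (hb : b ∈ I)
    (r : R) : b ⊗ₜ[k] r ∈ I.map (algebraMap B (B ⊗[k] R)) := by
  rw [show b ⊗ₜ[k] r = algebraMap B (B ⊗[k] R) b * (1 ⊗ₜ r) by simp]
  exact Ideal.mul_mem_right _ _ (Ideal.mem_map_of_mem _ hb)

theorem rTensor_mem_map {A : Type u} [CommRing A] [Algebra k A] {I : Ideal A} {J : Ideal B}
    {q : A →ₗ[k] B} (h : ∀ x ∈ I, q x ∈ J)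
    {R : Type*} [CommRing R] [Algebra k R] {x : A ⊗[k] R}
    (hx : x ∈ I.map (algebraMap A (A ⊗[k] R))) :
    q.rTensor R x ∈ J.map (algebraMap B (B ⊗[k] R)) := by
  refine map_induction (p := fun x => q.rTensor R x ∈ J.map (algebraMap B (B ⊗[k] R)))
    ?_ (fun x y hx hy => ?_) (fun b hb r => ?_) hx
  · rw [map_zero]
    exact zero_mem _
  · rw [map_add]
    exact add_mem hx hy
  · exact tmul_mem_map (h b hb) r

theorem isNilpotent_of_mem_map {R : Type*} [CommRing R] [Algebra k R] {x : B ⊗[k] R}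
    (hx : x ∈ (nilradical B).map (algebraMap B (B ⊗[k] R))) : IsNilpotent x := by
  rw [← mem_nilradical]
  refine Ideal.map_le_iff_le_comap.2 (fun b hb => ?_) hx
  exact mem_nilradical.2 ((mem_nilradical.1 hb).map (algebraMap B (B ⊗[k] R)))

/-- The point `1 + z` of `1 + J`, where `J` is the nilradical of `B`. -/
noncomputable def onePlusMk {R : CommAlgCat.{u} k} {z : B ⊗[k] R}
    (hz : z ∈ (nilradical B).map (algebraMap B (B ⊗[k] R))) :
    (onePlus k (nilradical B)).obj R :=
  ⟨.ofMul ⟨(isNilpotent_of_mem_map hz).isUnit_one_add.unit, mem_onePlusSubgroup.2 (by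
    rwa [IsUnit.unit_spec, add_sub_cancel_left])⟩⟩

/-- The element `z` of a point `1 + z` of `1 + J`. -/
noncomputable def onePlusVal {I : Ideal B} {R : CommAlgCat.{u} k} (x : (onePlus k I).obj R) :
    B ⊗[k] R :=
  (x.down.toMul.1 : B ⊗[k] R) - 1

theorem onePlusVal_mem {I : Ideal B} {R : CommAlgCat.{u} k} (x : (onePlus k I).obj R) :
    onePlusVal x ∈ I.map (algebraMap B (B ⊗[k] R)) :=
  mem_onePlusSubgroup.1 x.down.toMul.2

theorem onePlusVal_injective {I : Ideal B} {R : CommAlgCat.{u} k} :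
    Function.Injective (onePlusVal : (onePlus k I).obj R → B ⊗[k] R) := fun _ _ h =>
  ULift.ext _ _ (Subtype.ext (Units.ext (sub_left_injective h)))

@[simp] theorem onePlusVal_mk {R : CommAlgCat.{u} k} {z : B ⊗[k] R}
    (hz : z ∈ (nilradical B).map (algebraMap B (B ⊗[k] R))) : onePlusVal (onePlusMk hz) = z := by
  change ((isNilpotent_of_mem_map hz).isUnit_one_add.unit : B ⊗[k] R) - 1 = z
  rw [IsUnit.unit_spec, add_sub_cancel_left]

theorem onePlusVal_add {I : Ideal B} {R : CommAlgCat.{u} k} (x y : (onePlus k I).obj R) :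
    onePlusVal (x + y) = onePlusVal x + onePlusVal y + onePlusVal x * onePlusVal y := by
  change (x.down.toMul.1 : B ⊗[k] R) * (y.down.toMul.1 : B ⊗[k] R) - 1 = _
  rw [onePlusVal, onePlusVal]
  ring

theorem onePlusVal_map {I : Ideal B} {R S : CommAlgCat.{u} k} (φ : R ⟶ S)
    (x : (onePlus k I).obj R) : onePlusVal ((onePlus k I).map φ x) =
      mapR B φ.hom (onePlusVal x) := by
  rw [onePlusVal, onePlusVal, map_sub, map_one]
  rfl

theorem onePlusVal_onePlusMap {A : Type u} [CommRing A] [Algebra k A] {I : Ideal A} {J : Ideal B}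
    (f : A →ₐ[k] B) (h : I ≤ J.comap f) {R : CommAlgCat.{u} k} (x : (onePlus k I).obj R) :
    onePlusVal ((onePlusMap f h).app R x) = mapL f R (onePlusVal x) := by
  rw [onePlusVal, onePlusVal, map_sub, map_one]
  rfl

end extended

section nilQuot

variable {k : Type u} [Field k] {B : Type u} [CommRing B] [Algebra k B]

theorem exists_filtered_retraction [Module.Finite k B] (A : Subalgebra k B) :
    ∃ q : B →ₗ[k] B, (∀ x, ∃ a ∈ nilradical A, A.val a = q x) ∧
      (∀ a ∈ nilradical A, q (A.val a) = A.val a) ∧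
      ∀ m, ∀ x ∈ nilradical B ^ m, q x ∈ nilradical B ^ m := by
  obtain ⟨N, hN⟩ := isNilpotent_nilradical_of_finite k B
  obtain ⟨q, h1, h2, h3⟩ := exists_filtered_projection
    (F := fun m => (nilradical B ^ m).restrictScalars k) (fun _ _ h => Ideal.pow_le_pow_right h)
    (by rw [pow_zero, Ideal.one_eq_top]; rfl) (N := N) (by rw [hN]; rfl)
    (((nilradical A).restrictScalars k).map A.val.toLinearMap)
  exact ⟨q, h1, fun a ha => h2 _ ⟨a, ha, rfl⟩, h3⟩

variable {A : Subalgebra k B} {q : B →ₗ[k] B} {R : Type u} [CommRing R] [Algebra k R]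

theorem rTensor_mem_pow {J : Ideal B} (hq : ∀ m, ∀ x ∈ J ^ m, q x ∈ J ^ m) (m : ℕ)
    (x : B ⊗[k] R) (hx : x ∈ J.map (algebraMap B (B ⊗[k] R)) ^ m) :
    q.rTensor R x ∈ J.map (algebraMap B (B ⊗[k] R)) ^ m := by
  rw [← Ideal.map_pow] at hx ⊢
  exact rTensor_mem_map (hq m) hx

theorem exists_mapL_eq_rTensor {I : Ideal A} (hq : ∀ x, ∃ a ∈ I, A.val a = q x) (x : B ⊗[k] R) :
    ∃ a ∈ I.map (algebraMap A (A ⊗[k] R)), mapL A.val R a = q.rTensor R x := by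
  induction x with
  | zero => exact ⟨0, zero_mem _, by simp⟩
  | add x y hx hy =>
    obtain ⟨a, ha, hx⟩ := hx
    obtain ⟨b, hb, hy⟩ := hy
    exact ⟨a + b, add_mem ha hb, by rw [map_add, map_add, hx, hy]⟩
  | tmul x r =>
    obtain ⟨a, ha, hx⟩ := hq x
    refine ⟨a ⊗ₜ r, tmul_mem_map ha r, ?_⟩
    rw [Algebra.TensorProduct.map_tmul, hx]
    rfl

theorem rTensor_mapL {I : Ideal A} (hq : ∀ a ∈ I, q (A.val a) = A.val a) {x : A ⊗[k] R}
    (hx : x ∈ I.map (algebraMap A (A ⊗[k] R))) :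
    q.rTensor R (mapL A.val R x) = mapL A.val R x := by
  refine map_induction (p := fun x => q.rTensor R (mapL A.val R x) = mapL A.val R x)
    (by simp) (fun x y hx hy => ?_) (fun a ha r => ?_) hx
  · rw [map_add, map_add, hx, hy]
  · rw [Algebra.TensorProduct.map_tmul, LinearMap.rTensor_tmul, hq a ha]

variable {ι : Type*} [Fintype ι]

theorem eq_of_sum_tmul_eq {W : Submodule k B} (b : Module.Basis ι k W) {r r' : ι → R}
    (h : ∑ i, (b i : B) ⊗ₜ[k] r i = ∑ i, (b i : B) ⊗ₜ[k] r' i) : r = r' := by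
  classical
  obtain ⟨g, hg⟩ := W.subtype.exists_leftInverse_of_injective W.ker_subtype
  have key : ∀ (r : ι → R) j, pairing (b.coord j ∘ₗ g) R (∑ i, (b i : B) ⊗ₜ[k] r i) = r j := by
    intro r j
    have h1 : ∀ i, g (b i) = b i := fun i => DFunLike.congr_fun hg (b i)
    simp [pairing_tmul, h1, Finsupp.single_apply, ite_smul]
  ext j
  rw [← key r j, h, key]

theorem exists_sum_tmul_eq {J : Ideal B} {W : Submodule k B} (hW : ∀ x ∈ J, x - q x ∈ W)
    (b : Module.Basis ι k W) {x : B ⊗[k] R} (hx : x ∈ J.map (algebraMap B (B ⊗[k] R))) :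
    ∃ r : ι → R, ∑ i, (b i : B) ⊗ₜ[k] r i = x - q.rTensor R x := by
  have h : ∃ w : W ⊗[k] R, W.subtype.rTensor R w = x - q.rTensor R x := by
    refine map_induction (p := fun x => ∃ w : W ⊗[k] R, W.subtype.rTensor R w = x - q.rTensor R x)
      ⟨0, by simp⟩ ?_ (fun c hc r => ?_) hx
    · rintro x y ⟨v, hv⟩ ⟨w, hw⟩
      exact ⟨v + w, by rw [map_add, map_add, hv, hw, add_sub_add_comm]⟩
    · refine ⟨⟨c - q c, hW c hc⟩ ⊗ₜ r, ?_⟩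
      rw [LinearMap.rTensor_tmul, LinearMap.rTensor_tmul, ← TensorProduct.sub_tmul]
      rfl
  obtain ⟨w, hw⟩ := h
  refine ⟨fun i => pairing (b.coord i) R w, ?_⟩
  rw [← hw]
  conv_rhs => rw [← sum_tmul_pairing b w]
  simp

/-- The point `1 + ∑ bᵢ ⊗ rᵢ` of `1 + J`. -/
noncomputable def onePlusSum (b : ι → B) (hb : ∀ i, b i ∈ nilradical B) {R : CommAlgCat.{u} k}
    (r : ι → R) : (onePlus k (nilradical B)).obj R :=
  onePlusMk (z := ∑ i, b i ⊗ₜ[k] r i) (sum_mem fun i _ => tmul_mem_map (hb i) (r i))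

theorem onePlusVal_sum (b : ι → B) (hb : ∀ i, b i ∈ nilradical B) {R : CommAlgCat.{u} k}
    (r : ι → R) : onePlusVal (onePlusSum b hb r) = ∑ i, b i ⊗ₜ[k] r i :=
  onePlusVal_mk _

theorem onePlusSum_map (b : ι → B) (hb : ∀ i, b i ∈ nilradical B) {R S : CommAlgCat.{u} k}
    (φ : R ⟶ S) (r : ι → R) : (onePlus k (nilradical B)).map φ (onePlusSum b hb r) =
      onePlusSum b hb (fun i => φ.hom (r i)) := by
  refine onePlusVal_injective ?_
  rw [onePlusVal_map, onePlusVal_sum, onePlusVal_sum, map_sum]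
  simp

/-- The quotient `(1 + J) / (1 + I)` is isomorphic to an affine space as a functor, already before
passing to the associated sheaf. -/
theorem exists_universal_cokernel [Module.Finite k B] (A : Subalgebra k B) :
    ∃ (d : ℕ) (x : (onePlus k (nilradical B)).obj (.of k (MvPolynomial (Fin d) k))),
      (∀ (R : CommAlgCat.{u} k) (ψ ψ' : CommAlgCat.of k (MvPolynomial (Fin d) k) ⟶ R)
        (n : (onePlus k (nilradical A)).obj R), (onePlusMap A.val (nilradical_le A)).app R n =
          (onePlus k (nilradical B)).map ψ x - (onePlus k (nilradical B)).map ψ' x → ψ = ψ') ∧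
      ∀ (R : CommAlgCat.{u} k) (z : (onePlus k (nilradical B)).obj R),
        ∃ (ψ : CommAlgCat.of k (MvPolynomial (Fin d) k) ⟶ R)
          (n : (onePlus k (nilradical A)).obj R),
          (onePlus k (nilradical B)).map ψ x + (onePlusMap A.val (nilradical_le A)).app R n =
            z := by
  obtain ⟨q, h1, h2, h3⟩ := exists_filtered_retraction A
  let W : Submodule k B := (nilradical B).restrictScalars k ⊓ LinearMap.ker q
  let b := Module.finBasis k W
  have hqJ : ∀ x ∈ nilradical B, q x ∈ nilradical B := by simpa using h3 1
  have hqq : ∀ x, q (q x) = q x := fun x => by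
    obtain ⟨a, ha, hx⟩ := h1 x
    rw [← hx, h2 a ha]
  have hW : ∀ x ∈ nilradical B, x - q x ∈ W := fun x hx =>
    ⟨sub_mem hx (hqJ x hx), LinearMap.mem_ker.2 (by rw [map_sub, hqq, sub_self])⟩
  have hb : ∀ i, (b i : B) ∈ nilradical B := fun i => (b i).2.1
  have hQb : ∀ {R : CommAlgCat.{u} k} (r : Fin _ → R),
      q.rTensor R (∑ i, (b i : B) ⊗ₜ[k] r i) = 0 := fun r => by
    rw [map_sum]
    refine Finset.sum_eq_zero fun i _ => ?_
    rw [LinearMap.rTensor_tmul, LinearMap.mem_ker.1 (b i).2.2, TensorProduct.zero_tmul]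
  have hnil : ∀ R : CommAlgCat.{u} k,
      IsNilpotent ((nilradical B).map (algebraMap B (B ⊗[k] R))) := fun R => by
    obtain ⟨N, hN⟩ := isNilpotent_nilradical_of_finite k B
    exact ⟨N, by rw [← Ideal.map_pow, hN, Ideal.zero_eq_bot, Ideal.map_bot]; rfl⟩
  have hval : ∀ {R : CommAlgCat.{u} k} (n : (onePlus k (nilradical A)).obj R),
      onePlusVal ((onePlusMap A.val (nilradical_le A)).app R n) ∈
        (nilradical B).map (algebraMap B (B ⊗[k] R)) := fun n => onePlusVal_mem _
  refine ⟨_, onePlusSum (fun i => (b i : B)) hb (R := .of k (MvPolynomial (Fin _) k))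
    MvPolynomial.X, fun R ψ ψ' n hn => ?_, fun R z => ?_⟩
  · rw [onePlusSum_map, onePlusSum_map] at hn
    set w := onePlusSum (fun i => (b i : B)) hb (fun i => ψ.hom (MvPolynomial.X i)) with hw
    set w' := onePlusSum (fun i => (b i : B)) hb (fun i => ψ'.hom (MvPolynomial.X i)) with hw'
    have hc := rTensor_mapL h2 (onePlusVal_mem n)
    have hc' := hval n
    rw [onePlusVal_onePlusMap] at hc'
    have hQw : q.rTensor R (onePlusVal w) = 0 := by rw [hw, onePlusVal_sum, hQb]
    have hQw' : q.rTensor R (onePlusVal w') = 0 := by rw [hw', onePlusVal_sum, hQb]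
    have h4 : onePlusVal w = onePlusVal w' + mapL A.val R (onePlusVal n) +
        onePlusVal w' * mapL A.val R (onePlusVal n) := by
      rw [← onePlusVal_onePlusMap A.val (nilradical_le A), ← onePlusVal_add, hn, add_sub_cancel]
    have h5 : onePlusVal w = onePlusVal w' + mapL A.val R (onePlusVal n) := by
      refine eq_of_add_mul_eq (Q := (q.rTensor R).toAddMonoidHom) (hnil R)
        (rTensor_mem_pow h3) (onePlusVal_mem _) (add_mem (onePlusVal_mem _) hc') ?_
      change _ + (_ - q.rTensor R _) * q.rTensor R _ = _ + (_ - q.rTensor R _) * q.rTensor R _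
      rw [map_add, hQw, hQw', hc, mul_zero, add_zero, zero_add, add_sub_cancel_right]
      exact h4
    have h6 := congrArg (q.rTensor R) h5
    rw [map_add, hQw, hQw', hc, zero_add] at h6
    rw [← h6, add_zero, hw, hw', onePlusVal_sum, onePlusVal_sum] at h5
    have h7 := eq_of_sum_tmul_eq b h5
    refine CommAlgCat.hom_ext (MvPolynomial.algHom_ext fun i => congrFun h7 i)
  · obtain ⟨t, ht, htz⟩ := exists_add_mul_eq (Q := (q.rTensor R).toAddMonoidHom) (hnil R)
      (rTensor_mem_pow h3) (onePlusVal_mem z)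
    obtain ⟨r, hr⟩ := exists_sum_tmul_eq hW b ht
    obtain ⟨a, ha, hat⟩ := exists_mapL_eq_rTensor h1 t
    refine ⟨CommAlgCat.ofHom (MvPolynomial.aeval r), onePlusMk ha, onePlusVal_injective ?_⟩
    rw [onePlusSum_map, onePlusVal_add, onePlusVal_onePlusMap, onePlusVal_mk, onePlusVal_sum, hat,
      ← htz]
    simp only [CommAlgCat.hom_ofHom, MvPolynomial.aeval_X]
    rw [hr]
    change _ = t + (t - q.rTensor R t) * q.rTensor R t
    ring

theorem isUnipotent_nilQuot [Module.Finite k B] (A : Subalgebra k B) :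
    IsUnipotent (nilQuot A) := by
  set φ := onePlusMap A.val (nilradical_le A) (k := k)
  obtain ⟨d, x, hinj, hsurj⟩ := exists_universal_cokernel A
  have hmap : ∀ {R S : CommAlgCat.{u} k} (ψ : R ⟶ S) (z : (onePlus k (nilradical B)).obj R),
      (cokernel φ).map ψ ((cokernel.π φ).app R z) =
        (cokernel.π φ).app S ((onePlus k (nilradical B)).map ψ z) := fun ψ z =>
    (ConcreteCategory.congr_hom ((cokernel.π φ).naturality ψ) z).symm
  have hsurj' : ∀ (R : CommAlgCat.{u} k) (z : (cokernel φ).obj R),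
      ∃ ψ : CommAlgCat.of k (MvPolynomial (Fin d) k) ⟶ R,
        (cokernel φ).map ψ ((cokernel.π φ).app _ x) = z := by
    intro R z
    obtain ⟨z, rfl⟩ := cokernel_π_app_surjective φ R z
    obtain ⟨ψ, n, rfl⟩ := hsurj R z
    refine ⟨ψ, ?_⟩
    rw [hmap, map_add, (cokernel_π_app_eq_zero_iff φ).2 ⟨n, rfl⟩, add_zero]
  obtain ⟨e⟩ := nonempty_iso_of_universal ((cokernel.π φ).app _ x) (fun R ψ ψ' h => by
    rw [hmap, hmap, ← sub_eq_zero, ← map_sub] at h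
    obtain ⟨n, hn⟩ := (cokernel_π_app_eq_zero_iff φ).1 h
    exact hinj R ψ ψ' n hn) hsurj'
  obtain ⟨i, -⟩ := exists_iso_fppfQuotient φ (isFppfSheaf_of_representable _ _ e) (cokernel.π φ)
    (fun R z => cokernel_π_app_eq_zero_iff φ) (fun R z =>
      ⟨⊤, (fppfTopology k).top_mem _, fun S ψ _ => cokernel_π_app_surjective φ S _⟩)
  refine isUnipotent_of_universal (.of_iso i ⟨_, inferInstance, ⟨e⟩⟩)
    (i.inv.app _ ((cokernel.π φ).app _ x)) fun R z => ?_
  obtain ⟨ψ, hψ⟩ := hsurj' R (i.hom.app R z)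
  refine ⟨ψ, ?_⟩
  have h1 := ConcreteCategory.congr_hom (i.inv.naturality ψ) ((cokernel.π φ).app _ x)
  refine h1.symm.trans ?_
  refine (congrArg (i.inv.app R) hψ).trans ?_
  exact ConcreteCategory.congr_hom (i.hom_inv_id_app R) z

end nilQuot

end RelUnits

theorem mainTheorem5 {k : Type u} [Field k] {B : Type u} [CommRing B] [Algebra k B]
    [Module.Finite k B] (A : Subalgebra k B) :
    ((∃! s : sepTop k B →ₐ[k] B, (toRed k B).comp s = (sepTop k B).val) ∧
      ∀ s : sepTop k B →ₐ[k] B, (toRed k B).comp s = (sepTop k B).val →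
        ∃ hs : ∀ x, s (sepIncl A x) ∈ A, IsMaximalTorus (sepToRelMu A s hs)) ∧
    (PerfectField k → sepTop k B = ⊤) ∧
    (sepTop k B = ⊤ →
      sepSub A = redSub A ∧
      (∃ e : relMu A.val ≅ nilQuot A ⨯ relMu (redSub A).val,
        nilQuotIncl A ≫ e.hom ≫ Limits.prod.fst = 𝟙 (nilQuot A) ∧
        e.hom ≫ Limits.prod.snd = relMuToRed A) ∧
      IsUnipotent (nilQuot A) ∧
      IsTorus (relMu (redSub A).val)) := by
  have := etale_sepPart (⊤ : Subalgebra k (Red B))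
  have := etale_sepPart (redSub A)
  refine ⟨⟨existsUnique_lift _, fun s hs => ⟨lift_sepIncl_mem hs, ?_, ?_, ?_⟩⟩,
    fun _ => sepTop_eq_top_of_perfectField, fun h => ⟨sepSub_eq_redSub h A, ?_, ?_, ?_⟩⟩
  · exact isTorus_relMu _ (Subalgebra.inclusion_injective _)
  · exact isClosedImmersion_sepToRelMu hs _
  · exact fun K _ _ T' i hT' _ => exists_hom_of_isTorus (isClosedImmersion_sepToRelMu hs _)
      (fun R m hm h h0 => exists_of_nsmul_eq_zero hs _ hm h0) K i hT'
  · exact exists_iso_prod h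
  · exact isUnipotent_nilQuot A
  · rw [← sepSub_eq_redSub h A]
    have : Algebra.Etale k (Red B) :=
      etale_of_injective (((Subalgebra.topEquiv : _ ≃ₐ[k] Red B).symm.trans
        (Subalgebra.equivOfEq _ _ h).symm).toAlgHom) (AlgEquiv.injective _)
    exact isTorus_relMu _ Subtype.val_injective
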